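/- Let $d\ge 1$, $G\in \mathrm{GL}_{1+d}(\mathbb{R})$, and for $\xi\in\mathbb{R}^d$, $\|\xi\|<1$, put $\sigma(\xi)=(\sqrt{1-\|\xi\|^2},\xi)\in\mathbb{R}^{1+d}$ and $g(\xi)=\boldsymbol{\pi}({}^tG\,\sigma(\xi))\in\mathbb{R}^d$, where $\boldsymbol{\pi}:\mathbb{R}^{1+d}\to\mathbb{R}^d$ forgets the zeroth coordinate. For $\hbar>0$ and $\varphi\in C_c^\infty(\{\|\eta\|<1\})$ let \[ (V_G\varphi)(x)=\frac{1}{(2\pi\hbar)^d}\int_{\mathbb{R}^d} e^{\frac{i}{\hbar}\langle G(0,x),\sigma(\eta)\rangle}\varphi(\eta)\,d\eta ,\qquad x\in\mathbb{R}^d . \] For a symbol $p$ let $\mathrm{Op}_\hbar^w(p)$ be the operator on Schwartz functions, extended by duality to tempered distributions, with kernel $\int_{\mathbb{R}^d} e^{\frac{i}{\hbar}\langle x-y,\xi\rangle}p(\tfrac{x+y}{2},\xi)\,d\xi$ (that is, normalized without the factor $(2\pi\hbar)^{-d}$; with that factor, the kernel below is multiplied by $(2\pi\hbar)^{-d}$).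 Let $m$ be an order function on $\mathbb{R}^{2d}$, i.e. $m>0$ and $m(w)\le C(1+|w-z|)^N m(z)$ for all $z,w$ and some constants $C,N$; let $S(m)$ be the class of smooth functions $a:\mathbb{R}^{2d}\to\mathbb{C}$ all of whose derivatives of each order are bounded by a constant times $m$. Let $\hbar_0>0$ and let $p_\hbar=p_0+\hbar p_1+O(\hbar^2)$ for $0<\hbar\le\hbar_0$, with $p_0,p_1\in S(m)$ independent of $\hbar$, and $O(\hbar^2)$ meant in $S(m)$: each derivative of the (smooth) remainder is bounded by $C\hbar^2 m$ with $C$ independent of $\hbar$. Let $P=\mathrm{Op}_\hbar^w(p_\hbar)$. Then, for every $\hbar\in(0,\hbar_0]$, the Schwartz kernel $K_{PV_G}$ of $PV_G$ is a smooth function of $(x,\eta)\in\mathbb{R}^d\times\{\|\eta\|<1\}$, that is, \[ \langle PV_G\varphi,v\rangle=\iint K_{PV_G}(x,\eta)\,v(x)\,\varphi(\eta)\,dx\,d\eta \] for all $\varphi\in C_c^\infty(\{\|\eta\|<1\})$ and all Schwartz functions $v$ on $\mathbb{R}^d$, both sides being given by absolutely convergent integrals, with $\langle Pu,v\rangle=\int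 u\,({}^tPv)$ for the bounded function $u=V_G\varphi$. Moreover, with $\tilde\xi=g(\eta)$, \[ K_{PV_G}(x,\eta)=e^{\frac{i}{\hbar}\langle x,\tilde\xi\rangle}\Big(p_0(x,\tilde\xi)+\hbar p_1(x,\tilde\xi)-\frac{i\hbar}{2}\langle\partial_{\tilde\xi},\partial_x\rangle p_0(x,\tilde\xi)+O(\hbar^2)\Big), \] where $\langle\partial_{\xi},\partial_x\rangle=\sum_{j=1}^d\partial_{\xi_j}\partial_{x_j}$ and $O(\hbar^2)$ denotes a family of smooth functions of $(x,\eta)$ each of whose derivatives in $(x,\eta)$ is $O(\hbar^2)$ uniformly on every compact subset of $\mathbb{R}^d\times\{\|\eta\|<1\}$, for $0<\hbar\le\hbar_0$. -/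

import Mathlib

open MeasureTheory Set
open scoped ContDiff SchwartzMap

noncomputable section

namespace TiltedFIO

/-- Euclidean space of dimension `d`. -/
abbrev E (d : ℕ) : Type := EuclideanSpace ℝ (Fin d)

/-- `(X₀, X)` in dimension `1 + d`, from `X₀` in `ℝ` and `X` in dimension `d`. -/
def lift {d : ℕ} (t : ℝ) (x : E d) : E (d + 1) :=
  WithLp.toLp 2 (Fin.cons t (fun j => x j))

/-- The projection `π (X₀, X) = X` that forgets the zeroth coordinate. -/
def proj {d : ℕ} (X : E (d + 1)) : E d :=
  WithLp.toLp 2 (fun j => X j.succ)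

/-- `σ(ξ) = (√(1 - |ξ|²), ξ)`; it is only used for `|ξ| < 1`. -/
def sigma {d : ℕ} (ξ : E d) : E (d + 1) :=
  lift (Real.sqrt (1 - ‖ξ‖ ^ 2)) ξ

/-- The action of a matrix on a vector of Euclidean space. -/
def act {n : ℕ} (A : Matrix (Fin n) (Fin n) ℝ) (X : E n) : E n :=
  WithLp.toLp 2 (A.mulVec X.ofLp)

/-- `g = π ∘ ᵗG ∘ σ`. -/
def gMap {d : ℕ} (G : Matrix (Fin (d + 1)) (Fin (d + 1)) ℝ) (η : E d) : E d :=
  proj (act G.transpose (sigma η))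

/-- The oscillating factor `exp (i t / ħ)`. -/
def osc (ħ t : ℝ) : ℂ := Complex.exp (Complex.I * ((t / ħ : ℝ) : ℂ))

/-- `(V_G φ)(x) = (2πħ)^{-d} ∫ exp (i ⟨G (0, x), σ(η)⟩ / ħ) φ(η) dη`. -/
def opV {d : ℕ} (ħ : ℝ) (G : Matrix (Fin (d + 1)) (Fin (d + 1)) ℝ) (φ : E d → ℂ) (x : E d) : ℂ :=
  (((2 * Real.pi * ħ) ^ d : ℝ) : ℂ)⁻¹ *
    ∫ η : E d, osc ħ (inner ℝ (act G (lift 0 x)) (sigma η)) * φ η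

/-- The Weyl operator `Op_ħ^w(p)` on Schwartz functions `u`: the operator with kernel
`∫ exp (i ⟨x - y, ξ⟩ / ħ) p ((x + y) / 2, ξ) dξ`, in the normalization without the factor
`(2πħ)^{-d}`. For a symbol `p` in a class `S(m)` and a Schwartz function `u` the two successive
integrals converge absolutely. -/
def weylOp {d : ℕ} (ħ : ℝ) (p : E d × E d → ℂ) (u : E d → ℂ) (x : E d) : ℂ :=
  ∫ ξ : E d, ∫ y : E d,
    osc ħ (inner ℝ (x - y) ξ) * p ((1 / 2 : ℝ) • (x + y), ξ) * u y

/-- The transpose of `Op_ħ^w(p)` for the bilinear pairing `∫ u v`, that is, the operator obtained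
by integrating the kernel of `Op_ħ^w(p)` against its first variable. -/
def weylTranspose {d : ℕ} (ħ : ℝ) (p : E d × E d → ℂ) (v : E d → ℂ) (y : E d) : ℂ :=
  ∫ ξ : E d, ∫ x : E d,
    osc ħ (inner ℝ (x - y) ξ) * p ((1 / 2 : ℝ) • (x + y), ξ) * v x

/-- An order function on phase space: positive and of tempered variation. -/
def IsOrderFunction {d : ℕ} (m : E d × E d → ℝ) : Prop :=
  (∀ z, 0 < m z) ∧ ∃ (C : ℝ) (N : ℕ), ∀ z w, m w ≤ C * (1 + ‖w - z‖) ^ N * m z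

/-- The family `a_ħ`, `0 < ħ ≤ ħ₀`, is `O(ħ^n)` in the symbol class `S(m)`: it consists of smooth
functions, and all derivatives are bounded by `C ħ^n m`, with `C` independent of `ħ`. -/
def IsSymbolO {d : ℕ} (m : E d × E d → ℝ) (ħ₀ : ℝ) (n : ℕ) (a : ℝ → E d × E d → ℂ) : Prop :=
  (∀ ħ ∈ Ioc 0 ħ₀, ContDiff ℝ ∞ (a ħ)) ∧
    ∀ k : ℕ, ∃ C : ℝ, ∀ ħ ∈ Ioc 0 ħ₀, ∀ z, ‖iteratedFDeriv ℝ k (a ħ) z‖ ≤ C * ħ ^ n * m z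

/-- The symbol class `S(m)`. -/
def IsSymbol {d : ℕ} (m : E d × E d → ℝ) (a : E d × E d → ℂ) : Prop :=
  ContDiff ℝ ∞ a ∧ ∀ k : ℕ, ∃ C : ℝ, ∀ z, ‖iteratedFDeriv ℝ k a z‖ ≤ C * m z

/-- The family `r_ħ`, `0 < ħ ≤ ħ₀`, is `O(ħ^n)` in the topology of `C^∞(U)`, for `U` open: all
derivatives are `O(ħ^n)` uniformly on each compact subset of `U`. -/
def IsSmoothO {d : ℕ} (U : Set (E d × E d)) (ħ₀ : ℝ) (n : ℕ) (r : ℝ → E d × E d → ℂ) : Prop :=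
  (∀ ħ ∈ Ioc 0 ħ₀, ContDiffOn ℝ ∞ (r ħ) U) ∧
    ∀ S ⊆ U, IsCompact S → ∀ k : ℕ, ∃ C : ℝ, ∀ ħ ∈ Ioc 0 ħ₀, ∀ z ∈ S,
      ‖iteratedFDeriv ℝ k (r ħ) z‖ ≤ C * ħ ^ n

/-- `⟨∂_ξ, ∂_x⟩ a = ∑ j, ∂_{ξ_j} ∂_{x_j} a`, at `(x, ξ)`. -/
def mixedDeriv {d : ℕ} (a : E d × E d → ℂ) (x ξ : E d) : ℂ :=
  ∑ j : Fin d,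
    fderiv ℝ (fun ξ' : E d =>
      fderiv ℝ (fun x' : E d => a (x', ξ')) x (EuclideanSpace.single j 1)) ξ
        (EuclideanSpace.single j 1)

/-- The region of `(x, η)` with `|η| < 1`. -/
def region (d : ℕ) : Set (E d × E d) := univ ×ˢ Metric.ball 0 1

/-- The Schwartz kernel of `P V_G`, `P = Op_ħ^w(p)`, over `|η| < 1` is the smooth function `K`:
for every test function `φ` supported in the open unit ball and every Schwartz function `v`,
`⟨P V_G φ, v⟩ = ∫∫ K(x, η) v(x) φ(η) dx dη`. As `V_G φ` is a bounded function, which need not be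
a Schwartz function, `P` acts on it as on a tempered distribution, that is, by duality:
`⟨P u, v⟩ = ∫ u (ᵗP v)`. -/
structure IsKernelPV {d : ℕ} (ħ : ℝ) (p : E d × E d → ℂ)
    (G : Matrix (Fin (d + 1)) (Fin (d + 1)) ℝ) (K : E d × E d → ℂ) : Prop where
  smooth : ContDiffOn ℝ ∞ K (region d)
  pairing : ∀ φ : E d → ℂ, ContDiff ℝ ∞ φ → HasCompactSupport φ → tsupport φ ⊆ Metric.ball 0 1 →
    ∀ v : 𝓢(E d, ℂ),
      Integrable (fun y : E d => opV ħ G φ y * weylTranspose ħ p v y) ∧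
      Integrable (fun z : E d × E d => K z * (v z.1 * φ z.2)) ∧
      ∫ y : E d, opV ħ G φ y * weylTranspose ħ p v y =
        ∫ z : E d × E d, K z * (v z.1 * φ z.2)

end TiltedFIO

end

noncomputable section

namespace TiltedFIO

set_option linter.unusedSectionVars false

/-! Since `⟨G(0,x),σ(η)⟩ = ⟨x,g(η)⟩` (`inner_act_lift`), `V_G φ` is a superposition of plane waves
with frequencies `g(η)`. Everything reduces to the action of `P` on one plane wave. Substituting `y
= x + h s`, `ξ = ζ + h θ` with `h = √ħ` gives, formally, `P e^{i⟨·,ζ⟩/ħ} = (2πħ)^d e^{i⟨·,ζ⟩/ħ} (T_h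
p)(·,ζ)`, where `T_h f(z) = (2π)^{-d} ∫ e^{-i⟨s,θ⟩} f(z + (h s/2, h θ)) ds dθ` is
`exp(-(iħ/2)⟨∂_ξ,∂_x⟩)`. The factor `(2πħ)^d` cancels the one in `V_G`. So the kernel is exactly
`e^{i⟨x,g(η)⟩/ħ} (T_h p)(x,g(η))` (`integral_osc_weylTranspose`, `isKernelPV_kernelPV`), and the
asymptotics are those of `T_h p` as `h → 0`.

For amplitudes of polynomial growth `T_h` (`transf`) is an oscillatory integral, made absolutely
convergent by `M` integrations by parts, each of which lowers the order by one (`ampOp_bound`,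
`integral_phase_smul_ampOp`). `T_h` commutes with derivatives and is bounded on symbols, uniformly
for bounded `h` (`exists_symB_transf`).

The expansion comes from an evolution equation: `d/dh T_h f = h T_h (mixOp f)` (`hasDerivAt_transf`)
and `T_h f → f` as `h → 0` (`tendsto_transf_zero`, whose constant is found by Fourier inversion in
`oscInt_one`). Integrating once gives `T_h f - f = O(h²)`. Inserting this into the equation and
integrating again gives `T_h f = f + (h²/2) mixOp f + O(h⁴)`, that is, an error `O(ħ²)`. Because the
target space `V` is arbitrary, applying the pointwise estimates to the derivatives of `f` controls
all derivatives.

The evolution equation and the duality formula are proved first for compactly supported amplitudes,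
where the integrals converge absolutely, and then extended by cutoffs. This requires constants
independent of the cutoff, of `h` and of the base point, which is why `SymB` carries an explicit
sequence of bounds. -/

lemma one_add_norm_pos {X : Type} [NormedAddCommGroup X] (w : X) : 0 < 1 + ‖w‖ := by positivity

lemma one_le_one_add_norm {X : Type} [NormedAddCommGroup X] (w : X) : 1 ≤ 1 + ‖w‖ := by linarith [norm_nonneg w]

lemma one_add_norm_add_le {X : Type} [NormedAddCommGroup X] (z w : X) : 1 + ‖z + w‖ ≤ (1 + ‖z‖) * (1 + ‖w‖) := by
  nlinarith [norm_add_le z w, norm_nonneg z, norm_nonneg w, mul_nonneg (norm_nonneg z) (norm_nonneg w)]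

lemma one_add_norm_rpow_pos {X : Type} [NormedAddCommGroup X] (w : X) (r : ℝ) : 0 < (1 + ‖w‖) ^ r :=
  Real.rpow_pos_of_pos (one_add_norm_pos w) r

/-- Peetre's inequality for negative powers. -/
lemma peetre {X : Type} [NormedAddCommGroup X] {r : ℝ} (hr : 0 ≤ r) (z w : X) :
    (1 + ‖z + w‖) ^ (-r) ≤ (1 + ‖z‖) ^ (-r) * (1 + ‖w‖) ^ r := by
  have h : 1 + ‖z‖ ≤ (1 + ‖z + w‖) * (1 + ‖w‖) := by
    have := one_add_norm_add_le (z + w) (-w)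
    simpa using this
  have h1 := one_add_norm_pos z
  have h2 := one_add_norm_pos (z + w)
  have h3 := Real.rpow_le_rpow h1.le h hr
  rw [Real.mul_rpow h2.le (one_add_norm_pos w).le] at h3
  rw [Real.rpow_neg h2.le, Real.rpow_neg h1.le, inv_mul_eq_div,
    le_div_iff₀ (Real.rpow_pos_of_pos h1 r), inv_mul_le_iff₀ (Real.rpow_pos_of_pos h2 r)]
  exact h3

/-! ### Calculus of symbol estimates with explicit constants -/

section SymbolBounds

variable {X Y V V' : Type} [NormedAddCommGroup X] [NormedSpace ℝ X]
  [NormedAddCommGroup Y] [NormedSpace ℝ Y]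
  [NormedAddCommGroup V] [NormedSpace ℝ V] [NormedAddCommGroup V'] [NormedSpace ℝ V']

/-- `f` is smooth, and its derivative of order `k` is bounded by `B k * (1 + ‖w‖) ^ r`. -/
def SymB (r : ℝ) (B : ℕ → ℝ) (f : X → V) : Prop :=
  ContDiff ℝ ∞ f ∧ ∀ k w, ‖iteratedFDeriv ℝ k f w‖ ≤ B k * (1 + ‖w‖) ^ r

lemma SymB.nonneg {r : ℝ} {B : ℕ → ℝ} {f : X → V} (h : SymB r B f) (k : ℕ) : 0 ≤ B k := by
  have := (norm_nonneg _).trans (h.2 k 0)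
  simpa using this

lemma SymB.norm_le {r : ℝ} {B : ℕ → ℝ} {f : X → V} (h : SymB r B f) (w : X) :
    ‖f w‖ ≤ B 0 * (1 + ‖w‖) ^ r := by
  simpa using h.2 0 w

lemma SymB.differentiable {r : ℝ} {B : ℕ → ℝ} {f : X → V} (h : SymB r B f) :
    Differentiable ℝ f := h.1.differentiable (by simp)

lemma SymB.mono {r r' : ℝ} {B B' : ℕ → ℝ} {f : X → V} (h : SymB r B f) (hr : r ≤ r')
    (hB : ∀ k, B k ≤ B' k) : SymB r' B' f := by
  refine ⟨h.1, fun k w => (h.2 k w).trans ?_⟩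
  have h1 := Real.rpow_le_rpow_of_exponent_le (one_le_one_add_norm w) hr
  have h2 := one_add_norm_rpow_pos w r
  exact mul_le_mul (hB k) h1 h2.le ((h.nonneg k).trans (hB k))

lemma SymB.mono_exp {r r' : ℝ} {B : ℕ → ℝ} {f : X → V} (h : SymB r B f) (hr : r ≤ r') :
    SymB r' B f := h.mono hr fun _ => le_rfl

lemma SymB.add {r : ℝ} {B B' : ℕ → ℝ} {f g : X → V} (hf : SymB r B f) (hg : SymB r B' g) :
    SymB r (fun k => B k + B' k) (fun w => f w + g w) := by
  refine ⟨hf.1.add hg.1, fun k w => ?_⟩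
  change ‖iteratedFDeriv ℝ k (f + g) w‖ ≤ _
  rw [iteratedFDeriv_add_apply (hf.1.of_le (by exact_mod_cast le_top)).contDiffAt
    (hg.1.of_le (by exact_mod_cast le_top)).contDiffAt]
  refine (norm_add_le _ _).trans ?_
  rw [add_mul]
  exact add_le_add (hf.2 k w) (hg.2 k w)

lemma SymB.const_smul {𝕜 : Type} [NormedField 𝕜] [NormedSpace 𝕜 V]
    [SMulCommClass ℝ 𝕜 V] {r : ℝ} {B : ℕ → ℝ} {f : X → V} (hf : SymB r B f) (c : 𝕜) :
    SymB r (fun k => ‖c‖ * B k) (fun w => c • f w) := by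
  refine ⟨hf.1.const_smul c, fun k w => ?_⟩
  change ‖iteratedFDeriv ℝ k (c • f) w‖ ≤ _
  rw [iteratedFDeriv_const_smul_apply (hf.1.of_le (by exact_mod_cast le_top)).contDiffAt,
    norm_smul, mul_assoc]
  exact mul_le_mul_of_nonneg_left (hf.2 k w) (norm_nonneg c)

lemma SymB.sub {r : ℝ} {B B' : ℕ → ℝ} {f g : X → V} (hf : SymB r B f) (hg : SymB r B' g) :
    SymB r (fun k => B k + B' k) (fun w => f w - g w) := by
  have := hf.add (hg.const_smul (-1 : ℝ))
  simpa [sub_eq_add_neg] using this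

/-- The bounds that the Leibniz rule gives for a product. -/
def leibniz (B B' : ℕ → ℝ) (k : ℕ) : ℝ :=
  ∑ i ∈ Finset.range (k + 1), (k.choose i : ℝ) * B i * B' (k - i)

lemma leibniz_bound {r r' : ℝ} {B B' : ℕ → ℝ} {f : X → V} {g : X → V'} (hf : SymB r B f)
    (hg : SymB r' B' g) (k : ℕ) (w : X) :
    ∑ i ∈ Finset.range (k + 1),
      (k.choose i : ℝ) * ‖iteratedFDeriv ℝ i f w‖ * ‖iteratedFDeriv ℝ (k - i) g w‖ ≤
        leibniz B B' k * (1 + ‖w‖) ^ (r + r') := by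
  rw [leibniz, Finset.sum_mul]
  refine Finset.sum_le_sum fun i _ => ?_
  rw [Real.rpow_add (one_add_norm_pos w)]
  calc _ ≤ (k.choose i : ℝ) * (B i * (1 + ‖w‖) ^ r) * (B' (k - i) * (1 + ‖w‖) ^ r') := by
        have := hf.nonneg i
        have := one_add_norm_rpow_pos w r
        gcongr
        · exact hf.2 i w
        · exact hg.2 _ w
    _ = _ := by ring

lemma SymB.smul {𝕜 : Type} [NormedField 𝕜] [NormedAlgebra ℝ 𝕜] [NormedSpace 𝕜 V]
    [IsScalarTower ℝ 𝕜 V] {r r' : ℝ} {B B' : ℕ → ℝ} {f : X → 𝕜} {g : X → V} (hf : SymB r B f)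
    (hg : SymB r' B' g) : SymB (r + r') (leibniz B B') (fun w => f w • g w) :=
  ⟨hf.1.smul hg.1, fun k w => (norm_iteratedFDeriv_smul_le hf.1 hg.1 w
    (by exact_mod_cast le_top)).trans (leibniz_bound hf hg k w)⟩

lemma SymB.clm_apply {r r' : ℝ} {B B' : ℕ → ℝ} {f : X → V →L[ℝ] V'} {g : X → V}
    (hf : SymB r B f) (hg : SymB r' B' g) :
    SymB (r + r') (leibniz B B') (fun w => f w (g w)) :=
  ⟨hf.1.clm_apply hg.1, fun k w => (norm_iteratedFDeriv_clm_apply hf.1 hg.1 w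
    (by exact_mod_cast le_top)).trans (leibniz_bound hf hg k w)⟩

lemma SymB.fderiv {r : ℝ} {B : ℕ → ℝ} {f : X → V} (hf : SymB r B f) :
    SymB r (fun k => B (k + 1)) (_root_.fderiv ℝ f) :=
  ⟨(contDiff_infty_iff_fderiv.1 hf.1).2, fun k w => by
    rw [norm_iteratedFDeriv_fderiv]; exact hf.2 (k + 1) w⟩

lemma SymB.clm_apply_const {r : ℝ} {B : ℕ → ℝ} {f : X → V →L[ℝ] V'} (hf : SymB r B f) (v : V) :
    SymB r (fun k => ‖v‖ * B k) (fun w => f w v) :=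
  ⟨hf.1.clm_apply contDiff_const, fun k w => by
    refine (norm_iteratedFDeriv_clm_apply_const (N := ∞) hf.1.contDiffAt
      (by exact_mod_cast le_top)).trans ?_
    rw [mul_assoc]
    exact mul_le_mul_of_nonneg_left (hf.2 k w) (norm_nonneg v)⟩

lemma SymB.fderiv_apply {r : ℝ} {B : ℕ → ℝ} {f : X → V} (hf : SymB r B f) (v : X) :
    SymB r (fun k => ‖v‖ * B (k + 1)) (fun w => _root_.fderiv ℝ f w v) :=
  hf.fderiv.clm_apply_const v

lemma norm_iteratedFDeriv_comp_affine_le {f : X → V} (hf : ContDiff ℝ ∞ f) (z : X)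
    (L : Y →L[ℝ] X) (k : ℕ) (w : Y) :
    ‖iteratedFDeriv ℝ k (fun w => f (z + L w)) w‖ ≤
      ‖iteratedFDeriv ℝ k f (z + L w)‖ * ‖L‖ ^ k := by
  have h1 : ContDiff ℝ ∞ (fun x => f (z + x)) := hf.comp (contDiff_const.add contDiff_id)
  have := L.iteratedFDeriv_comp_right h1 w (i := k) (by exact_mod_cast le_top)
  change ‖iteratedFDeriv ℝ k ((fun x => f (z + x)) ∘ L) w‖ ≤ _
  rw [this, iteratedFDeriv_comp_add_left]
  refine (ContinuousMultilinearMap.norm_compContinuousLinearMap_le _ _).trans ?_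
  simp

lemma one_add_norm_clm_le (L : Y →L[ℝ] X) {Λ : ℝ} (hL : ‖L‖ ≤ Λ) (w : Y) :
    1 + ‖L w‖ ≤ (1 + Λ) * (1 + ‖w‖) := by
  have h0 := L.le_opNorm w
  have h1 := mul_le_mul_of_nonneg_right hL (norm_nonneg w)
  nlinarith [norm_nonneg w, (norm_nonneg L).trans hL]

lemma one_add_norm_affine_rpow_le {r : ℝ} (hr : 0 ≤ r) (z : X) (L : Y →L[ℝ] X) {Λ : ℝ}
    (hL : ‖L‖ ≤ Λ) (w : Y) :
    (1 + ‖z + L w‖) ^ r ≤ (1 + ‖z‖) ^ r * (1 + Λ) ^ r * (1 + ‖w‖) ^ r := by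
  have hΛ : 0 ≤ Λ := (norm_nonneg L).trans hL
  rw [← Real.mul_rpow (by positivity) (by positivity), ← Real.mul_rpow (by positivity) (by positivity),
    mul_assoc]
  refine Real.rpow_le_rpow (by positivity) ((one_add_norm_add_le _ _).trans ?_) hr
  gcongr
  exact one_add_norm_clm_le L hL w

/-- The weight is submultiplicative, so the base point `z` separates from the variable `w` and
survives only as the scalar `(1 + ‖z‖) ^ r`. This scalar later becomes the growth of `transf` in
`z`. -/
lemma SymB.comp_affine {r : ℝ} (hr : 0 ≤ r) {B : ℕ → ℝ} {f : X → V} (hf : SymB r B f) (z : X)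
    (L : Y →L[ℝ] X) {Λ : ℝ} (hL : ‖L‖ ≤ Λ) :
    SymB r (fun k => (1 + ‖z‖) ^ r * ((1 + Λ) ^ r * Λ ^ k * B k)) (fun w => f (z + L w)) := by
  have hΛ : 0 ≤ Λ := (norm_nonneg L).trans hL
  refine ⟨hf.1.comp (contDiff_const.add L.contDiff), fun k w => ?_⟩
  refine (norm_iteratedFDeriv_comp_affine_le hf.1 z L k w).trans ?_
  calc _ ≤ (B k * ((1 + ‖z‖) ^ r * (1 + Λ) ^ r * (1 + ‖w‖) ^ r)) * Λ ^ k := by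
        have := hf.nonneg k
        gcongr
        exact (hf.2 k _).trans (mul_le_mul_of_nonneg_left
          (one_add_norm_affine_rpow_le hr z L hL w) this)
    _ = _ := by ring

/-- A rapidly decaying function of an affine expression, with the decay moved to the constant
term. -/
lemma SymB.comp_affine_neg {r : ℝ} (hr : 0 ≤ r) {B : ℕ → ℝ} {f : X → V} (hf : SymB (-r) B f)
    (z : X) (L : Y →L[ℝ] X) {Λ : ℝ} (hL : ‖L‖ ≤ Λ) :
    SymB r (fun k => (1 + ‖z‖) ^ (-r) * ((1 + Λ) ^ r * Λ ^ k * B k)) (fun w => f (z + L w)) := by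
  have hΛ : 0 ≤ Λ := (norm_nonneg L).trans hL
  refine ⟨hf.1.comp (contDiff_const.add L.contDiff), fun k w => ?_⟩
  refine (norm_iteratedFDeriv_comp_affine_le hf.1 z L k w).trans ?_
  calc _ ≤ (B k * ((1 + ‖z‖) ^ (-r) * ((1 + Λ) ^ r * (1 + ‖w‖) ^ r))) * Λ ^ k := by
        have := hf.nonneg k
        gcongr
        refine (hf.2 k _).trans (mul_le_mul_of_nonneg_left ?_ this)
        refine (peetre hr z (L w)).trans ?_
        gcongr
        rw [← Real.mul_rpow (by positivity) (by positivity)]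
        exact Real.rpow_le_rpow (by positivity) (one_add_norm_clm_le L hL w) hr
    _ = _ := by ring

/-- A rapidly decaying function of an expanding affine expression. -/
lemma SymB.comp_affine_expanding {r : ℝ} (hr : 0 ≤ r) {B : ℕ → ℝ} {f : X → V}
    (hf : SymB (-r) B f) (z : X) (L : Y →L[ℝ] X) {c : ℝ} (hc : 0 < c)
    (hL : ∀ w, c * (1 + ‖w‖) ≤ 1 + ‖L w‖) :
    SymB (-r) (fun k => (1 + ‖z‖) ^ r * c ^ (-r) * ‖L‖ ^ k * B k) (fun w => f (z + L w)) := by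
  refine ⟨hf.1.comp (contDiff_const.add L.contDiff), fun k w => ?_⟩
  refine (norm_iteratedFDeriv_comp_affine_le hf.1 z L k w).trans ?_
  calc _ ≤ (B k * ((c ^ (-r) * (1 + ‖w‖) ^ (-r)) * (1 + ‖z‖) ^ r)) * ‖L‖ ^ k := by
        have := hf.nonneg k
        gcongr
        refine (hf.2 k _).trans (mul_le_mul_of_nonneg_left ?_ this)
        rw [add_comm z]
        refine (peetre hr (L w) z).trans ?_
        gcongr
        rw [← Real.mul_rpow hc.le (by positivity)]
        exact Real.rpow_le_rpow_of_nonpos (by positivity) (hL w) (by linarith)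
    _ = _ := by ring

lemma SymB.const (v : V) : SymB 0 (fun k => if k = 0 then ‖v‖ else 0) (fun _ : X => v) := by
  refine ⟨contDiff_const, fun k w => ?_⟩
  rcases Nat.eq_zero_or_pos k with rfl | hk
  · simp
  · rw [iteratedFDeriv_const_of_ne hk.ne']
    simp [hk.ne']

lemma SymB.clm (L : X →L[ℝ] V) : SymB 1 (fun k => if k ≤ 1 then ‖L‖ else 0) (fun w => L w) := by
  refine ⟨L.contDiff, fun k w => ?_⟩
  rw [Real.rpow_one]
  have hw := norm_nonneg w
  have hL := norm_nonneg L
  match k with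
  | 0 => simpa using (L.le_opNorm w).trans (by nlinarith)
  | 1 =>
    rw [← zero_add 1, ← norm_iteratedFDeriv_fderiv]
    have : _root_.fderiv ℝ (fun w => L w) = fun _ => L := by ext1 w; exact L.fderiv
    rw [this]
    simp
    nlinarith
  | k + 2 =>
    rw [← norm_iteratedFDeriv_fderiv]
    have : _root_.fderiv ℝ (fun w => L w) = fun _ => L := by ext1 w; exact L.fderiv
    rw [this, iteratedFDeriv_const_of_ne (by omega)]
    simp

/-- Places a compactly supported amplitude in an order negative enough for absolute convergence. -/
lemma SymB.exists_of_hasCompactSupport {f : X → V} (hf : ContDiff ℝ ∞ f)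
    (hs : HasCompactSupport f) (r : ℝ) : ∃ B, SymB r B f := by
  have h : ∀ k, ∃ C, ∀ w, ‖(1 + ‖w‖) ^ (-r) * ‖iteratedFDeriv ℝ k f w‖‖ ≤ C := by
    intro k
    have hc : Continuous (fun w => (1 + ‖w‖) ^ (-r) * ‖iteratedFDeriv ℝ k f w‖) := by
      refine Continuous.mul ?_ (hf.continuous_iteratedFDeriv (by exact_mod_cast le_top)).norm
      exact (continuous_const.add continuous_norm).rpow_const
        fun w => Or.inl (one_add_norm_pos w).ne'
    have hk : HasCompactSupport (fun w => ‖iteratedFDeriv ℝ k f w‖) := (hs.iteratedFDeriv k).norm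
    exact hk.mul_left.exists_bound_of_continuous hc
  choose C hC using h
  refine ⟨C, hf, fun k w => ?_⟩
  have := (le_abs_self _).trans (hC k w)
  have h1 := one_add_norm_rpow_pos w r
  rw [Real.rpow_neg (one_add_norm_pos w).le, inv_mul_le_iff₀ h1] at this
  linarith

end SymbolBounds

/-! ### Integration by parts against `e^{-i⟨s,θ⟩}`: the operator on amplitudes -/

section Amplitude

open Filter Topology

/-- Phase space. -/
abbrev PS (d : ℕ) : Type := E d × E d

instance instIsAddHaarMeasurePS (d : ℕ) : (volume : Measure (PS d)).IsAddHaarMeasure := by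
  rw [Measure.volume_eq_prod]; infer_instance

lemma finrank_PS (d : ℕ) : Module.finrank ℝ (PS d) = 2 * d := by
  simp [two_mul]

variable {d : ℕ} {V V' : Type} [NormedAddCommGroup V] [NormedSpace ℝ V] [NormedSpace ℂ V]
  [IsScalarTower ℝ ℂ V] [NormedAddCommGroup V'] [NormedSpace ℝ V'] [NormedSpace ℂ V']
  [IsScalarTower ℝ ℂ V']

/-- The derivative of `1 + |s|² + |θ|²`. -/
def dWeight (d : ℕ) : PS d →L[ℝ] PS d →L[ℝ] ℝ :=
  (2 : ℝ) • ((ContinuousLinearMap.precomp ℝ (ContinuousLinearMap.fst ℝ (E d) (E d))).comp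
      ((innerSL ℝ).comp (ContinuousLinearMap.fst ℝ (E d) (E d))) +
    (ContinuousLinearMap.precomp ℝ (ContinuousLinearMap.snd ℝ (E d) (E d))).comp
      ((innerSL ℝ).comp (ContinuousLinearMap.snd ℝ (E d) (E d))))

lemma dWeight_apply (w v : PS d) :
    dWeight d w v = 2 * (inner ℝ w.1 v.1 + inner ℝ w.2 v.2) := rfl

/-- The weight `(1 + |s|² + |θ|²)⁻¹`. -/
def invWeight (w : PS d) : ℝ := (1 + ‖w.1‖ ^ 2 + ‖w.2‖ ^ 2)⁻¹

lemma weight_pos (w : PS d) : 0 < 1 + ‖w.1‖ ^ 2 + ‖w.2‖ ^ 2 := by positivity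

lemma contDiff_invWeight : ContDiff ℝ ∞ (invWeight : PS d → ℝ) := by
  refine ContDiff.inv ?_ fun w => (weight_pos w).ne'
  exact (contDiff_const.add (contDiff_fst.norm_sq ℝ)).add (contDiff_snd.norm_sq ℝ)

lemma invWeight_le (w : PS d) : invWeight w ≤ 2 * (1 + ‖w‖) ^ (-2 : ℝ) := by
  have h0 := one_add_norm_pos w
  have h1 : ‖w‖ ^ 2 ≤ ‖w.1‖ ^ 2 + ‖w.2‖ ^ 2 := by
    rw [Prod.norm_def]
    rcases max_choice ‖w.1‖ ‖w.2‖ with h | h <;> rw [h] <;> nlinarith [sq_nonneg ‖w.1‖, sq_nonneg ‖w.2‖]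
  rw [Real.rpow_neg h0.le, invWeight, Real.rpow_two, ← div_eq_mul_inv, inv_eq_one_div,
    div_le_div_iff₀ (weight_pos w) (by positivity)]
  nlinarith [sq_nonneg (‖w‖ - 1)]

/-- The derivative `-u² dWeight` of the weight `u` is written as nested products of `u`, `u` and a
linear map, the shape to which the Leibniz estimate applies inductively. -/
lemma fderiv_invWeight :
    fderiv ℝ (invWeight : PS d → ℝ) =
      fun w => invWeight w • (invWeight w • (-dWeight d) w) := by
  ext1 w
  have h1 : HasFDerivAt (fun w : PS d => 1 + ‖w.1‖ ^ 2 + ‖w.2‖ ^ 2) (dWeight d w) w := by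
    have ha := (ContinuousLinearMap.fst ℝ (E d) (E d)).hasFDerivAt (x := w) |>.norm_sq
    have hb := (ContinuousLinearMap.snd ℝ (E d) (E d)).hasFDerivAt (x := w) |>.norm_sq
    refine ((ha.const_add 1).add hb).congr_fderiv ?_
    refine ContinuousLinearMap.ext fun v => ?_
    rw [dWeight_apply, add_apply, mul_add, two_nsmul, two_nsmul, two_mul, two_mul]
    rfl
  have h2 := (HasDerivAt.comp_hasFDerivAt w (hasDerivAt_inv (weight_pos w).ne') h1).fderiv
  change fderiv ℝ (Inv.inv ∘ fun w : PS d => 1 + ‖w.1‖ ^ 2 + ‖w.2‖ ^ 2) w = _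
  rw [h2, smul_smul]
  simp only [invWeight, neg_apply, smul_neg, neg_smul]
  congr 2
  rw [sq, mul_inv]

/-- A Leibniz estimate restricted to orders at most `n`. `SymB` demands all orders at once and could
not serve as the induction hypothesis for `invWeight`. -/
lemma iteratedFDeriv_smul_bound {X V : Type} [NormedAddCommGroup X] [NormedSpace ℝ X]
    [NormedAddCommGroup V] [NormedSpace ℝ V] {f : X → ℝ} {g : X → V} (hf : ContDiff ℝ ∞ f)
    (hg : ContDiff ℝ ∞ g) {n : ℕ} {r r' : ℝ}
    (h : ∃ C, ∀ k ≤ n, ∀ w, ‖iteratedFDeriv ℝ k f w‖ ≤ C * (1 + ‖w‖) ^ r)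
    (h' : ∃ C, ∀ k ≤ n, ∀ w, ‖iteratedFDeriv ℝ k g w‖ ≤ C * (1 + ‖w‖) ^ r') :
    ∃ C, ∀ k ≤ n, ∀ w, ‖iteratedFDeriv ℝ k (fun w => f w • g w) w‖ ≤ C * (1 + ‖w‖) ^ (r + r') := by
  obtain ⟨C, hC⟩ := h
  obtain ⟨C', hC'⟩ := h'
  refine ⟨∑ k ∈ Finset.range (n + 1), ∑ i ∈ Finset.range (k + 1), (k.choose i : ℝ) * |C| * |C'|,
    fun k hk w => ?_⟩
  refine (norm_iteratedFDeriv_smul_le hf hg w (by exact_mod_cast le_top)).trans ?_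
  rw [Real.rpow_add (one_add_norm_pos w)]
  have p1 := one_add_norm_rpow_pos w r
  have p2 := one_add_norm_rpow_pos w r'
  calc _ ≤ ∑ i ∈ Finset.range (k + 1), (k.choose i : ℝ) * (|C| * (1 + ‖w‖) ^ r) *
          (|C'| * (1 + ‖w‖) ^ r') := by
        refine Finset.sum_le_sum fun i hi => ?_
        have hi' : i ≤ k := by simpa [Nat.lt_succ_iff] using hi
        have h1 := (hC i (hi'.trans hk) w).trans
          (mul_le_mul_of_nonneg_right (le_abs_self C) p1.le)
        have h2 := (hC' (k - i) ((Nat.sub_le _ _).trans hk) w).trans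
          (mul_le_mul_of_nonneg_right (le_abs_self C') p2.le)
        gcongr
    _ = (∑ i ∈ Finset.range (k + 1), (k.choose i : ℝ) * |C| * |C'|) *
          ((1 + ‖w‖) ^ r * (1 + ‖w‖) ^ r') := by
        rw [Finset.sum_mul]
        exact Finset.sum_congr rfl fun i _ => by ring
    _ ≤ _ := by
        refine mul_le_mul_of_nonneg_right ?_ (by positivity)
        exact Finset.single_le_sum
          (f := fun k => ∑ i ∈ Finset.range (k + 1), (k.choose i : ℝ) * |C| * |C'|)
          (fun k _ => Finset.sum_nonneg fun i _ => by positivity) (by simpa [Nat.lt_succ_iff] using hk)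

/-- Bootstrap: the derivative is a product of two copies of the weight and a linear map, so bounds
up to order `n` give order `n + 1`, with exponent `-2 - 2 + 1 ≤ -2`. -/
lemma exists_symB_invWeight (d : ℕ) : ∃ B, SymB (-2) B (invWeight : PS d → ℝ) := by
  have key : ∀ n : ℕ, ∃ C, ∀ k ≤ n, ∀ w : PS d,
      ‖iteratedFDeriv ℝ k (invWeight : PS d → ℝ) w‖ ≤ C * (1 + ‖w‖) ^ (-2 : ℝ) := by
    intro n
    induction n with
    | zero =>
      refine ⟨2, fun k hk w => ?_⟩
      obtain rfl : k = 0 := by omega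
      rw [norm_iteratedFDeriv_zero]
      change ‖(1 + ‖w.1‖ ^ 2 + ‖w.2‖ ^ 2)⁻¹‖ ≤ _
      rw [Real.norm_of_nonneg (inv_pos.2 (weight_pos w)).le]
      exact invWeight_le w
    | succ n ih =>
      have hl := SymB.clm (-dWeight d)
      have h1 : ∃ C, ∀ k ≤ n, ∀ w : PS d,
          ‖iteratedFDeriv ℝ k (fun w => (-dWeight d) w) w‖ ≤ C * (1 + ‖w‖) ^ (1 : ℝ) := by
        refine ⟨‖-dWeight d‖, fun k _ w => (hl.2 k w).trans ?_⟩
        have := one_add_norm_rpow_pos w 1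
        gcongr
        dsimp only
        split_ifs
        · exact le_rfl
        · positivity
      have h2 := iteratedFDeriv_smul_bound contDiff_invWeight hl.1 ih h1
      obtain ⟨C, hC⟩ := iteratedFDeriv_smul_bound contDiff_invWeight
        (contDiff_invWeight.smul hl.1) ih h2
      obtain ⟨C0, hC0⟩ := ih
      refine ⟨|C0| + |C|, fun k hk w => ?_⟩
      have p := one_add_norm_rpow_pos w (-2)
      rcases Nat.lt_or_ge k (n + 1) with h | h
      · refine (hC0 k (by omega) w).trans ?_
        gcongr
        linarith [le_abs_self C0, abs_nonneg C]
      · obtain rfl : k = n + 1 := by omega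
        rw [← norm_iteratedFDeriv_fderiv, fderiv_invWeight]
        refine (hC n le_rfl w).trans ?_
        have p3 : (1 + ‖w‖) ^ (-2 + (-2 + 1) : ℝ) ≤ (1 + ‖w‖) ^ (-2 : ℝ) :=
          Real.rpow_le_rpow_of_exponent_le (one_le_one_add_norm w) (by norm_num)
        have p4 := one_add_norm_rpow_pos w (-2 + (-2 + 1))
        exact mul_le_mul (by linarith [le_abs_self C, abs_nonneg C0]) p3 p4.le (by positivity)
  choose C hC using key
  exact ⟨C, contDiff_invWeight, fun k w => hC k k le_rfl w⟩

/-- The oscillating factor `exp (-i ⟨s, θ⟩)`. -/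
def phase (w : PS d) : ℂ := Complex.exp (-Complex.I * ((inner ℝ w.1 w.2 : ℝ) : ℂ))

lemma norm_phase (w : PS d) : ‖phase w‖ = 1 := by
  rw [phase, Complex.norm_exp]; simp

lemma contDiff_phase : ContDiff ℝ ∞ (phase : PS d → ℂ) :=
  (contDiff_const.mul (Complex.ofRealCLM.contDiff.comp (contDiff_fst.inner ℝ contDiff_snd))).cexp

lemma hasFDerivAt_phase_apply (w v : PS d) :
    fderiv ℝ phase w v =
      -Complex.I * ((inner ℝ w.1 v.2 + inner ℝ v.1 w.2 : ℝ) : ℂ) * phase w := by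
  have h1 := ((ContinuousLinearMap.fst ℝ (E d) (E d)).hasFDerivAt (x := w)).inner ℝ
    ((ContinuousLinearMap.snd ℝ (E d) (E d)).hasFDerivAt (x := w))
  have h2 := ((Complex.ofRealCLM.hasFDerivAt.comp w h1).const_mul (-Complex.I)).cexp.fderiv
  change fderiv ℝ (fun w : PS d => Complex.exp (-Complex.I * ((inner ℝ w.1 w.2 : ℝ) : ℂ))) w v = _
  have h3 := congrArg (fun L => L v) h2
  refine h3.trans ?_
  simp [phase]
  ring

/-- The swap `(s, θ) ↦ (θ, s)`. -/
def swapCLM (d : ℕ) : PS d →L[ℝ] PS d :=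
  (ContinuousLinearMap.snd ℝ (E d) (E d)).prod (ContinuousLinearMap.fst ℝ (E d) (E d))

/-- The operator on amplitudes that one integration by parts against `phase` produces. -/
def ampOp (f : PS d → V) (w : PS d) : V :=
  invWeight w • f w - Complex.I • fderiv ℝ (fun w => invWeight w • f w) w (swapCLM d w)

/-- The weight gains two orders and the linear coefficient of the swap field loses one. The new
bounds depend on `B` alone, not on `r` or `f`, and all later uniformity rests on this. -/
lemma ampOp_bound (B : ℕ → ℝ) : ∃ B' : ℕ → ℝ, ∀ (r : ℝ) (f : PS d → V), SymB r B f →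
    SymB (r - 1) B' (ampOp f) := by
  obtain ⟨Bu, hu⟩ := exists_symB_invWeight d
  have hJ := SymB.clm (swapCLM d)
  refine ⟨fun k => leibniz Bu B k + ‖Complex.I‖ * leibniz (fun k => leibniz Bu B (k + 1))
    (fun k => if k ≤ 1 then ‖swapCLM d‖ else 0) k, fun r f hf => ?_⟩
  have hq := hu.smul hf
  have h1 := ((hq.fderiv.clm_apply hJ).const_smul Complex.I).mono_exp (r' := r - 1) (by linarith)
  exact (hq.mono_exp (r' := r - 1) (by linarith)).sub h1

lemma ampOp_iterate_bound (B : ℕ → ℝ) (M : ℕ) :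
    ∃ B' : ℕ → ℝ, ∀ (r : ℝ) (f : PS d → V), SymB r B f → SymB (r - M) B' (ampOp^[M] f) := by
  induction M with
  | zero => exact ⟨B, fun r f hf => by simpa using hf⟩
  | succ M ih =>
    obtain ⟨B1, h1⟩ := ih
    obtain ⟨B2, h2⟩ := ampOp_bound (d := d) (V := V) B1
    refine ⟨B2, fun r f hf => ?_⟩
    rw [Function.iterate_succ_apply']
    have := h2 _ _ (h1 r f hf)
    push_cast
    rwa [← sub_sub]

lemma contDiff_ampOp {f : PS d → V} (hf : ContDiff ℝ ∞ f) : ContDiff ℝ ∞ (ampOp f) := by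
  have hq := contDiff_invWeight.smul hf
  exact hq.sub (((contDiff_infty_iff_fderiv.1 hq).2.clm_apply (swapCLM d).contDiff).const_smul
    Complex.I)

lemma contDiff_ampOp_iterate {f : PS d → V} (hf : ContDiff ℝ ∞ f) (M : ℕ) :
    ContDiff ℝ ∞ (ampOp^[M] f) := by
  induction M with
  | zero => exact hf
  | succ M ih => rw [Function.iterate_succ_apply']; exact contDiff_ampOp ih

/-- Locality, needed because cutoffs agree with `1` near each point eventually; equality at the
point alone would not control the derivative in `ampOp`. -/
lemma ampOp_congr {f g : PS d → V} {w : PS d} (h : f =ᶠ[𝓝 w] g) : ampOp f =ᶠ[𝓝 w] ampOp g := by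
  have h1 : (fun w => invWeight w • f w) =ᶠ[𝓝 w] (fun w => invWeight w • g w) :=
    h.mono fun x hx => by simp only [hx]
  filter_upwards [h, h1.eventuallyEq_nhds] with x hx hx1
  rw [ampOp, ampOp, hx, hx1.fderiv_eq]

lemma ampOp_iterate_congr {f g : PS d → V} {w : PS d} (h : f =ᶠ[𝓝 w] g) (M : ℕ) :
    ampOp^[M] f =ᶠ[𝓝 w] ampOp^[M] g := by
  induction M with
  | zero => exact h
  | succ M ih => rw [Function.iterate_succ_apply', Function.iterate_succ_apply']; exact ampOp_congr ih

lemma ampOp_add {f g : PS d → V} (hf : ContDiff ℝ ∞ f) (hg : ContDiff ℝ ∞ g) :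
    ampOp (f + g) = ampOp f + ampOp g := by
  ext1 w
  have h1 : DifferentiableAt ℝ (fun w => invWeight w • f w) w :=
    ((contDiff_invWeight.smul hf).differentiable (by simp)) w
  have h2 : DifferentiableAt ℝ (fun w => invWeight w • g w) w :=
    ((contDiff_invWeight.smul hg).differentiable (by simp)) w
  have h3 : (fun w => invWeight w • (f + g) w) =
      (fun w => invWeight w • f w) + (fun w => invWeight w • g w) := by
    ext1 w; simp
  rw [Pi.add_apply, ampOp, ampOp, ampOp, h3, fderiv_add h1 h2]
  simp only [Pi.add_apply, smul_add, add_apply]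
  abel

lemma ampOp_iterate_add {f g : PS d → V} (hf : ContDiff ℝ ∞ f) (hg : ContDiff ℝ ∞ g) (M : ℕ) :
    ampOp^[M] (f + g) = ampOp^[M] f + ampOp^[M] g := by
  induction M with
  | zero => rfl
  | succ M ih =>
    simp only [Function.iterate_succ_apply']
    rw [ih, ampOp_add (contDiff_ampOp_iterate hf M) (contDiff_ampOp_iterate hg M)]

/-- Allows a vector-valued oscillatory integral to be evaluated in a direction, and the constant
amplitude `v` to be reduced to the scalar `1`. -/
lemma ampOp_clm_comp (Λ : V →L[ℂ] V') {f : PS d → V} (hf : ContDiff ℝ ∞ f) :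
    ampOp (Λ ∘ f) = Λ ∘ ampOp f := by
  ext1 w
  have h1 : DifferentiableAt ℝ (fun w => invWeight w • f w) w :=
    ((contDiff_invWeight.smul hf).differentiable (by simp)) w
  have h2 : (fun w => invWeight w • (Λ ∘ f) w) =
      (Λ.restrictScalars ℝ) ∘ (fun w => invWeight w • f w) := by
    ext1 w; simp
  rw [ampOp, h2, ((Λ.restrictScalars ℝ).hasFDerivAt.comp w h1.hasFDerivAt).fderiv]
  simp [ampOp]

lemma ampOp_iterate_clm_comp (Λ : V →L[ℂ] V') {f : PS d → V} (hf : ContDiff ℝ ∞ f) (M : ℕ) :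
    ampOp^[M] (Λ ∘ f) = Λ ∘ ampOp^[M] f := by
  induction M with
  | zero => rfl
  | succ M ih =>
    simp only [Function.iterate_succ_apply']
    rw [ih, ampOp_clm_comp Λ (contDiff_ampOp_iterate hf M)]

end Amplitude

/-! ### Regularized oscillatory integrals -/

section OscillatoryIntegral

open Filter Topology

variable {d : ℕ} {V V' : Type} [NormedAddCommGroup V] [NormedSpace ℝ V] [NormedSpace ℂ V]
  [IsScalarTower ℝ ℂ V] [NormedAddCommGroup V'] [NormedSpace ℝ V'] [NormedSpace ℂ V']
  [IsScalarTower ℝ ℂ V']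

lemma ofReal_smul' (c : ℝ) (v : V) : (c : ℂ) • v = c • v := algebraMap_smul ℂ c v

lemma integrable_decay (d : ℕ) : Integrable (fun w : PS d => (1 + ‖w‖) ^ (-(2 * d + 1) : ℝ)) := by
  refine integrable_one_add_norm ?_
  rw [finrank_PS]; push_cast; linarith

lemma integrable_of_norm_le_decay {f : PS d → V} (hf : Continuous f) {C : ℝ}
    (h : ∀ w, ‖f w‖ ≤ C * (1 + ‖w‖) ^ (-(2 * d + 1) : ℝ)) : Integrable f :=
  ((integrable_decay d).const_mul C).mono' hf.aestronglyMeasurable (Eventually.of_forall h)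

lemma SymB.integrable_phase_smul {r : ℝ} {B : ℕ → ℝ} {f : PS d → V} (hf : SymB r B f)
    (hr : r ≤ -(2 * d + 1)) : Integrable (fun w => phase w • f w) := by
  refine integrable_of_norm_le_decay (C := B 0)
    (contDiff_phase.continuous.smul hf.1.continuous) fun w => ?_
  rw [norm_smul, norm_phase, one_mul]
  exact (hf.mono_exp hr).norm_le w

lemma abs_clm_mul_le {ℓ : PS d →L[ℝ] ℝ} (w : PS d) : |ℓ w| ≤ ‖ℓ‖ * (1 + ‖w‖) :=
  (ℓ.le_opNorm w).trans (mul_le_mul_of_nonneg_left (by linarith) (norm_nonneg ℓ))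

lemma integrable_of_growth {r s : ℝ} {B : ℕ → ℝ} {q : PS d → V} (hq : SymB r B q)
    {c : PS d → ℂ} (hc : Continuous c) {C : ℝ} (hC : 0 ≤ C)
    (hcb : ∀ w, ‖c w‖ ≤ C * (1 + ‖w‖) ^ s) (hrs : r + s ≤ -(2 * d + 1)) :
    Integrable (fun w => c w • q w) := by
  refine integrable_of_norm_le_decay (C := C * B 0) (hc.smul hq.1.continuous) fun w => ?_
  have p1 := one_add_norm_rpow_pos w r
  have p2 := one_add_norm_rpow_pos w s
  have hB := hq.nonneg 0
  calc _ ≤ (C * (1 + ‖w‖) ^ s) * (B 0 * (1 + ‖w‖) ^ r) := by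
        rw [norm_smul]
        exact mul_le_mul (hcb w) (hq.norm_le w) (norm_nonneg _) (by positivity)
    _ = C * B 0 * (1 + ‖w‖) ^ (r + s) := by rw [Real.rpow_add (one_add_norm_pos w)]; ring
    _ ≤ _ := by
      gcongr
      exact one_le_one_add_norm w

/-- Integration by parts against `phase` with a linear coefficient that is constant in the
direction of differentiation. -/
lemma integral_phase_clm_smul_fderiv {r : ℝ} {B : ℕ → ℝ} {q : PS d → V} (hq : SymB r B q)
    (hr : r + 2 ≤ -(2 * d + 1)) (ℓ : PS d →L[ℝ] ℝ) (v : PS d) (hv : ℓ v = 0) :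
    ∫ w, (phase w * (ℓ w : ℂ)) • fderiv ℝ q w v =
      ∫ w, (Complex.I * ((inner ℝ w.1 v.2 + inner ℝ v.1 w.2 : ℝ) : ℂ) * (ℓ w : ℂ) * phase w) •
        q w := by
  have hsm : ContDiff ℝ ∞ (fun w : PS d => phase w * (ℓ w : ℂ)) :=
    contDiff_phase.mul (Complex.ofRealCLM.contDiff.comp ℓ.contDiff)
  have hfd : ∀ w, fderiv ℝ (fun w : PS d => phase w * (ℓ w : ℂ)) w v =
      -(Complex.I * ((inner ℝ w.1 v.2 + inner ℝ v.1 w.2 : ℝ) : ℂ) * (ℓ w : ℂ) * phase w) := by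
    intro w
    have h1 : HasFDerivAt (fun w : PS d => (ℓ w : ℂ)) (Complex.ofRealCLM.comp ℓ) w :=
      Complex.ofRealCLM.hasFDerivAt.comp w ℓ.hasFDerivAt
    have h2 : HasFDerivAt (fun w : PS d => phase w * (ℓ w : ℂ)) _ w :=
      ((contDiff_phase.differentiable (by simp)) w).hasFDerivAt.mul h1
    rw [h2.fderiv]
    simp [hv, hasFDerivAt_phase_apply]
    ring
  have hb1 : ∀ w : PS d, ‖phase w * (ℓ w : ℂ)‖ ≤ ‖ℓ‖ * (1 + ‖w‖) ^ (1 : ℝ) := by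
    intro w
    rw [norm_mul, norm_phase, one_mul, Complex.norm_real, Real.rpow_one]
    exact abs_clm_mul_le w
  -- The derivative of the phase and the coefficient `ℓ` each grow linearly; this accounts for the
  -- two orders in `hr`.
  have hb2 : ∀ w : PS d, ‖fderiv ℝ (fun w : PS d => phase w * (ℓ w : ℂ)) w v‖ ≤
      (2 * ‖v‖ * ‖ℓ‖) * (1 + ‖w‖) ^ (2 : ℝ) := by
    intro w
    rw [hfd, norm_neg, norm_mul, norm_mul, norm_mul, norm_phase, Complex.norm_I, Complex.norm_real,
      Complex.norm_real, one_mul, mul_one, Real.rpow_two]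
    have e1 : ‖(inner ℝ w.1 v.2 + inner ℝ v.1 w.2 : ℝ)‖ ≤ 2 * ‖v‖ * (1 + ‖w‖) := by
      have a1 := norm_inner_le_norm (𝕜 := ℝ) w.1 v.2
      have a2 := norm_inner_le_norm (𝕜 := ℝ) v.1 w.2
      have a3 := mul_le_mul (norm_fst_le w) (norm_snd_le v) (norm_nonneg _) (norm_nonneg _)
      have a4 := mul_le_mul (norm_fst_le v) (norm_snd_le w) (norm_nonneg _) (norm_nonneg _)
      have a5 := norm_add_le (inner ℝ w.1 v.2 : ℝ) (inner ℝ v.1 w.2)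
      nlinarith [norm_nonneg v]
    calc _ ≤ (2 * ‖v‖ * (1 + ‖w‖)) * (‖ℓ‖ * (1 + ‖w‖)) :=
          mul_le_mul e1 (abs_clm_mul_le w) (abs_nonneg _) (by positivity)
      _ = _ := by ring
  have hq' := hq.fderiv_apply v
  rw [integral_smul_fderiv_eq_neg_fderiv_smul_of_integrable (𝕜 := ℂ)
    (f := fun w : PS d => phase w * (ℓ w : ℂ)) (g := q) (v := v)]
  · rw [← integral_neg]
    congr 1
    ext1 w
    rw [hfd, neg_smul, neg_neg]
  · exact integrable_of_growth hq
      ((contDiff_infty_iff_fderiv.1 hsm).2.clm_apply contDiff_const).continuous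
      (by positivity) hb2 hr
  · exact integrable_of_growth hq' hsm.continuous (by positivity) hb1 (by linarith)
  · exact integrable_of_growth hq hsm.continuous (by positivity) hb1 (by linarith)
  · exact fun w _ => hsm.differentiable (by simp) w
  · exact fun w _ => hq.differentiable w

/-- The coordinate vectors of the position factor. -/
def unitPos (j : Fin d) : PS d := (EuclideanSpace.single j 1, 0)

/-- The coordinate vectors of the momentum factor. -/
def unitMom (j : Fin d) : PS d := (0, EuclideanSpace.single j 1)

/-- The position coordinates. -/
def coordPos (j : Fin d) : PS d →L[ℝ] ℝ :=
  (EuclideanSpace.proj j).comp (ContinuousLinearMap.fst ℝ (E d) (E d))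

/-- The momentum coordinates. -/
def coordMom (j : Fin d) : PS d →L[ℝ] ℝ :=
  (EuclideanSpace.proj j).comp (ContinuousLinearMap.snd ℝ (E d) (E d))

lemma coordPos_apply (j : Fin d) (w : PS d) : coordPos j w = w.1 j := rfl

lemma coordMom_apply (j : Fin d) (w : PS d) : coordMom j w = w.2 j := rfl

lemma inner_single_one_left (j : Fin d) (x : E d) :
    inner ℝ (EuclideanSpace.single j (1 : ℝ)) x = x j := by
  rw [EuclideanSpace.inner_single_left]; simp

lemma inner_single_one_right (j : Fin d) (x : E d) :
    inner ℝ x (EuclideanSpace.single j (1 : ℝ)) = x j := by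
  rw [EuclideanSpace.inner_single_right]; simp

lemma sum_coord_smul_single (x : E d) : ∑ j, x j • EuclideanSpace.single j (1 : ℝ) = x := by
  ext i
  simp [Finset.sum_apply, Pi.single_apply]

lemma swapCLM_eq_sum (w : PS d) :
    swapCLM d w = ∑ j, (coordMom j w • unitPos j + coordPos j w • unitMom j) := by
  rw [Finset.sum_add_distrib]
  refine Prod.ext ?_ ?_
  · simp only [Prod.fst_add, Prod.fst_sum, Prod.smul_fst, unitPos, unitMom, smul_zero,
      Finset.sum_const_zero, add_zero, coordMom_apply, sum_coord_smul_single]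
    rfl
  · simp only [Prod.snd_add, Prod.snd_sum, Prod.smul_snd, unitPos, unitMom, smul_zero,
      Finset.sum_const_zero, zero_add, coordPos_apply, sum_coord_smul_single]
    rfl

/-- The field `θ·∂_s + s·∂_θ` has no divergence and multiplies the phase by `-i(‖s‖² + ‖θ‖²)`. Each
of its terms has a coefficient constant along its direction, so the previous integration by parts
applies term by term. -/
lemma integral_phase_smul_fderiv_swap {r : ℝ} {B : ℕ → ℝ} {q : PS d → V} (hq : SymB r B q)
    (hr : r + 2 ≤ -(2 * d + 1)) :
    ∫ w, phase w • (Complex.I • fderiv ℝ q w (swapCLM d w)) =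
      -∫ w, phase w • ((‖w.1‖ ^ 2 + ‖w.2‖ ^ 2) • q w) := by
  have hint : ∀ (ℓ : PS d →L[ℝ] ℝ) (v : PS d),
      Integrable (fun w => (phase w * (ℓ w : ℂ)) • fderiv ℝ q w v) := by
    intro ℓ v
    refine integrable_of_growth (hq.fderiv_apply v) (s := 1) (C := ‖ℓ‖)
      (contDiff_phase.continuous.mul (Complex.continuous_ofReal.comp ℓ.continuous))
      (by positivity) (fun w => ?_) (by linarith)
    rw [norm_mul, norm_phase, one_mul, Complex.norm_real, Real.rpow_one]
    exact abs_clm_mul_le w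
  have hint2 : ∀ (ℓ : PS d →L[ℝ] ℝ),
      Integrable (fun w => (Complex.I * (ℓ w : ℂ) * (ℓ w : ℂ) * phase w) • q w) := by
    intro ℓ
    refine integrable_of_growth hq (s := 2) (C := ‖ℓ‖ * ‖ℓ‖) ?_ (by positivity) (fun w => ?_) hr
    · have : Continuous fun w => (ℓ w : ℂ) := Complex.continuous_ofReal.comp ℓ.continuous
      exact ((continuous_const.mul this).mul this).mul contDiff_phase.continuous
    · rw [norm_mul, norm_phase, norm_mul, norm_mul, Complex.norm_I, Complex.norm_real, one_mul,
        mul_one, Real.rpow_two]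
      calc _ ≤ (‖ℓ‖ * (1 + ‖w‖)) * (‖ℓ‖ * (1 + ‖w‖)) :=
            mul_le_mul (abs_clm_mul_le w) (abs_clm_mul_le w) (abs_nonneg _) (by positivity)
        _ = _ := by ring
  have h1 : ∀ w, phase w • (Complex.I • fderiv ℝ q w (swapCLM d w)) =
      Complex.I • ∑ j, ((phase w * ((coordMom j w : ℝ) : ℂ)) • fderiv ℝ q w (unitPos j) +
        (phase w * ((coordPos j w : ℝ) : ℂ)) • fderiv ℝ q w (unitMom j)) := by
    intro w
    rw [smul_comm, swapCLM_eq_sum, map_sum, Finset.smul_sum]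
    congr 1
    refine Finset.sum_congr rfl fun j _ => ?_
    rw [map_add, map_smul, map_smul, smul_add, mul_smul, mul_smul, ofReal_smul',
      ofReal_smul']
  simp_rw [h1]
  have hint3 : ∀ j : Fin d, Integrable (fun w =>
      (phase w * ((coordMom j w : ℝ) : ℂ)) • fderiv ℝ q w (unitPos j) +
      (phase w * ((coordPos j w : ℝ) : ℂ)) • fderiv ℝ q w (unitMom j)) :=
    fun j => (hint _ _).add (hint _ _)
  have hint4 : ∀ j : Fin d, Integrable (fun w =>
      (Complex.I * (coordMom j w : ℂ) * (coordMom j w : ℂ) * phase w) • q w +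
      (Complex.I * (coordPos j w : ℂ) * (coordPos j w : ℂ) * phase w) • q w) :=
    fun j => (hint2 _).add (hint2 _)
  rw [integral_smul, integral_finsetSum _ fun j _ => hint3 j]
  have h2 : ∀ j : Fin d, ∫ w, ((phase w * ((coordMom j w : ℝ) : ℂ)) • fderiv ℝ q w (unitPos j) +
      (phase w * ((coordPos j w : ℝ) : ℂ)) • fderiv ℝ q w (unitMom j)) =
      ∫ w, ((Complex.I * (coordMom j w : ℂ) * (coordMom j w : ℂ) * phase w) • q w +
        (Complex.I * (coordPos j w : ℂ) * (coordPos j w : ℂ) * phase w) • q w) := by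
    intro j
    rw [integral_add (hint _ _) (hint _ _), integral_add (hint2 _) (hint2 _),
      integral_phase_clm_smul_fderiv hq hr _ _ (by simp [coordMom_apply, unitPos]),
      integral_phase_clm_smul_fderiv hq hr _ _ (by simp [coordPos_apply, unitMom])]
    congr 2
    · ext1 w
      simp [unitPos, coordMom_apply, inner_single_one_left]
    · ext1 w
      simp [unitMom, coordPos_apply, inner_single_one_right]
  simp_rw [h2]
  rw [← integral_finsetSum _ fun j _ => hint4 j, ← integral_smul, ← integral_neg]
  congr 1
  ext1 w
  have h3 : ((‖w.1‖ ^ 2 + ‖w.2‖ ^ 2 : ℝ) : ℂ) =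
      ∑ j, ((coordMom j w : ℂ) ^ 2 + (coordPos j w : ℂ) ^ 2) := by
    rw [EuclideanSpace.real_norm_sq_eq, EuclideanSpace.real_norm_sq_eq, add_comm]
    push_cast
    rw [Finset.sum_add_distrib]
    rfl
  rw [← ofReal_smul' (‖w.1‖ ^ 2 + ‖w.2‖ ^ 2), h3, smul_smul, ← neg_smul, Finset.mul_sum, Finset.smul_sum,
    ← Finset.sum_neg_distrib, Finset.sum_smul]
  refine Finset.sum_congr rfl fun j _ => ?_
  rw [← add_smul, smul_smul]
  congr 1
  linear_combination ((coordMom j w : ℂ) ^ 2 + (coordPos j w : ℂ) ^ 2) * phase w * Complex.I_mul_I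

/-- With `q = u f` and `u = (1 + ‖s‖² + ‖θ‖²)⁻¹`, integrating the swap term by parts restores `(‖s‖²
+ ‖θ‖²) q`, which together with `q` sums to `f`. -/
lemma integral_phase_smul_ampOp {r : ℝ} {B : ℕ → ℝ} {f : PS d → V} (hf : SymB r B f)
    (hr : r ≤ -(2 * d + 1)) : ∫ w, phase w • ampOp f w = ∫ w, phase w • f w := by
  obtain ⟨Bu, hu⟩ := exists_symB_invWeight d
  have hq := hu.smul hf
  have h1 := integral_phase_smul_fderiv_swap hq (by linarith)
  have hi1 : Integrable (fun w => phase w • (invWeight w • f w)) :=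
    hq.integrable_phase_smul (by linarith)
  have hi2 : Integrable (fun w => phase w •
      (Complex.I • fderiv ℝ (fun w => invWeight w • f w) w (swapCLM d w))) := by
    have := (hq.fderiv.clm_apply (SymB.clm (swapCLM d))).const_smul Complex.I
    exact this.integrable_phase_smul (by linarith)
  have hfe : ∀ w, phase w • f w = phase w • (invWeight w • f w) +
      phase w • ((‖w.1‖ ^ 2 + ‖w.2‖ ^ 2) • (invWeight w • f w)) := by
    intro w
    rw [← smul_add]
    congr 1
    rw [smul_smul, ← add_smul]
    have : invWeight w + (‖w.1‖ ^ 2 + ‖w.2‖ ^ 2) * invWeight w = 1 := by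
      rw [invWeight]
      have := weight_pos w
      field_simp
      ring
    rw [this, one_smul]
  have hi3 : Integrable (fun w : PS d => phase w •
      ((‖w.1‖ ^ 2 + ‖w.2‖ ^ 2) • (invWeight w • f w))) := by
    refine ((hf.integrable_phase_smul hr).sub hi1).congr (Eventually.of_forall fun w => ?_)
    change phase w • f w - _ = _
    rw [hfe w]
    abel
  simp_rw [ampOp, smul_sub]
  rw [integral_sub hi1 hi2, h1, sub_neg_eq_add, ← integral_add hi1 hi3]
  congr 1
  ext1 w
  rw [← hfe w]

/-- The oscillatory integral of `f` against `phase`, regularized by `M` integrations by parts. -/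
def oscInt (M : ℕ) (f : PS d → V) : V := ∫ w, phase w • (ampOp^[M] f) w

/-- Regularization is harmless when the integral already converges: each iterate has lower order
still, so every step of the integration by parts is legitimate. -/
lemma oscInt_eq_integral {r : ℝ} {B : ℕ → ℝ} {f : PS d → V} (hf : SymB r B f)
    (hr : r ≤ -(2 * d + 1)) (M : ℕ) : oscInt M f = ∫ w, phase w • f w := by
  induction M with
  | zero => rfl
  | succ M ih =>
    obtain ⟨B', h⟩ := ampOp_iterate_bound (d := d) (V := V) B M
    have h1 := integral_phase_smul_ampOp (h r f hf) (by linarith [Nat.cast_nonneg (α := ℝ) M])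
    rw [← ih, oscInt, oscInt, Function.iterate_succ_apply', h1]

lemma SymB.integrable_oscInt {r : ℝ} {B : ℕ → ℝ} {f : PS d → V} (hf : SymB r B f) {M : ℕ}
    (hr : r - M ≤ -(2 * d + 1)) : Integrable (fun w => phase w • (ampOp^[M] f) w) := by
  obtain ⟨B', h⟩ := ampOp_iterate_bound (d := d) (V := V) B M
  exact (h r f hf).integrable_phase_smul hr

lemma oscInt_add {r : ℝ} {B B' : ℕ → ℝ} {f g : PS d → V} (hf : SymB r B f) (hg : SymB r B' g)
    {M : ℕ} (hr : r - M ≤ -(2 * d + 1)) :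
    oscInt M (fun w => f w + g w) = oscInt M f + oscInt M g := by
  change oscInt M (f + g) = _
  rw [oscInt, ampOp_iterate_add hf.1 hg.1]
  simp_rw [Pi.add_apply, smul_add]
  exact integral_add (hf.integrable_oscInt hr) (hg.integrable_oscInt hr)

lemma oscInt_clm_comp [CompleteSpace V] [CompleteSpace V'] (Λ : V →L[ℂ] V') {r : ℝ} {B : ℕ → ℝ}
    {f : PS d → V} (hf : SymB r B f) {M : ℕ} (hr : r - M ≤ -(2 * d + 1)) :
    oscInt M (fun w => Λ (f w)) = Λ (oscInt M f) := by
  change oscInt M (Λ ∘ f) = _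
  have h := (Λ.restrictScalars ℝ).integral_comp_comm (hf.integrable_oscInt hr)
  rw [oscInt, ampOp_iterate_clm_comp Λ hf.1]
  refine Eq.trans ?_ h
  simp

lemma oscInt_smul (c : ℂ) {f : PS d → V} (hf : ContDiff ℝ ∞ f) (M : ℕ) :
    oscInt M (fun w => c • f w) = c • oscInt M f := by
  change oscInt M ((c • ContinuousLinearMap.id ℂ V) ∘ f) = _
  rw [oscInt, ampOp_iterate_clm_comp _ hf, oscInt, ← integral_smul]
  congr 1
  ext1 w
  exact smul_comm _ _ _

lemma oscInt_real_smul (c : ℝ) {f : PS d → V} (hf : ContDiff ℝ ∞ f) (M : ℕ) :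
    oscInt M (fun w => c • f w) = c • oscInt M f := by
  have h : (fun w => c • f w) = fun w => (c : ℂ) • f w := by
    ext1 w
    rw [ofReal_smul']
  rw [h, ← ofReal_smul']
  exact oscInt_smul c hf M

lemma oscInt_sub {r : ℝ} {B B' : ℕ → ℝ} {f g : PS d → V} (hf : SymB r B f) (hg : SymB r B' g)
    {M : ℕ} (hr : r - M ≤ -(2 * d + 1)) :
    oscInt M (fun w => f w - g w) = oscInt M f - oscInt M g := by
  have h := oscInt_add hf (hg.const_smul (-1 : ℝ)) hr
  rw [oscInt_real_smul _ hg.1] at h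
  simpa [sub_eq_add_neg] using h

/-- By homogeneity, `c⁻¹ • f` lies in the fixed class given by `B`, so `C` depends on `B` only. The
scalar `c` carries whatever must be tracked: a power of `ħ`, of `1 + ‖z‖`, or of a small increment.
-/
lemma exists_norm_oscInt_le {r : ℝ} {M : ℕ} (hr : r - M ≤ -(2 * d + 1)) (B : ℕ → ℝ) :
    ∃ C, 0 ≤ C ∧ ∀ (c : ℝ) (f : PS d → V), 0 ≤ c → SymB r (fun k => c * B k) f →
      ‖oscInt M f‖ ≤ c * C := by
  obtain ⟨B', h⟩ := ampOp_iterate_bound (d := d) (V := V) B M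
  refine ⟨|B' 0| * ∫ w : PS d, (1 + ‖w‖) ^ (-(2 * d + 1) : ℝ), ?_, fun c f hc hf => ?_⟩
  · have : 0 ≤ ∫ w : PS d, (1 + ‖w‖) ^ (-(2 * d + 1) : ℝ) :=
      integral_nonneg fun w => (one_add_norm_rpow_pos w _).le
    positivity
  -- For `c = 0` the rescaling is unavailable, but then `f` vanishes.
  · rcases hc.eq_or_lt with rfl | hc
    · have h0 : f = fun _ => (0 : ℝ) • (0 : V) := by
        ext1 w
        have := hf.norm_le w
        simpa using this
      rw [h0, oscInt_real_smul _ contDiff_const]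
      simp
    · have h1 := hf.const_smul c⁻¹
      have h2 : SymB r B (fun w => c⁻¹ • f w) := by
        refine h1.mono le_rfl fun k => le_of_eq ?_
        rw [Real.norm_of_nonneg (inv_nonneg.2 hc.le)]
        field_simp
      have h3 : oscInt M f = c • oscInt M (fun w => c⁻¹ • f w) := by
        rw [oscInt_real_smul _ hf.1, smul_smul, mul_inv_cancel₀ hc.ne', one_smul]
      rw [h3, norm_smul, Real.norm_of_nonneg hc.le]
      refine mul_le_mul_of_nonneg_left ?_ hc.le
      rw [← integral_const_mul]
      refine norm_integral_le_of_norm_le ((integrable_decay d).const_mul _)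
        (Eventually.of_forall fun w => ?_)
      rw [norm_smul, norm_phase, one_mul]
      exact (((h r _ h2).mono_exp hr).norm_le w).trans
        (mul_le_mul_of_nonneg_right (le_abs_self _) (one_add_norm_rpow_pos w _).le)

/-- Eventual equality on neighbourhoods, not mere pointwise convergence, is assumed because the
regularized integrand contains derivatives. The common bounds `B` provide the dominating function.
-/
lemma tendsto_oscInt {r : ℝ} {M : ℕ} (hr : r - M ≤ -(2 * d + 1)) {B : ℕ → ℝ}
    {f : ℕ → PS d → V} {g : PS d → V} (hf : ∀ n, SymB r B (f n))
    (hfg : ∀ w, ∀ᶠ n in atTop, f n =ᶠ[𝓝 w] g) :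
    Tendsto (fun n => oscInt M (f n)) atTop (𝓝 (oscInt M g)) := by
  obtain ⟨B', h⟩ := ampOp_iterate_bound (d := d) (V := V) B M
  refine tendsto_integral_of_dominated_convergence
    (fun w => B' 0 * (1 + ‖w‖) ^ (-(2 * d + 1) : ℝ))
    (fun n => ((hf n).integrable_oscInt hr).aestronglyMeasurable)
    ((integrable_decay d).const_mul _) (fun n => Eventually.of_forall fun w => ?_)
    (Eventually.of_forall fun w => ?_)
  · rw [norm_smul, norm_phase, one_mul]
    exact ((h r _ (hf n)).mono_exp hr).norm_le w
  · refine tendsto_const_nhds.congr' ?_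
    filter_upwards [hfg w] with n hn
    rw [(ampOp_iterate_congr hn M).eq_of_nhds]

end OscillatoryIntegral

/-! ### Cutoffs with uniform symbol bounds -/

section Cutoff

open Filter Topology

variable {d : ℕ}

/-- Smooth cutoffs, equal to `1` on large balls. -/
def cutoff (n : ℕ) (w : PS d) : ℝ :=
  (⟨1, 2, one_pos, one_lt_two⟩ : ContDiffBump (0 : PS d)) ((n + 1 : ℝ)⁻¹ • w)

lemma contDiff_cutoff (n : ℕ) : ContDiff ℝ ∞ (cutoff n : PS d → ℝ) :=
  ContDiffBump.contDiff _ |>.comp (contDiff_const_smul _)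

lemma hasCompactSupport_cutoff (n : ℕ) : HasCompactSupport (cutoff n : PS d → ℝ) :=
  (ContDiffBump.hasCompactSupport _).comp_smul (by positivity)

/-- The cutoffs are contractive dilations of a single bump, so composition does not worsen its
bounds. -/
lemma exists_symB_cutoff (d : ℕ) : ∃ B, ∀ n, SymB 0 B (cutoff n : PS d → ℝ) := by
  obtain ⟨B, hB⟩ := SymB.exists_of_hasCompactSupport
    (ContDiffBump.contDiff (⟨1, 2, one_pos, one_lt_two⟩ : ContDiffBump (0 : PS d)) (n := ⊤))
    (ContDiffBump.hasCompactSupport _) 0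
  refine ⟨fun k => (1 + ‖(0 : PS d)‖) ^ (0 : ℝ) * ((1 + 1) ^ (0 : ℝ) * 1 ^ k * B k), fun n => ?_⟩
  have hL : ‖((n + 1 : ℝ)⁻¹ • ContinuousLinearMap.id ℝ (PS d))‖ ≤ 1 := by
    rw [norm_smul]
    refine mul_le_one₀ ?_ (norm_nonneg _) ContinuousLinearMap.norm_id_le
    rw [Real.norm_of_nonneg (by positivity)]
    exact inv_le_one_of_one_le₀ (by linarith [Nat.cast_nonneg (α := ℝ) n])
  have := hB.comp_affine le_rfl 0 _ hL
  simp only [zero_add] at this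
  exact this

lemma cutoff_eventuallyEq_one (w : PS d) :
    ∀ᶠ n in atTop, (cutoff n : PS d → ℝ) =ᶠ[𝓝 w] fun _ => 1 := by
  obtain ⟨N, hN⟩ := exists_nat_gt ‖w‖
  filter_upwards [eventually_ge_atTop N] with n hn
  have h1 : ∀ᶠ x in 𝓝 w, ‖x‖ < N := continuous_norm.continuousAt.eventually_lt_const hN
  filter_upwards [h1] with x hx
  refine ContDiffBump.one_of_mem_closedBall _ ?_
  rw [mem_closedBall_zero_iff, norm_smul, Real.norm_of_nonneg (by positivity),
    inv_mul_le_iff₀ (by positivity)]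
  have : (N : ℝ) ≤ n := by exact_mod_cast hn
  change _ ≤ (n + 1 : ℝ) * 1
  linarith

end Cutoff

/-! ### First order Taylor remainders of symbols -/

section TaylorRemainder

variable {X V : Type} [NormedAddCommGroup X] [NormedSpace ℝ X] [NormedAddCommGroup V]
  [NormedSpace ℝ V]

/-- Symmetry of the second derivative; it makes Taylor remainders and directional derivatives
commute with `fderiv`. -/
lemma fderiv_fderiv_apply {f : X → V} (hf : ContDiff ℝ ∞ f) (v a : X) :
    fderiv ℝ (fun a => fderiv ℝ f a v) a = fderiv ℝ (fderiv ℝ f) a v := by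
  have h1 : DifferentiableAt ℝ (fderiv ℝ f) a :=
    (contDiff_infty_iff_fderiv.1 hf).2.differentiable (by simp) a
  have h2 := (h1.hasFDerivAt.clm_apply (hasFDerivAt_const v a)).fderiv
  rw [h2]
  ext u
  have h3 : IsSymmSndFDerivAt ℝ f a := by
    refine (hf.contDiffAt (x := a)).isSymmSndFDerivAt ?_
    simp only [minSmoothness_of_isRCLikeNormedField]
    exact WithTop.coe_le_coe.2 (le_top : (2 : ℕ∞) ≤ ⊤)
  simpa using h3.eq u v

/-- The remainder of the first order Taylor expansion of `f`. -/
def taylorRem (f : X → V) (v a : X) : V := f (a + v) - f a - fderiv ℝ f a v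

lemma contDiff_taylorRem {f : X → V} (hf : ContDiff ℝ ∞ f) (v : X) :
    ContDiff ℝ ∞ (taylorRem f v) :=
  ((hf.comp (contDiff_id.add contDiff_const)).sub hf).sub
    ((contDiff_infty_iff_fderiv.1 hf).2.clm_apply contDiff_const)

lemma fderiv_taylorRem {f : X → V} (hf : ContDiff ℝ ∞ f) (v : X) :
    fderiv ℝ (taylorRem f v) = taylorRem (fderiv ℝ f) v := by
  ext1 a
  have hd : Differentiable ℝ f := hf.differentiable (by simp)
  have h1 : DifferentiableAt ℝ (fun a => f (a + v)) a :=
    (hd (a + v)).comp a (differentiableAt_id.add_const v)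
  have h2 : DifferentiableAt ℝ (fun a => fderiv ℝ f a v) a :=
    ((contDiff_infty_iff_fderiv.1 hf).2.clm_apply contDiff_const).differentiable (by simp) a
  change fderiv ℝ (fun a => f (a + v) - f a - fderiv ℝ f a v) a = _
  rw [fderiv_fun_sub (h1.fun_sub (hd a)) h2, fderiv_fun_sub h1 (hd a), fderiv_comp_add_right,
    fderiv_fderiv_apply hf, taylorRem]

lemma one_add_norm_rpow_le_of_dist {r : ℝ} (hr : 0 ≤ r) {a x : X} (h : ‖x - a‖ ≤ 1) :
    (1 + ‖x‖) ^ r ≤ 2 ^ r * (1 + ‖a‖) ^ r := by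
  rw [← Real.mul_rpow (by norm_num) (by positivity)]
  refine Real.rpow_le_rpow (by positivity) ?_ hr
  have := norm_add_le (x - a) a
  rw [sub_add_cancel] at this
  linarith [norm_nonneg a]

/-- The mean value inequality twice on the ball of radius `‖v‖`: once for the variation of `fderiv`,
once for the remainder. As `‖v‖ ≤ 1`, the weight changes there by at most `2 ^ r`. -/
lemma norm_taylorRem_le {r : ℝ} (hr : 0 ≤ r) {B : ℕ → ℝ} {f : X → V} (hf : SymB r B f) {v : X}
    (hv : ‖v‖ ≤ 1) (a : X) :
    ‖taylorRem f v a‖ ≤ ‖v‖ ^ 2 * (2 ^ r * B 2) * (1 + ‖a‖) ^ r := by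
  have hB := hf.nonneg 2
  set C := B 2 * (2 ^ r * (1 + ‖a‖) ^ r) with hC
  have hs : Convex ℝ (Metric.closedBall a ‖v‖) := convex_closedBall _ _
  have ha : a ∈ Metric.closedBall a ‖v‖ := Metric.mem_closedBall_self (norm_nonneg v)
  have hav : a + v ∈ Metric.closedBall a ‖v‖ := by simp
  have hn : ∀ x ∈ Metric.closedBall a ‖v‖, ‖x - a‖ ≤ ‖v‖ := fun x hx => by
    simpa [dist_eq_norm] using hx
  have h1 : ∀ x ∈ Metric.closedBall a ‖v‖, ‖fderiv ℝ f x - fderiv ℝ f a‖ ≤ C * ‖v‖ := by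
    intro x hx
    have h2 : ∀ y ∈ Metric.closedBall a ‖v‖, ‖fderiv ℝ (fderiv ℝ f) y‖ ≤ C := by
      intro y hy
      have h3 := hf.2 2 y
      rw [← norm_iteratedFDeriv_fderiv, ← norm_iteratedFDeriv_fderiv, norm_iteratedFDeriv_zero] at h3
      exact h3.trans (mul_le_mul_of_nonneg_left
        (one_add_norm_rpow_le_of_dist hr ((hn y hy).trans hv)) hB)
    refine (hs.norm_image_sub_le_of_norm_fderiv_le
      (fun y _ => hf.fderiv.differentiable y) h2 ha hx).trans ?_
    exact mul_le_mul_of_nonneg_left (hn x hx) (by positivity)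
  have h4 := hs.norm_image_sub_le_of_norm_fderiv_le' (fun y _ => hf.differentiable y) h1 ha hav
  rw [add_sub_cancel_left] at h4
  refine h4.trans (le_of_eq ?_)
  rw [hC]; ring

/-- Differentiating the remainder gives the remainder of the derivative, so the pointwise bound
yields every order; hence the induction varies `V`. -/
lemma SymB.taylorRem {r : ℝ} (hr : 0 ≤ r) {B : ℕ → ℝ} {f : X → V} (hf : SymB r B f) {v : X}
    (hv : ‖v‖ ≤ 1) : SymB r (fun k => ‖v‖ ^ 2 * (2 ^ r * B (k + 2))) (taylorRem f v) := by
  refine ⟨contDiff_taylorRem hf.1 v, fun k => ?_⟩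
  induction k generalizing V B with
  | zero => intro w; simpa using norm_taylorRem_le hr hf hv w
  | succ k ih =>
    intro w
    rw [← norm_iteratedFDeriv_fderiv, fderiv_taylorRem hf.1]
    exact ih hf.fderiv w

end TaylorRemainder

/-! ### The operator `exp(-(i h²/2)⟨∂_ξ,∂_x⟩)` on symbols -/

section Transform

open Filter Topology

variable {d : ℕ} {V : Type} [NormedAddCommGroup V] [NormedSpace ℝ V] [NormedSpace ℂ V]
  [IsScalarTower ℝ ℂ V] [CompleteSpace V]

/-- The dilation `(s, θ) ↦ (h s / 2, h θ)`. -/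
def dil (d : ℕ) (h : ℝ) : PS d →L[ℝ] PS d :=
  h • (((1 / 2 : ℝ) • ContinuousLinearMap.fst ℝ (E d) (E d)).prod
    (ContinuousLinearMap.snd ℝ (E d) (E d)))

lemma dil_apply (h : ℝ) (w : PS d) : dil d h w = ((h / 2) • w.1, h • w.2) := by
  simp [dil, smul_smul, div_eq_mul_inv]

lemma norm_dil_apply_le (h : ℝ) (w : PS d) : ‖dil d h w‖ ≤ |h| * ‖w‖ := by
  rw [dil_apply, Prod.norm_def, norm_smul, norm_smul, Real.norm_eq_abs, Real.norm_eq_abs, abs_div,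
    abs_two]
  have h1 := mul_le_mul_of_nonneg_left (norm_fst_le w) (abs_nonneg h)
  have h2 := mul_le_mul_of_nonneg_left (norm_snd_le w) (abs_nonneg h)
  have h3 : 0 ≤ |h| * ‖w.1‖ := by positivity
  exact max_le (by nlinarith) h2

lemma norm_dil_le (h : ℝ) : ‖dil d h‖ ≤ |h| :=
  ContinuousLinearMap.opNorm_le_bound _ (abs_nonneg h) (norm_dil_apply_le h)

lemma le_norm_dil_apply {h : ℝ} (hh : 0 ≤ h) (w : PS d) : h / 2 * ‖w‖ ≤ ‖dil d h w‖ := by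
  rw [dil_apply]
  simp only [Prod.norm_def, norm_smul]
  rw [Real.norm_of_nonneg hh, Real.norm_of_nonneg (by positivity), mul_max_of_nonneg _ _ (by positivity)]
  refine max_le_max le_rfl ?_
  nlinarith [norm_nonneg w.2, mul_nonneg hh (norm_nonneg w.2)]

/-- The operator `exp (-i h² ⟨∂_ξ, ∂_x⟩ / 2)` on amplitudes of polynomial growth. -/
def transf (M : ℕ) (h : ℝ) (f : PS d → V) (z : PS d) : V :=
  (((2 * Real.pi) ^ d)⁻¹ : ℝ) • oscInt M (fun w => f (z + dil d h w))

/-- Evaluation of a linear map, as a complex linear map. -/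
def evalCLM {X : Type} [NormedAddCommGroup X] [NormedSpace ℝ X] (V : Type) [NormedAddCommGroup V]
    [NormedSpace ℝ V] [NormedSpace ℂ V] [IsScalarTower ℝ ℂ V] (v : X) :
    (X →L[ℝ] V) →L[ℂ] V :=
  LinearMap.mkContinuous
    { toFun := fun L => L v
      map_add' := fun _ _ => rfl
      map_smul' := fun _ _ => rfl } ‖v‖ fun L => by
    rw [mul_comm]; exact L.le_opNorm v

variable {r : ℝ} {M : ℕ}

lemma SymB.comp_dil (hr : 0 ≤ r) {B : ℕ → ℝ} {f : PS d → V} (hf : SymB r B f) (h : ℝ) (z : PS d) :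
    SymB r (fun k => (1 + ‖z‖) ^ r * ((1 + |h|) ^ r * |h| ^ k * B k))
      (fun w => f (z + dil d h w)) :=
  hf.comp_affine hr z _ (norm_dil_le h)

lemma exists_norm_transf_le (hr : 0 ≤ r) (hM : r - M ≤ -(2 * d + 1)) (B : ℕ → ℝ) (H : ℝ) :
    ∃ C, 0 ≤ C ∧ ∀ (c : ℝ) (f : PS d → V), 0 ≤ c → SymB r (fun k => c * B k) f →
      ∀ h, |h| ≤ H → ∀ z, ‖transf M h f z‖ ≤ c * C * (1 + ‖z‖) ^ r := by
  obtain ⟨C, hC0, hC⟩ := exists_norm_oscInt_le (V := V) hM (fun k => (1 + H) ^ r * H ^ k * B k)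
  refine ⟨((2 * Real.pi) ^ d)⁻¹ * C, by positivity, fun c f hc hf h hh z => ?_⟩
  have h1 := hf.comp_affine hr z (dil d h) ((norm_dil_le h).trans hh)
  have p := one_add_norm_rpow_pos z r
  have h2 := hC (c * (1 + ‖z‖) ^ r) _ (by positivity)
    (h1.mono le_rfl fun k => le_of_eq (by ring))
  rw [transf, norm_smul, Real.norm_of_nonneg (by positivity)]
  calc _ ≤ ((2 * Real.pi) ^ d)⁻¹ * (c * (1 + ‖z‖) ^ r * C) := by gcongr
    _ = _ := by ring

lemma transf_add (hr : 0 ≤ r) (hM : r - M ≤ -(2 * d + 1)) {B B' : ℕ → ℝ} {f g : PS d → V}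
    (hf : SymB r B f) (hg : SymB r B' g) (h : ℝ) (z : PS d) :
    transf M h (fun w => f w + g w) z = transf M h f z + transf M h g z := by
  rw [transf, oscInt_add (hf.comp_dil hr h z) (hg.comp_dil hr h z) hM, smul_add]
  rfl

lemma transf_smul {f : PS d → V} (hf : ContDiff ℝ ∞ f) (c : ℂ) (h : ℝ) (z : PS d) :
    transf M h (fun w => c • f w) z = c • transf M h f z := by
  rw [transf, oscInt_smul c (f := fun w => f (z + dil d h w))
    (hf.comp (contDiff_const.add (dil d h).contDiff)), smul_comm]
  rfl

/-- No differentiation under the regularized integral is needed. By linearity, the first order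
remainder of `transf M h f` at `z` is the transform of `taylorRem f v`, whose symbol bounds are
`O(‖v‖²)`. -/
lemma hasFDerivAt_transf (hr : 0 ≤ r) (hM : r - M ≤ -(2 * d + 1)) {B : ℕ → ℝ} {f : PS d → V}
    (hf : SymB r B f) (h : ℝ) (z : PS d) :
    HasFDerivAt (transf M h f) (transf M h (fderiv ℝ f) z) z := by
  obtain ⟨C, hC0, hC⟩ := exists_norm_transf_le (d := d) (V := V) hr hM
    (fun k => 2 ^ r * B (k + 2)) |h|
  have hT : ∀ v, transf M h (taylorRem f v) z =
      transf M h f (z + v) - transf M h f z - transf M h (fderiv ℝ f) z v := by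
    intro v
    have e1 : ∀ w, f (z + dil d h w + v) = f (z + v + dil d h w) := fun w => by
      rw [add_right_comm]
    obtain ⟨B1, s1⟩ : ∃ B1, SymB r B1 (fun w => f (z + dil d h w + v)) := by
      simp_rw [e1]; exact ⟨_, hf.comp_dil hr h (z + v)⟩
    have s2 := hf.comp_dil hr h z
    have s3 := hf.fderiv.comp_dil hr h z
    have s4 : SymB r _ (fun w => fderiv ℝ f (z + dil d h w) v) := s3.clm_apply_const v
    have e2 : oscInt M (fun w => fderiv ℝ f (z + dil d h w) v) =
        oscInt M (fun w => fderiv ℝ f (z + dil d h w)) v :=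
      oscInt_clm_comp (evalCLM V v) s3 hM
    change (((2 * Real.pi) ^ d)⁻¹ : ℝ) • oscInt M (fun w => f (z + dil d h w + v) -
      f (z + dil d h w) - fderiv ℝ f (z + dil d h w) v) = _
    rw [oscInt_sub (s1.sub s2) s4 hM, oscInt_sub s1 s2 hM, e2]
    simp_rw [e1]
    simp only [transf, smul_sub, smul_apply]
  rw [hasFDerivAt_iff_isLittleO_nhds_zero]
  have hO : (fun v => transf M h f (z + v) - transf M h f z - transf M h (fderiv ℝ f) z v)
      =O[𝓝 0] fun v : PS d => ‖v‖ ^ 2 := by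
    refine Asymptotics.IsBigO.of_bound (C * (1 + ‖z‖) ^ r) ?_
    filter_upwards [Metric.closedBall_mem_nhds (0 : PS d) one_pos] with v hv
    rw [← hT v]
    refine (hC (‖v‖ ^ 2) _ (by positivity) (hf.taylorRem hr (by simpa using hv)) h le_rfl z).trans
      (le_of_eq ?_)
    rw [Real.norm_of_nonneg (by positivity)]
    ring
  exact hO.trans_isLittleO (Asymptotics.isLittleO_norm_pow_id one_lt_two)

lemma fderiv_transf (hr : 0 ≤ r) (hM : r - M ≤ -(2 * d + 1)) {B : ℕ → ℝ} {f : PS d → V}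
    (hf : SymB r B f) (h : ℝ) : fderiv ℝ (transf M h f) = transf M h (fderiv ℝ f) := by
  ext1 z
  exact (hasFDerivAt_transf hr hM hf h z).fderiv

lemma contDiff_transf (hr : 0 ≤ r) (hM : r - M ≤ -(2 * d + 1)) {B : ℕ → ℝ} {f : PS d → V}
    (hf : SymB r B f) (h : ℝ) : ContDiff ℝ ∞ (transf M h f) := by
  refine contDiff_infty.2 fun n => ?_
  induction n generalizing V B with
  | zero =>
    exact contDiff_zero.2 (continuous_iff_continuousAt.2
      fun z => (hasFDerivAt_transf hr hM hf h z).continuousAt)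
  | succ n ih =>
    push_cast
    refine contDiff_succ_iff_fderiv.2
      ⟨fun z => (hasFDerivAt_transf hr hM hf h z).differentiableAt, by simp, ?_⟩
    rw [fderiv_transf hr hM hf]
    exact ih hf.fderiv

/-- The sup estimate applied to `fderiv`, viewed as a symbol with values in the space of linear
maps, gives the next order of differentiation. -/
lemma exists_symB_transf (hr : 0 ≤ r) (hM : r - M ≤ -(2 * d + 1)) (B : ℕ → ℝ) (H : ℝ) :
    ∃ B' : ℕ → ℝ, ∀ (c : ℝ) (f : PS d → V), 0 ≤ c → SymB r (fun k => c * B k) f →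
      ∀ h, |h| ≤ H → SymB r (fun k => c * B' k) (transf M h f) := by
  have key : ∀ k : ℕ, ∃ C, 0 ≤ C ∧ ∀ (c : ℝ) (f : PS d → V), 0 ≤ c → SymB r (fun k => c * B k) f →
      ∀ h, |h| ≤ H → ∀ z, ‖iteratedFDeriv ℝ k (transf M h f) z‖ ≤ c * C * (1 + ‖z‖) ^ r := by
    intro k
    induction k generalizing V B with
    | zero =>
      simp_rw [norm_iteratedFDeriv_zero]
      exact exists_norm_transf_le hr hM B H
    | succ k ih =>
      obtain ⟨C, hC0, hC⟩ := ih (V := PS d →L[ℝ] V) (fun k => B (k + 1))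
      refine ⟨C, hC0, fun c f hc hf h hh z => ?_⟩
      rw [← norm_iteratedFDeriv_fderiv, fderiv_transf hr hM hf]
      exact hC c _ hc hf.fderiv h hh z
  choose C _ hC using key
  exact ⟨C, fun c f hc hf h hh => ⟨contDiff_transf hr hM hf h, fun k z => hC k c f hc hf h hh z⟩⟩

/-- The variation of a symbol under a small dilation. -/
lemma SymB.comp_dil_sub (hr : 0 ≤ r) {B : ℕ → ℝ} {f : PS d → V} (hf : SymB r B f) {h : ℝ}
    (hh : |h| ≤ 1) (z : PS d) :
    SymB (r + 1) (fun k => |h| * ((1 + ‖z‖) ^ r * 2 ^ r * (B k + B (k + 1))))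
      (fun w => f (z + dil d h w) - f z) := by
  have hs := hf.comp_affine hr z (dil d h) (Λ := 1) ((norm_dil_le h).trans hh)
  refine ⟨hs.1.sub contDiff_const, fun k w => ?_⟩
  have pz := one_add_norm_rpow_pos z r
  have pw := one_add_norm_rpow_pos w r
  have hB := hf.nonneg
  have hw := norm_nonneg w
  rw [Real.rpow_add (one_add_norm_pos w), Real.rpow_one]
  rcases Nat.eq_zero_or_pos k with rfl | hk
  · rw [norm_iteratedFDeriv_zero]
    -- For `k = 0` the mean value inequality along the segment produces `|h| * ‖w‖`, the source of
    -- the extra order in `r + 1`.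
    have hseg : ∀ x ∈ segment ℝ z (z + dil d h w),
        ‖_root_.fderiv ℝ f x‖ ≤ B 1 * ((1 + ‖z‖) ^ r * 2 ^ r * (1 + ‖w‖) ^ r) := by
      intro x hx
      rw [segment_eq_image'] at hx
      obtain ⟨t, ht, rfl⟩ := hx
      have h1 : ‖(t • dil d h)‖ ≤ 1 := by
        rw [norm_smul, Real.norm_of_nonneg ht.1]
        exact mul_le_one₀ ht.2 (norm_nonneg _) ((norm_dil_le h).trans hh)
      have h2 := one_add_norm_affine_rpow_le hr z (t • dil d h) h1 w
      have h3 := hf.2 1 (z + (t • dil d h) w)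
      rw [← zero_add 1, ← norm_iteratedFDeriv_fderiv, norm_iteratedFDeriv_zero, zero_add] at h3
      simp only [add_sub_cancel_left]
      refine h3.trans (mul_le_mul_of_nonneg_left (h2.trans (le_of_eq ?_)) (hB 1))
      norm_num
    have h4 := (convex_segment z (z + dil d h w)).norm_image_sub_le_of_norm_fderiv_le
      (fun y _ => hf.differentiable y) hseg (left_mem_segment _ _ _) (right_mem_segment _ _ _)
    rw [add_sub_cancel_left] at h4
    refine h4.trans ?_
    have h5 := hB 0
    have h6 := hB 1
    calc _ ≤ B 1 * ((1 + ‖z‖) ^ r * 2 ^ r * (1 + ‖w‖) ^ r) * (|h| * ‖w‖) := by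
          gcongr
          exact norm_dil_apply_le h w
      _ ≤ (B 0 + B (0 + 1)) * ((1 + ‖z‖) ^ r * 2 ^ r * (1 + ‖w‖) ^ r) * (|h| * (1 + ‖w‖)) := by
          gcongr
          · simpa using h5
          · linarith
      _ = _ := by ring
  · have h1 : iteratedFDeriv ℝ k (fun w => f (z + dil d h w) - f z) w =
        iteratedFDeriv ℝ k (fun w => f (z + dil d h w)) w := by
      change iteratedFDeriv ℝ k ((fun w => f (z + dil d h w)) - fun _ => f z) w = _
      rw [iteratedFDeriv_sub_apply (hs.1.of_le (by exact_mod_cast le_top)).contDiffAt contDiffAt_const,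
        iteratedFDeriv_const_of_ne hk.ne']
      simp
    rw [h1]
    refine (norm_iteratedFDeriv_comp_affine_le hf.1 z (dil d h) k w).trans ?_
    -- For `k ≥ 1` the constant `f z` drops out and the chain rule supplies `|h| ^ k ≤ |h|`.
    have h2 : ‖dil d h‖ ^ k ≤ |h| :=
      (pow_le_pow_left₀ (norm_nonneg _) (norm_dil_le h) k).trans
        (pow_le_of_le_one (abs_nonneg h) hh hk.ne')
    have h3 := one_add_norm_affine_rpow_le hr z (dil d h) ((norm_dil_le h).trans hh) w
    have h4 := hB k
    have h5 := hB (k + 1)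
    calc _ ≤ (B k * ((1 + ‖z‖) ^ r * (1 + 1) ^ r * (1 + ‖w‖) ^ r)) * |h| := by
          gcongr
          exact (hf.2 k _).trans (mul_le_mul_of_nonneg_left h3 h4)
      _ ≤ ((B k + B (k + 1)) * ((1 + ‖z‖) ^ r * 2 ^ r * ((1 + ‖w‖) ^ r * (1 + ‖w‖)))) * |h| := by
          have h6 : (1 + 1 : ℝ) ^ r = 2 ^ r := by norm_num
          rw [h6]
          gcongr
          · linarith
          · nlinarith
      _ = _ := by ring

/-- The variation of the symbol has bounds of size `|h|` at the cost of one order, whence `r + 1` in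
`hM`. The oscillatory integral of a constant is left to be computed. -/
lemma tendsto_transf_zero_aux (hr : 0 ≤ r) (hM : r + 1 - M ≤ -(2 * d + 1)) {B : ℕ → ℝ}
    {f : PS d → V} (hf : SymB r B f) (z : PS d) :
    Tendsto (fun h => oscInt M (fun w => f (z + dil d h w))) (𝓝 0)
      (𝓝 (oscInt M (fun _ : PS d => f z))) := by
  obtain ⟨C, hC0, hC⟩ := exists_norm_oscInt_le (V := V) hM
    (fun k => (1 + ‖z‖) ^ r * 2 ^ r * (B k + B (k + 1)))
  rw [tendsto_iff_norm_sub_tendsto_zero]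
  have hlim : Tendsto (fun h : ℝ => |h| * C) (𝓝 0) (𝓝 0) := by
    have : Continuous (fun h : ℝ => |h| * C) := by fun_prop
    simpa using this.tendsto 0
  refine squeeze_zero' (Eventually.of_forall fun _ => norm_nonneg _) ?_ hlim
  filter_upwards [Metric.closedBall_mem_nhds (0 : ℝ) one_pos] with h hh
  have hh' : |h| ≤ 1 := by simpa using hh
  have h1 := hC |h| _ (abs_nonneg h) (hf.comp_dil_sub hr hh' z)
  rwa [oscInt_sub ((hf.comp_dil hr h z).mono_exp (by linarith))
    ((SymB.const (f z)).mono_exp (by linarith)) hM] at h1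

end Transform

/-! ### The constant `(2π)^d` from Fourier inversion -/

section Normalization

open Filter Topology FourierTransform

variable {d : ℕ} {V : Type} [NormedAddCommGroup V] [NormedSpace ℝ V] [NormedSpace ℂ V]
  [IsScalarTower ℝ ℂ V] [CompleteSpace V]

/-- A bump function on `E d`. -/
def bumpE (d : ℕ) : ContDiffBump (0 : E d) := ⟨1, 2, one_pos, one_lt_two⟩

/-- A complex bump function on `E d`. -/
def bumpC (x : E d) : ℂ := (bumpE d x : ℂ)

lemma contDiff_bumpC : ContDiff ℝ ∞ (bumpC : E d → ℂ) :=
  Complex.ofRealCLM.contDiff.comp (ContDiffBump.contDiff _)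

lemma hasCompactSupport_bumpC : HasCompactSupport (bumpC : E d → ℂ) :=
  (ContDiffBump.hasCompactSupport (bumpE d)).comp_left (g := fun x : ℝ => (x : ℂ)) (by simp)

lemma bumpC_zero : bumpC (0 : E d) = 1 := by
  have : bumpE d 0 = 1 := ContDiffBump.one_of_mem_closedBall _ (by simp [bumpE])
  rw [bumpC, this]; simp

lemma norm_bumpC_le (x : E d) : ‖bumpC x‖ ≤ 1 := by
  rw [bumpC, Complex.norm_real, Real.norm_of_nonneg (ContDiffBump.nonneg _)]
  exact ContDiffBump.le_one _

lemma integrable_fourier_bumpC : Integrable (𝓕 (bumpC : E d → ℂ)) :=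
  (𝓕 (hasCompactSupport_bumpC.toSchwartzMap contDiff_bumpC : 𝓢(E d, ℂ))).integrable

lemma integral_fourier_bumpC : ∫ ξ, 𝓕 (bumpC : E d → ℂ) ξ = 1 := by
  have h1 := contDiff_bumpC.continuous.fourierInv_fourier_eq
    (contDiff_bumpC.continuous.integrable_of_hasCompactSupport hasCompactSupport_bumpC)
    (integrable_fourier_bumpC (d := d))
  have h2 := congrFun h1 0
  rw [bumpC_zero, Real.fourierInv_eq'] at h2
  simpa using h2

/-- A complex bump function on phase space. -/
def bumpPS (w : PS d) : ℂ := bumpC w.1 * bumpC w.2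

lemma contDiff_bumpPS : ContDiff ℝ ∞ (bumpPS : PS d → ℂ) :=
  (contDiff_bumpC.comp contDiff_fst).mul (contDiff_bumpC.comp contDiff_snd)

lemma hasCompactSupport_bumpPS : HasCompactSupport (bumpPS : PS d → ℂ) := by
  refine HasCompactSupport.intro
    (hasCompactSupport_bumpC.isCompact.prod hasCompactSupport_bumpC.isCompact)
    fun w hw => ?_
  have hw' : w.1 ∉ tsupport (bumpC : E d → ℂ) ∨ w.2 ∉ tsupport (bumpC : E d → ℂ) := by
    by_contra! h
    exact hw ⟨h.1, h.2⟩
  rcases hw' with hw | hw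
  · rw [bumpPS, image_eq_zero_of_notMem_tsupport hw, zero_mul]
  · rw [bumpPS, image_eq_zero_of_notMem_tsupport hw, mul_zero]

lemma HasCompactSupport.comp_affine {X Y V : Type} [NormedAddCommGroup X] [NormedSpace ℝ X]
    [NormedAddCommGroup Y] [NormedSpace ℝ Y] [ProperSpace Y] [NormedAddCommGroup V] {f : X → V}
    (hf : HasCompactSupport f) (z : X) (L : Y →L[ℝ] X) {c : ℝ} (hc : 0 < c)
    (hL : ∀ w, c * ‖w‖ ≤ ‖L w‖) : HasCompactSupport (fun w => f (z + L w)) := by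
  obtain ⟨R, hR⟩ := hf.isCompact.isBounded.exists_norm_le
  refine HasCompactSupport.intro (isCompact_closedBall (0 : Y) ((R + ‖z‖) / c)) fun w hw => ?_
  refine image_eq_zero_of_notMem_tsupport fun h => hw ?_
  rw [mem_closedBall_zero_iff, le_div_iff₀ hc]
  have h1 := hR _ h
  have h2 := norm_sub_le (z + L w) z
  rw [add_sub_cancel_left] at h2
  linarith [hL w]

lemma HasCompactSupport.comp_dil {f : PS d → V} (hf : HasCompactSupport f) (z : PS d) {h : ℝ}
    (hh : 0 < h) : HasCompactSupport (fun w => f (z + dil d h w)) :=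
  HasCompactSupport.comp_affine hf z _ (half_pos hh) (le_norm_dil_apply hh.le)

lemma oscInt_eq_integral_of_hasCompactSupport {f : PS d → V} (hf : ContDiff ℝ ∞ f)
    (hs : HasCompactSupport f) (M : ℕ) : oscInt M f = ∫ w, phase w • f w := by
  obtain ⟨B, hB⟩ := SymB.exists_of_hasCompactSupport hf hs (-(2 * d + 1))
  exact oscInt_eq_integral hB le_rfl M

/-- With `u = (δ/2) s` one has `⟨s,θ⟩ = 2π⟨u, θ/(πδ)⟩`, which puts the integral in the `2π`
convention of `𝓕`. -/
lemma integral_exp_bumpC {δ : ℝ} (hδ : 0 < δ) (θ : E d) :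
    ∫ s : E d, phase (s, θ) * bumpC ((δ / 2) • s) =
      ((2 / δ) ^ d : ℝ) • 𝓕 (bumpC : E d → ℂ) ((Real.pi * δ)⁻¹ • θ) := by
  set F : E d → ℂ := fun u => Complex.exp (((-2 * Real.pi *
    inner ℝ u ((Real.pi * δ)⁻¹ • θ) : ℝ) : ℂ) * Complex.I) • bumpC u with hF
  have h1 : (fun s : E d => phase (s, θ) * bumpC ((δ / 2) • s)) = fun s => F ((δ / 2) • s) := by
    ext1 s
    have e : (-2 * Real.pi * ((Real.pi * δ)⁻¹ * (δ / 2 * inner ℝ s θ)) : ℝ) = -inner ℝ s θ := by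
      have := Real.pi_pos
      field_simp
    simp only [hF, inner_smul_left, inner_smul_right, phase, smul_eq_mul, conj_trivial]
    rw [e]
    push_cast
    ring_nf
  rw [h1, Measure.integral_comp_smul volume F, Real.fourier_eq', abs_of_pos (by positivity)]
  congr 1
  simp [div_pow]

/-- After `κ = θ/(πδ)` the Jacobians `(2/δ)^d` and `(πδ)^d` multiply to `(2π)^d`; `δ` remains only
inside the bump. -/
lemma integral_phase_bump {δ : ℝ} (hδ : 0 < δ) :
    ∫ w : PS d, phase w • bumpPS (0 + dil d δ w) =
      ((2 * Real.pi) ^ d : ℝ) •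
        ∫ κ : E d, bumpC ((δ ^ 2 * Real.pi) • κ) * 𝓕 (bumpC : E d → ℂ) κ := by
  have hc : HasCompactSupport (fun w : PS d => phase w • bumpPS (0 + dil d δ w)) :=
    (HasCompactSupport.comp_dil hasCompactSupport_bumpPS 0 hδ).smul_left (f := phase)
  have hcont : Continuous (fun w : PS d => phase w • bumpPS (0 + dil d δ w)) :=
    contDiff_phase.continuous.smul (contDiff_bumpPS.continuous.comp
      (continuous_const.add (dil d δ).continuous))
  have hint := hcont.integrable_of_hasCompactSupport hc (μ := volume)
  rw [Measure.volume_eq_prod] at hint ⊢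
  rw [integral_prod_symm _ hint]
  set F : E d → ℂ := fun κ => bumpC ((δ ^ 2 * Real.pi) • κ) * 𝓕 (bumpC : E d → ℂ) κ with hF
  have h1 : (fun θ : E d => ∫ s : E d, phase (s, θ) • bumpPS (0 + dil d δ (s, θ))) =
      fun θ => ((2 / δ) ^ d : ℝ) • F ((Real.pi * δ)⁻¹ • θ) := by
    ext1 θ
    have h2 : ∀ s : E d, phase (s, θ) • bumpPS (0 + dil d δ (s, θ)) =
        bumpC (δ • θ) * (phase (s, θ) * bumpC ((δ / 2) • s)) := by
      intro s
      rw [zero_add, dil_apply, bumpPS, smul_eq_mul]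
      ring
    simp_rw [h2]
    rw [integral_const_mul, integral_exp_bumpC hδ, mul_smul_comm, hF]
    dsimp only
    rw [smul_smul]
    congr 4
    have := Real.pi_pos
    field_simp
  rw [h1, integral_smul, Measure.integral_comp_smul volume F, smul_smul]
  congr 1
  have := Real.pi_pos
  rw [abs_of_pos (by positivity), finrank_euclideanSpace_fin]
  rw [← inv_pow, inv_inv, ← mul_pow]
  congr 1
  field_simp

/-- Two limits of the same integrals of dilated bumps are compared. Continuity of the transform at
`h = 0` gives the value for the constant `1`, and dominated convergence with Fourier inversion at
the origin gives `(2π)^d`. -/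
lemma oscInt_one {M : ℕ} (hM : 1 - (M : ℝ) ≤ -(2 * d + 1)) :
    oscInt M (fun _ : PS d => (1 : ℂ)) = (2 * Real.pi) ^ d := by
  obtain ⟨B, hB⟩ := SymB.exists_of_hasCompactSupport (contDiff_bumpPS (d := d))
    hasCompactSupport_bumpPS 0
  have h1 := tendsto_transf_zero_aux le_rfl (by linarith) hB 0 (M := M)
  have hδ : Tendsto (fun n : ℕ => 1 / ((n : ℝ) + 1)) atTop (𝓝 0) :=
    tendsto_one_div_add_atTop_nhds_zero_nat
  have h2 := h1.comp hδ
  have h3 : Tendsto (fun n : ℕ => ∫ κ : E d,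
      bumpC (((1 / ((n : ℝ) + 1)) ^ 2 * Real.pi) • κ) * 𝓕 (bumpC : E d → ℂ) κ) atTop
      (𝓝 (∫ κ : E d, 𝓕 (bumpC : E d → ℂ) κ)) := by
    refine tendsto_integral_of_dominated_convergence (fun κ => ‖𝓕 (bumpC : E d → ℂ) κ‖)
      (fun n => ?_) integrable_fourier_bumpC.norm
      (fun n => Eventually.of_forall fun κ => ?_) (Eventually.of_forall fun κ => ?_)
    · exact ((contDiff_bumpC.continuous.comp (continuous_const_smul _)).aestronglyMeasurable).mul
        integrable_fourier_bumpC.aestronglyMeasurable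
    · rw [norm_mul]
      exact mul_le_of_le_one_left (norm_nonneg _) (norm_bumpC_le _)
    · have h4 : Tendsto (fun n : ℕ => ((1 / ((n : ℝ) + 1)) ^ 2 * Real.pi) • κ) atTop
          (𝓝 ((0 ^ 2 * Real.pi) • κ)) := ((hδ.pow 2).mul_const _).smul_const κ
      have h5 := (contDiff_bumpC.continuous.tendsto ((0 ^ 2 * Real.pi) • κ)).comp h4
      have h6 := h5.mul_const (𝓕 (bumpC : E d → ℂ) κ)
      simpa [bumpC_zero] using h6
  rw [integral_fourier_bumpC] at h3
  have h4 := h3.const_smul ((2 * Real.pi) ^ d : ℝ)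
  have h5 : bumpPS (0 : PS d) = 1 := by simp [bumpPS, bumpC_zero]
  rw [h5] at h2
  refine tendsto_nhds_unique h2 ?_
  have h6 : ((2 * Real.pi) ^ d : ℝ) • (1 : ℂ) = (2 * Real.pi) ^ d := by simp
  rw [← h6]
  refine h4.congr fun n => ?_
  have hn : 0 < 1 / ((n : ℝ) + 1) := by positivity
  rw [← integral_phase_bump hn, Function.comp_apply, oscInt_eq_integral_of_hasCompactSupport]
  · exact contDiff_bumpPS.comp (contDiff_const.add (dil d _).contDiff)
  · exact HasCompactSupport.comp_dil hasCompactSupport_bumpPS 0 hn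

lemma oscInt_const {M : ℕ} (hM : 1 - (M : ℝ) ≤ -(2 * d + 1)) (v : V) :
    oscInt M (fun _ : PS d => v) = ((2 * Real.pi) ^ d : ℝ) • v := by
  have h := oscInt_clm_comp (d := d) (ContinuousLinearMap.toSpanSingleton ℂ v)
    ((SymB.const (X := PS d) (1 : ℂ)).mono_exp zero_le_one) hM
  rw [oscInt_one hM] at h
  simp only [ContinuousLinearMap.toSpanSingleton_apply, one_smul] at h
  rw [h, ← ofReal_smul']
  push_cast
  rfl

lemma tendsto_transf_zero {r : ℝ} {M : ℕ} (hr : 0 ≤ r) (hM : r + 1 - M ≤ -(2 * d + 1))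
    {B : ℕ → ℝ} {f : PS d → V} (hf : SymB r B f) (z : PS d) :
    Tendsto (fun h => transf M h f z) (𝓝 0) (𝓝 (f z)) := by
  have h1 := (tendsto_transf_zero_aux hr hM hf z).const_smul (((2 * Real.pi) ^ d)⁻¹ : ℝ)
  rw [oscInt_const (by linarith), smul_smul, inv_mul_cancel₀ (by positivity), one_smul] at h1
  exact h1

end Normalization

/-! ### The evolution equation in `h` for compactly supported amplitudes -/

section Evolution

open Filter Topology

variable {d : ℕ} {V : Type} [NormedAddCommGroup V] [NormedSpace ℝ V] [NormedSpace ℂ V]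
  [IsScalarTower ℝ ℂ V] [CompleteSpace V]

/-- The derivative in the direction `v`. -/
def dirD {X V : Type} [NormedAddCommGroup X] [NormedSpace ℝ X] [NormedAddCommGroup V]
    [NormedSpace ℝ V] (v : X) (f : X → V) (a : X) : V := fderiv ℝ f a v

lemma contDiff_dirD {f : PS d → V} (hf : ContDiff ℝ ∞ f) (v : PS d) : ContDiff ℝ ∞ (dirD v f) :=
  (contDiff_infty_iff_fderiv.1 hf).2.clm_apply contDiff_const

lemma fderiv_dirD {f : PS d → V} (hf : ContDiff ℝ ∞ f) (v : PS d) :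
    fderiv ℝ (dirD v f) = dirD v (fderiv ℝ f) := by
  ext1 a
  exact fderiv_fderiv_apply hf v a

lemma dirD_comm {f : PS d → V} (hf : ContDiff ℝ ∞ f) (u v : PS d) :
    dirD u (dirD v f) = dirD v (dirD u f) := by
  ext1 a
  rw [dirD, fderiv_dirD hf]
  have h1 : DifferentiableAt ℝ (fderiv ℝ f) a :=
    (contDiff_infty_iff_fderiv.1 hf).2.differentiable (by simp) a
  have h2 := (h1.hasFDerivAt.clm_apply (hasFDerivAt_const u a)).fderiv
  change _ = fderiv ℝ (fun a => fderiv ℝ f a u) a v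
  rw [h2]
  simp [dirD]

lemma dirD_comp_dil {f : PS d → V} (hf : ContDiff ℝ ∞ f) (z : PS d) (h : ℝ) (v : PS d) :
    dirD v (fun w => f (z + dil d h w)) = fun w => dirD (dil d h v) f (z + dil d h w) := by
  ext1 w
  have h1 : HasFDerivAt (fun w => z + dil d h w) (dil d h) w :=
    (dil d h).hasFDerivAt.const_add z
  have h2 := ((hf.differentiable (by simp) (z + dil d h w)).hasFDerivAt.comp w h1).fderiv
  change fderiv ℝ (f ∘ fun w => z + dil d h w) w v = _
  rw [h2]
  rfl

lemma dirD_smul (c : ℝ) (v : PS d) (f : PS d → V) : dirD (c • v) f = fun a => c • dirD v f a := by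
  ext1 a
  exact map_smul _ _ _

lemma dirD_fun_smul (c : ℝ) (v : PS d) {f : PS d → V} (hf : ContDiff ℝ ∞ f) :
    dirD v (fun a => c • f a) = fun a => c • dirD v f a := by
  ext1 a
  rw [dirD, fderiv_fun_const_smul (hf.differentiable (by simp) a)]
  rfl

lemma dil_eq_smul (h : ℝ) (w : PS d) : dil d h w = h • dil d 1 w := by simp [dil]

lemma dil_unitPos (h : ℝ) (j : Fin d) : dil d h (unitPos j) = (h / 2) • unitPos j := by
  rw [dil_apply]; ext <;> simp [unitPos]

lemma dil_unitMom (h : ℝ) (j : Fin d) : dil d h (unitMom j) = h • unitMom j := by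
  rw [dil_apply]; ext <;> simp [unitMom]

/-- The operator `-i ⟨∂_ξ, ∂_x⟩`. -/
def mixOp (f : PS d → V) (a : PS d) : V :=
  -Complex.I • ∑ j, dirD (unitMom j) (dirD (unitPos j) f) a

lemma HasCompactSupport.dirD {f : PS d → V} (hs : HasCompactSupport f) (v : PS d) :
    HasCompactSupport (dirD v f) :=
  hs.fderiv_apply ℝ v

lemma contDiff_mixOp {f : PS d → V} (hf : ContDiff ℝ ∞ f) : ContDiff ℝ ∞ (mixOp f) :=
  (ContDiff.sum fun _ _ => contDiff_dirD (contDiff_dirD hf _) _).const_smul _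

lemma HasCompactSupport.mixOp {f : PS d → V} (hs : HasCompactSupport f) :
    HasCompactSupport (mixOp f) := by
  refine hs.mono' fun a ha => ?_
  by_contra hna
  refine ha ?_
  have : ∀ j, TiltedFIO.dirD (unitMom j) (TiltedFIO.dirD (unitPos j) f) a = 0 := by
    intro j
    have h1 : a ∉ tsupport (TiltedFIO.dirD (unitPos j) f) := fun h =>
      hna (tsupport_fderiv_apply_subset ℝ (unitPos j) h)
    have h2 : a ∉ tsupport (TiltedFIO.dirD (unitMom j) (TiltedFIO.dirD (unitPos j) f)) := fun h =>
      h1 (tsupport_fderiv_apply_subset ℝ (unitMom j) h)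
    exact image_eq_zero_of_notMem_tsupport h2
  simp [TiltedFIO.mixOp, this]

lemma fderiv_mixOp {f : PS d → V} (hf : ContDiff ℝ ∞ f) :
    fderiv ℝ (mixOp f) = mixOp (fderiv ℝ f) := by
  ext1 a
  have h1 : ∀ j ∈ (Finset.univ : Finset (Fin d)), DifferentiableAt ℝ
      (dirD (unitMom j) (dirD (unitPos j) f)) a := fun j _ =>
    (contDiff_dirD (contDiff_dirD hf _) _).differentiable (by simp) a
  change fderiv ℝ (fun a => -Complex.I • ∑ j, dirD (unitMom j) (dirD (unitPos j) f) a) a = _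
  rw [fderiv_fun_const_smul (DifferentiableAt.fun_sum h1), fderiv_fun_sum h1, mixOp]
  congr 1
  refine Finset.sum_congr rfl fun j _ => ?_
  rw [fderiv_dirD (contDiff_dirD hf _), fderiv_dirD hf]

lemma SymB.sum {ι X V : Type} [NormedAddCommGroup X] [NormedSpace ℝ X] [NormedAddCommGroup V]
    [NormedSpace ℝ V] (s : Finset ι) {r : ℝ} {B : ι → ℕ → ℝ} {f : ι → X → V}
    (hf : ∀ i ∈ s, SymB r (B i) (f i)) :
    SymB r (fun k => ∑ i ∈ s, B i k) (fun w => ∑ i ∈ s, f i w) := by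
  classical
  induction s using Finset.induction_on with
  | empty =>
    refine ⟨by simpa using contDiff_const, fun k w => ?_⟩
    simp only [Finset.sum_empty, zero_mul]
    rw [iteratedFDeriv_fun_zero]
    simp
  | insert i s hi ih =>
    simp_rw [Finset.sum_insert hi]
    exact (hf i (Finset.mem_insert_self i s)).add
      (ih fun j hj => hf j (Finset.mem_insert_of_mem hj))

lemma SymB.mixOp {r : ℝ} {B : ℕ → ℝ} {f : PS d → V} (hf : SymB r B f) :
    SymB r (fun k => d * B (k + 2)) (mixOp f) := by
  have h1 := (SymB.sum Finset.univ fun j _ =>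
    (hf.fderiv_apply (unitPos j)).fderiv_apply (unitMom j)).const_smul (-Complex.I)
  refine h1.mono le_rfl fun k => le_of_eq ?_
  have e1 : ∀ j : Fin d, ‖unitPos j‖ = 1 := fun j => by simp [unitPos, Prod.norm_def]
  have e2 : ∀ j : Fin d, ‖unitMom j‖ = 1 := fun j => by simp [unitMom, Prod.norm_def]
  simp [e1, e2]

lemma integrable_phase_smul_of_hasCompactSupport {G : PS d → V} (hG : Continuous G)
    (hs : HasCompactSupport G) : Integrable (fun w => phase w • G w) :=
  (contDiff_phase.continuous.smul hG).integrable_of_hasCompactSupport (hs.smul_left (f := phase))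

/-- The phase is an eigenfunction of `∂_v` with eigenvalue `-iℓ`, so integrating by parts trades the
coordinate `ℓ` for the conjugate derivative. -/
lemma integral_phase_coord_smul {G : PS d → V} (hG : ContDiff ℝ ∞ G)
    (hs : HasCompactSupport G) (ℓ : PS d →L[ℝ] ℝ) (v : PS d)
    (hv : ∀ w, fderiv ℝ phase w v = -Complex.I * (ℓ w : ℂ) * phase w) :
    ∫ w, phase w • (ℓ w • G w) = -Complex.I • ∫ w, phase w • dirD v G w := by
  have h0 : ∀ w, fderiv ℝ phase w v • G w = -Complex.I • (phase w • (ℓ w • G w)) := by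
    intro w
    rw [hv, ← ofReal_smul', smul_smul, smul_smul]
    congr 1
    ring
  have hi : Integrable (fun w => phase w • (ℓ w • G w)) :=
    integrable_phase_smul_of_hasCompactSupport (ℓ.continuous.smul hG.continuous)
      (hs.smul_left (f := ℓ))
  have h1 := integral_smul_fderiv_eq_neg_fderiv_smul_of_integrable (𝕜 := ℂ) (μ := volume)
    (f := phase) (g := G) (v := v) (by simp_rw [h0]; exact hi.smul _)
    (integrable_phase_smul_of_hasCompactSupport (contDiff_dirD hG v).continuous
      (HasCompactSupport.dirD hs v))
    (integrable_phase_smul_of_hasCompactSupport hG.continuous hs)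
    (fun w _ => contDiff_phase.differentiable (by simp) w)
    (fun w _ => hG.differentiable (by simp) w)
  simp_rw [h0] at h1
  rw [integral_smul] at h1
  unfold dirD
  rw [h1, ← neg_smul, smul_smul]
  simp

lemma integral_phase_coordPos_smul {G : PS d → V} (hG : ContDiff ℝ ∞ G)
    (hs : HasCompactSupport G) (j : Fin d) :
    ∫ w, phase w • (coordPos j w • G w) = -Complex.I • ∫ w, phase w • dirD (unitMom j) G w :=
  integral_phase_coord_smul hG hs _ _ fun w => by
    rw [hasFDerivAt_phase_apply]
    simp [unitMom, coordPos_apply, inner_single_one_right]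

lemma integral_phase_coordMom_smul {G : PS d → V} (hG : ContDiff ℝ ∞ G)
    (hs : HasCompactSupport G) (j : Fin d) :
    ∫ w, phase w • (coordMom j w • G w) = -Complex.I • ∫ w, phase w • dirD (unitPos j) G w :=
  integral_phase_coord_smul hG hs _ _ fun w => by
    rw [hasFDerivAt_phase_apply]
    simp [unitPos, coordMom_apply, inner_single_one_left]

lemma eq_sum_coord (w : PS d) :
    w = ∑ j, (coordPos j w • unitPos j + coordMom j w • unitMom j) := by
  rw [Finset.sum_add_distrib]
  refine Prod.ext ?_ ?_
  · simp only [Prod.fst_add, Prod.fst_sum, Prod.smul_fst, unitPos, unitMom, smul_zero,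
      Finset.sum_const_zero, add_zero, coordPos_apply, sum_coord_smul_single]
  · simp only [Prod.snd_add, Prod.snd_sum, Prod.smul_snd, unitPos, unitMom, smul_zero,
      Finset.sum_const_zero, zero_add, coordMom_apply, sum_coord_smul_single]

/-- The Euler vector field against `phase`. -/
lemma integral_phase_fderiv_self {q : PS d → V} (hq : ContDiff ℝ ∞ q)
    (hs : HasCompactSupport q) :
    ∫ w, phase w • fderiv ℝ q w w = (2 : ℝ) • ∫ w, phase w • mixOp q w := by
  -- In the Euler field `s·∂_s + θ·∂_θ` each coordinate becomes `-i` times the conjugate derivative.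
  -- The two halves give the same mixed derivatives, hence the factor `2`.
  have e1 : ∀ w, phase w • fderiv ℝ q w w =
      ∑ j, (phase w • (coordPos j w • dirD (unitPos j) q w) +
        phase w • (coordMom j w • dirD (unitMom j) q w)) := by
    intro w
    rw [congrArg (fderiv ℝ q w) (eq_sum_coord w), map_sum, Finset.smul_sum]
    refine Finset.sum_congr rfl fun j _ => ?_
    rw [map_add, map_smul, map_smul, smul_add]
    rfl
  have i1 : ∀ (ℓ : PS d →L[ℝ] ℝ) (v : PS d),
      Integrable (fun w => phase w • (ℓ w • dirD v q w)) := fun ℓ v =>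
    integrable_phase_smul_of_hasCompactSupport (ℓ.continuous.smul (contDiff_dirD hq v).continuous)
      ((HasCompactSupport.dirD hs v).smul_left (f := ℓ))
  have i2 : ∀ j : Fin d, Integrable (fun w => phase w • (coordPos j w • dirD (unitPos j) q w) +
        phase w • (coordMom j w • dirD (unitMom j) q w)) := fun j => (i1 _ _).add (i1 _ _)
  have i3 : ∀ j : Fin d, Integrable (fun w => phase w • dirD (unitMom j) (dirD (unitPos j) q) w) :=
    fun j => integrable_phase_smul_of_hasCompactSupport
      (contDiff_dirD (contDiff_dirD hq _) _).continuous
      (HasCompactSupport.dirD (HasCompactSupport.dirD hs _) _)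
  have e2 : ∀ w, phase w • mixOp q w =
      -Complex.I • ∑ j, phase w • dirD (unitMom j) (dirD (unitPos j) q) w := by
    intro w
    rw [mixOp, smul_comm, Finset.smul_sum]
  simp_rw [e1, e2]
  rw [integral_finsetSum _ fun j _ => i2 j, integral_smul, integral_finsetSum _ fun j _ => i3 j,
    smul_comm, Finset.smul_sum, Finset.smul_sum]
  refine Finset.sum_congr rfl fun j _ => ?_
  rw [integral_add (i1 _ _) (i1 _ _), integral_phase_coordPos_smul (contDiff_dirD hq _)
    (HasCompactSupport.dirD hs _), integral_phase_coordMom_smul (contDiff_dirD hq _)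
    (HasCompactSupport.dirD hs _), dirD_comm hq (unitPos j) (unitMom j), two_smul, smul_add]

/-- The Euler identity for `f(z + dil d h w)`: the chain rule gives `h` on the left and `2 · h²/2`
on the right, as the two blocks scale by `h/2` and `h`. One then divides by `h`. -/
lemma integral_phase_fderiv_dil {f : PS d → V} (hf : ContDiff ℝ ∞ f) (hs : HasCompactSupport f)
    (z : PS d) {h : ℝ} (hh : 0 < h) :
    ∫ w, phase w • fderiv ℝ f (z + dil d h w) (dil d 1 w) =
      h • ∫ w, phase w • mixOp f (z + dil d h w) := by
  have hq : ContDiff ℝ ∞ (fun w => f (z + dil d h w)) :=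
    hf.comp (contDiff_const.add (dil d h).contDiff)
  have h1 := integral_phase_fderiv_self hq (HasCompactSupport.comp_dil hs z hh)
  have e1 : ∀ w, fderiv ℝ (fun w => f (z + dil d h w)) w w =
      h • fderiv ℝ f (z + dil d h w) (dil d 1 w) := by
    intro w
    have e := congrFun (dirD_comp_dil hf z h w) w
    change dirD w _ w = _
    rw [e, dirD, ← map_smul, ← dil_eq_smul]
  have e2 : ∀ w, mixOp (fun w => f (z + dil d h w)) w =
      (h ^ 2 / 2) • mixOp f (z + dil d h w) := by
    intro w
    have e3 : ∀ j, dirD (unitMom j) (dirD (unitPos j) fun w => f (z + dil d h w)) w =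
        (h ^ 2 / 2) • dirD (unitMom j) (dirD (unitPos j) f) (z + dil d h w) := by
      intro j
      rw [dirD_comp_dil hf, dirD_comp_dil (contDiff_dirD hf _), dil_unitPos, dil_unitMom,
        dirD_smul, dirD_smul, dirD_fun_smul _ _ (contDiff_dirD hf _)]
      dsimp only
      rw [smul_smul]
      congr 1
      ring
    rw [mixOp, mixOp, smul_comm (h ^ 2 / 2)]
    simp only [e3, Finset.smul_sum]
  simp_rw [e1, e2, smul_comm (phase _)] at h1
  rw [integral_smul, integral_smul, smul_smul] at h1
  have h2 := congrArg (fun v => h⁻¹ • v) h1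
  simp only [smul_smul, inv_mul_cancel₀ hh.ne', one_smul] at h2
  rw [h2]
  congr 1
  field_simp

/-- Compact support removes the regularization, so one differentiates under the integral; the Euler
identity then turns the radial derivative into `h * mixOp`. -/
lemma hasDerivAt_transf {f : PS d → V} (hf : ContDiff ℝ ∞ f)
    (hs : HasCompactSupport f) (M : ℕ) (z : PS d) {h : ℝ} (hh : 0 < h) :
    HasDerivAt (fun h => transf M h f z) (h • transf M h (mixOp f) z) h := by
  have hT : ∀ {f : PS d → V}, ContDiff ℝ ∞ f → HasCompactSupport f → ∀ t, 0 < t →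
      transf M t f z = (((2 * Real.pi) ^ d)⁻¹ : ℝ) • ∫ w, phase w • f (z + dil d t w) := by
    intro f hf hs t ht
    rw [transf, oscInt_eq_integral_of_hasCompactSupport
      (f := fun w => f (z + dil d t w))
      (hf.comp (contDiff_const.add (dil d t).contDiff)) (HasCompactSupport.comp_dil hs z ht)]
  have h1 : (fun t => transf M t f z) =ᶠ[𝓝 h] fun t =>
      (((2 * Real.pi) ^ d)⁻¹ : ℝ) • ∫ w, phase w • f (z + dil d t w) := by
    filter_upwards [lt_mem_nhds hh] with t ht using hT hf hs t ht
  refine HasDerivAt.congr_of_eventuallyEq ?_ h1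
  rw [hT (contDiff_mixOp hf) (HasCompactSupport.mixOp hs) h hh, smul_comm,
    ← integral_phase_fderiv_dil hf hs z hh]
  refine HasDerivAt.const_smul _ ?_
  -- One power more than integrability needs, because the derivative is evaluated at `dil d 1 w`, of
  -- linear growth.
  set ρ : ℝ := 2 * d + 2 with hρ
  obtain ⟨B, hB⟩ := SymB.exists_of_hasCompactSupport hf hs (-ρ)
  -- For `t > h / 2` the dilation expands by at least `t / 2 > h / 4`, so this expansion constant is
  -- uniform in `t`.
  set c : ℝ := min 1 (h / 4) with hc
  have hc0 : 0 < c := lt_min one_pos (by positivity)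
  have hcont : ∀ t, Continuous (fun w => phase w • f (z + dil d t w)) := fun t =>
    contDiff_phase.continuous.smul (hf.continuous.comp (continuous_const.add (dil d t).continuous))
  have hcont' : Continuous (fun w => phase w • fderiv ℝ f (z + dil d h w) (dil d 1 w)) :=
    contDiff_phase.continuous.smul
      (((contDiff_infty_iff_fderiv.1 hf).2.continuous.comp
        (continuous_const.add (dil d h).continuous)).clm_apply (dil d 1).continuous)
  refine (hasDerivAt_integral_of_dominated_loc_of_deriv_le (μ := volume) (𝕜 := ℝ)
    (F := fun t w => phase w • f (z + dil d t w))
    (F' := fun t w => phase w • fderiv ℝ f (z + dil d t w) (dil d 1 w)) (x₀ := h)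
    (s := Ioi (h / 2)) (bound := fun w => ((1 + ‖z‖) ^ ρ * c ^ (-ρ) * B 1) *
      (1 + ‖w‖) ^ (-(2 * d + 1) : ℝ)) (Ioi_mem_nhds (by linarith))
    (Eventually.of_forall fun t => (hcont t).aestronglyMeasurable)
    ((hcont h).integrable_of_hasCompactSupport
      ((HasCompactSupport.comp_dil hs z hh).smul_left (f := phase)))
    hcont'.aestronglyMeasurable (Eventually.of_forall fun w t ht => ?_)
    ((integrable_decay d).const_mul _) (Eventually.of_forall fun w t ht => ?_)).2
  · have ht' : h / 2 < t := ht
    have ht0 : 0 < t := by linarith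
    have hL : ∀ w : PS d, c * (1 + ‖w‖) ≤ 1 + ‖dil d t w‖ := by
      intro w
      have e1 := le_norm_dil_apply ht0.le w
      have e2 : c ≤ 1 := min_le_left _ _
      have e3 : c ≤ t / 2 := (min_le_right _ _).trans (by linarith)
      have e4 := mul_le_mul_of_nonneg_right e3 (norm_nonneg w)
      linarith
    have h2 := (hB.fderiv.comp_affine_expanding (by positivity) z (dil d t) hc0 hL).norm_le w
    rw [norm_smul, norm_phase, one_mul]
    refine (ContinuousLinearMap.le_opNorm _ _).trans ?_
    have h3 := norm_dil_apply_le 1 w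
    rw [abs_one, one_mul] at h3
    have hB1 := hB.nonneg 1
    have hw := norm_nonneg w
    have p := one_add_norm_rpow_pos w (-ρ)
    have pz := one_add_norm_rpow_pos z ρ
    have pc := Real.rpow_pos_of_pos hc0 (-ρ)
    calc _ ≤ ((1 + ‖z‖) ^ ρ * c ^ (-ρ) * ‖dil d t‖ ^ 0 * B (0 + 1) * (1 + ‖w‖) ^ (-ρ)) *
          (1 + ‖w‖) := by
          gcongr
          linarith
      _ = _ := by
          have : (-(2 * d + 1) : ℝ) = -ρ + 1 := by rw [hρ]; ring
          rw [this, Real.rpow_add (one_add_norm_pos w), Real.rpow_one, zero_add, pow_zero]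
          ring
  · refine HasDerivAt.const_smul _ ?_
    have e1 : HasDerivAt (fun t : ℝ => z + dil d t w) (dil d 1 w) t := by
      have e : (fun t : ℝ => z + dil d t w) = fun t => z + t • dil d 1 w := by
        ext1 t
        rw [dil_eq_smul]
      rw [e]
      simpa using ((hasDerivAt_id t).smul_const (dil d 1 w)).const_add z
    exact (hf.differentiable (by simp) _).hasFDerivAt.comp_hasDerivAt t e1

end Evolution

/-! ### Expansion to first and second order in `h²` -/

section Expansion

open Filter Topology

variable {d : ℕ} {V : Type} [NormedAddCommGroup V] [NormedSpace ℝ V] [NormedSpace ℂ V]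
  [IsScalarTower ℝ ℂ V] [CompleteSpace V] {r : ℝ} {M : ℕ}

/-- The truncation of `f` by a cutoff. -/
def trunc (n : ℕ) (f : PS d → V) (w : PS d) : V := cutoff n w • f w

lemma exists_symB_trunc (B : ℕ → ℝ) :
    ∃ B' : ℕ → ℝ, ∀ (r : ℝ) (f : PS d → V), SymB r B f → ∀ n, SymB r B' (trunc n f) := by
  obtain ⟨Bχ, hχ⟩ := exists_symB_cutoff d
  refine ⟨leibniz Bχ B, fun r f hf n => ?_⟩
  have := (hχ n).smul hf
  rwa [zero_add] at this

lemma contDiff_trunc {f : PS d → V} (hf : ContDiff ℝ ∞ f) (n : ℕ) : ContDiff ℝ ∞ (trunc n f) :=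
  (contDiff_cutoff n).smul hf

lemma hasCompactSupport_trunc (f : PS d → V) (n : ℕ) : HasCompactSupport (trunc n f) :=
  (hasCompactSupport_cutoff n).smul_right

lemma trunc_eventuallyEq (f : PS d → V) (w : PS d) :
    ∀ᶠ n in atTop, trunc n f =ᶠ[𝓝 w] f := by
  filter_upwards [cutoff_eventuallyEq_one w] with n hn
  filter_upwards [hn] with x hx
  rw [trunc, hx, one_smul]

lemma dirD_congr {f g : PS d → V} {w : PS d} (h : f =ᶠ[𝓝 w] g) (v : PS d) :
    dirD v f =ᶠ[𝓝 w] dirD v g := by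
  filter_upwards [h.eventuallyEq_nhds] with x hx
  rw [dirD, dirD, hx.fderiv_eq]

lemma mixOp_congr {f g : PS d → V} {w : PS d} (h : f =ᶠ[𝓝 w] g) : mixOp f w = mixOp g w := by
  rw [mixOp, mixOp]
  congr 1
  exact Finset.sum_congr rfl fun j _ => (dirD_congr (dirD_congr h _) _).eq_of_nhds

lemma tendsto_trunc (f : PS d → V) (w : PS d) :
    Tendsto (fun n => trunc n f w) atTop (𝓝 (f w)) :=
  tendsto_const_nhds.congr' ((trunc_eventuallyEq f w).mono fun _ hn => hn.eq_of_nhds.symm)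

lemma tendsto_mixOp_trunc (f : PS d → V) (w : PS d) :
    Tendsto (fun n => mixOp (trunc n f) w) atTop (𝓝 (mixOp f w)) :=
  tendsto_const_nhds.congr' ((trunc_eventuallyEq f w).mono fun _ hn => (mixOp_congr hn).symm)

lemma tendsto_transf_trunc (hr : 0 ≤ r) (hM : r - M ≤ -(2 * d + 1)) {B : ℕ → ℝ} {f : PS d → V}
    (hf : SymB r B f) (h : ℝ) (z : PS d) :
    Tendsto (fun n => transf M h (trunc n f) z) atTop (𝓝 (transf M h f z)) := by
  obtain ⟨B', hB'⟩ := exists_symB_trunc (d := d) (V := V) B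
  refine Tendsto.const_smul (tendsto_oscInt hM (fun n => (hB' r f hf n).comp_dil hr h z)
    fun w => ?_) _
  filter_upwards [trunc_eventuallyEq f (z + dil d h w)] with n hn
  exact (continuous_const.add (dil d h).continuous).continuousAt.eventually hn

/-- The mean value inequality for `T_t f(z) - (t²/2) c` on `[δ, h]`, then `δ → 0`; the equation is
available only for `t > 0`. It is used with `c = 0` and with `c = mixOp f z`. -/
lemma norm_transf_sub_le_of_hasCompactSupport (hr : 0 ≤ r) (hM : r + 1 - M ≤ -(2 * d + 1))
    {f : PS d → V} (hf : ContDiff ℝ ∞ f) (hs : HasCompactSupport f) (z : PS d) (c : V) {h K : ℝ}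
    (hh : 0 < h) (hK : ∀ t, 0 < t → t ≤ h → ‖t • transf M t (mixOp f) z - t • c‖ ≤ K) :
    ‖transf M h f z - f z - (h ^ 2 / 2) • c‖ ≤ K * h := by
  have hK0 : 0 ≤ K := (norm_nonneg _).trans (hK h hh le_rfl)
  set φ : ℝ → V := fun t => transf M t f z - (t ^ 2 / 2) • c with hφ
  have hd : ∀ t, 0 < t → HasDerivAt φ (t • transf M t (mixOp f) z - t • c) t := by
    intro t ht
    have h1 : HasDerivAt (fun t : ℝ => t ^ 2 / 2) t t := by
      have := (hasDerivAt_pow 2 t).div_const 2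
      simpa using this
    exact (hasDerivAt_transf hf hs M z ht).sub (h1.smul_const c)
  have h1 : ∀ δ, 0 < δ → δ < h → ‖φ h - φ δ‖ ≤ K * h := by
    intro δ hδ hδh
    have h2 := (convex_Icc δ h).norm_image_sub_le_of_norm_hasDerivWithin_le (C := K)
      (fun t ht => (hd t (hδ.trans_le ht.1)).hasDerivWithinAt)
      (fun t ht => hK t (hδ.trans_le ht.1) ht.2) (left_mem_Icc.2 hδh.le) (right_mem_Icc.2 hδh.le)
    refine h2.trans (mul_le_mul_of_nonneg_left ?_ hK0)
    rw [Real.norm_of_nonneg (by linarith)]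
    linarith
  obtain ⟨B, hB⟩ := SymB.exists_of_hasCompactSupport hf hs r
  have h2 : Tendsto φ (𝓝[>] 0) (𝓝 (f z)) := by
    have h3 : Tendsto (fun t : ℝ => (t ^ 2 / 2) • c) (𝓝 0) (𝓝 0) := by
      have : Continuous (fun t : ℝ => (t ^ 2 / 2) • c) := by fun_prop
      simpa using this.tendsto 0
    have h4 := (tendsto_transf_zero hr hM hB z).sub h3
    rw [sub_zero] at h4
    exact h4.mono_left nhdsWithin_le_nhds
  have h3 : Tendsto (fun δ => ‖φ h - φ δ‖) (𝓝[>] 0) (𝓝 ‖φ h - f z‖) := (h2.const_sub _).norm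
  have h4 : ‖φ h - f z‖ ≤ K * h := by
    refine le_of_tendsto h3 ?_
    filter_upwards [Ioo_mem_nhdsGT hh] with δ hδ using h1 δ hδ.1 hδ.2
  rwa [hφ, sub_right_comm] at h4

/-- The velocity `t T_t(mixOp f)` is `O(h)` on `(0, h]`, so the increment is `O(h²)`. The constants
are uniform in the truncation and pass to the limit. -/
lemma exists_norm_transf_sub_le (hr : 0 ≤ r) (hM : r + 1 - M ≤ -(2 * d + 1)) (B : ℕ → ℝ) (H : ℝ) :
    ∃ C, 0 ≤ C ∧ ∀ f : PS d → V, SymB r B f → ∀ h, 0 < h → h ≤ H → ∀ z,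
      ‖transf M h f z - f z‖ ≤ h ^ 2 * C * (1 + ‖z‖) ^ r := by
  obtain ⟨B', hB'⟩ := exists_symB_trunc (d := d) (V := V) B
  have hM' : r - M ≤ -(2 * d + 1) := by linarith
  obtain ⟨C, hC0, hC⟩ := exists_norm_transf_le (V := V) hr hM' (fun k => d * B' (k + 2)) H
  refine ⟨C, hC0, fun f hf h hh hhH z => ?_⟩
  have pz := one_add_norm_rpow_pos z r
  have h1 : ∀ n, ‖transf M h (trunc n f) z - trunc n f z‖ ≤ h ^ 2 * C * (1 + ‖z‖) ^ r := by
    intro n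
    have h2 := norm_transf_sub_le_of_hasCompactSupport hr hM (contDiff_trunc hf.1 n)
      (hasCompactSupport_trunc f n) z (0 : V) hh (K := h * (C * (1 + ‖z‖) ^ r)) fun t ht hth => by
        rw [smul_zero, sub_zero, norm_smul, Real.norm_of_nonneg ht.le]
        have h3 := hC 1 (mixOp (trunc n f)) zero_le_one
          (by simpa using (hB' r f hf n).mixOp) t (by rw [abs_of_pos ht]; linarith) z
        rw [one_mul] at h3
        gcongr
    rw [smul_zero, sub_zero] at h2
    refine h2.trans (le_of_eq (by ring))
  exact le_of_tendsto (((tendsto_transf_trunc hr hM' hf h z).sub (tendsto_trunc f z)).norm)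
    (Eventually.of_forall h1)

/-- The remainder of the second order expansion of `transf`. -/
def expRem (M : ℕ) (h : ℝ) (f : PS d → V) (z : PS d) : V :=
  transf M h f z - f z - (h ^ 2 / 2) • mixOp f z

/-- The remainder of the first order expansion of `transf`. -/
def expRemOne (M : ℕ) (h : ℝ) (f : PS d → V) (z : PS d) : V := transf M h f z - f z

/-- The velocity of the remainder is `t (T_t(mixOp f) - mixOp f)`, which is `O(h³)` by the first
order estimate applied to `mixOp f`. -/
lemma exists_norm_expRem_le (hr : 0 ≤ r) (hM : r + 1 - M ≤ -(2 * d + 1)) (B : ℕ → ℝ) (H : ℝ) :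
    ∃ C, 0 ≤ C ∧ ∀ f : PS d → V, SymB r B f → ∀ h, 0 < h → h ≤ H → ∀ z,
      ‖expRem M h f z‖ ≤ h ^ 4 * C * (1 + ‖z‖) ^ r := by
  obtain ⟨B', hB'⟩ := exists_symB_trunc (d := d) (V := V) B
  have hM' : r - M ≤ -(2 * d + 1) := by linarith
  obtain ⟨C, hC0, hC⟩ := exists_norm_transf_sub_le (V := V) hr hM (fun k => d * B' (k + 2)) H
  refine ⟨C, hC0, fun f hf h hh hhH z => ?_⟩
  have pz := one_add_norm_rpow_pos z r
  have h1 : ∀ n, ‖expRem M h (trunc n f) z‖ ≤ h ^ 4 * C * (1 + ‖z‖) ^ r := by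
    intro n
    have h2 := norm_transf_sub_le_of_hasCompactSupport hr hM (contDiff_trunc hf.1 n)
      (hasCompactSupport_trunc f n) z (mixOp (trunc n f) z) hh
      (K := h * (h ^ 2 * C * (1 + ‖z‖) ^ r)) fun t ht hth => by
        rw [← smul_sub, norm_smul, Real.norm_of_nonneg ht.le]
        have h3 := hC (mixOp (trunc n f)) (hB' r f hf n).mixOp t ht (hth.trans hhH) z
        have h4 : t ^ 2 * C * (1 + ‖z‖) ^ r ≤ h ^ 2 * C * (1 + ‖z‖) ^ r := by gcongr
        exact mul_le_mul hth (h3.trans h4) (norm_nonneg _) hh.le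
    refine h2.trans (le_of_eq (by ring))
  exact le_of_tendsto ((((tendsto_transf_trunc hr hM' hf h z).sub (tendsto_trunc f z)).sub
    ((tendsto_mixOp_trunc f z).const_smul _)).norm) (Eventually.of_forall h1)

lemma contDiff_expRemOne (hr : 0 ≤ r) (hM : r + 1 - M ≤ -(2 * d + 1)) {B : ℕ → ℝ}
    {f : PS d → V} (hf : SymB r B f) (h : ℝ) : ContDiff ℝ ∞ (expRemOne M h f) :=
  (contDiff_transf hr (by linarith) hf h).sub hf.1

lemma contDiff_expRem (hr : 0 ≤ r) (hM : r + 1 - M ≤ -(2 * d + 1)) {B : ℕ → ℝ}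
    {f : PS d → V} (hf : SymB r B f) (h : ℝ) : ContDiff ℝ ∞ (expRem M h f) :=
  (contDiff_expRemOne hr hM hf h).sub ((contDiff_mixOp hf.1).const_smul _)

lemma fderiv_expRemOne (hr : 0 ≤ r) (hM : r + 1 - M ≤ -(2 * d + 1)) {B : ℕ → ℝ} {f : PS d → V}
    (hf : SymB r B f) (h : ℝ) : fderiv ℝ (expRemOne M h f) = expRemOne M h (fderiv ℝ f) := by
  have hM' : r - M ≤ -(2 * d + 1) := by linarith
  ext1 z
  exact ((hasFDerivAt_transf hr hM' hf h z).sub (hf.differentiable z).hasFDerivAt).fderiv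

lemma fderiv_expRem (hr : 0 ≤ r) (hM : r + 1 - M ≤ -(2 * d + 1)) {B : ℕ → ℝ} {f : PS d → V}
    (hf : SymB r B f) (h : ℝ) : fderiv ℝ (expRem M h f) = expRem M h (fderiv ℝ f) := by
  have hM' : r - M ≤ -(2 * d + 1) := by linarith
  ext1 z
  have h1 := ((contDiff_mixOp hf.1).differentiable (by simp) z).hasFDerivAt
  rw [fderiv_mixOp hf.1] at h1
  exact (((hasFDerivAt_transf hr hM' hf h z).sub (hf.differentiable z).hasFDerivAt).sub
    (h1.const_smul (h ^ 2 / 2))).fderiv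

lemma exists_symB_expRemOne (hr : 0 ≤ r) (hM : r + 1 - M ≤ -(2 * d + 1)) (B : ℕ → ℝ) (H : ℝ) :
    ∃ B' : ℕ → ℝ, ∀ f : PS d → V, SymB r B f → ∀ h, 0 < h → h ≤ H →
      SymB r (fun k => h ^ 2 * B' k) (expRemOne M h f) := by
  have key : ∀ k : ℕ, ∃ C, 0 ≤ C ∧ ∀ f : PS d → V, SymB r B f → ∀ h, 0 < h → h ≤ H → ∀ z,
      ‖iteratedFDeriv ℝ k (expRemOne M h f) z‖ ≤ h ^ 2 * C * (1 + ‖z‖) ^ r := by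
    intro k
    induction k generalizing V B with
    | zero =>
      simp_rw [norm_iteratedFDeriv_zero]
      exact exists_norm_transf_sub_le hr hM B H
    | succ k ih =>
      obtain ⟨C, hC0, hC⟩ := ih (V := PS d →L[ℝ] V) (fun k => B (k + 1))
      refine ⟨C, hC0, fun f hf h hh hhH z => ?_⟩
      rw [← norm_iteratedFDeriv_fderiv, fderiv_expRemOne hr hM hf]
      exact hC _ hf.fderiv h hh hhH z
  choose C _ hC using key
  exact ⟨C, fun f hf h hh hhH => ⟨contDiff_expRemOne hr hM hf h, fun k z => hC k f hf h hh hhH z⟩⟩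

lemma exists_symB_expRem (hr : 0 ≤ r) (hM : r + 1 - M ≤ -(2 * d + 1)) (B : ℕ → ℝ) (H : ℝ) :
    ∃ B' : ℕ → ℝ, ∀ f : PS d → V, SymB r B f → ∀ h, 0 < h → h ≤ H →
      SymB r (fun k => h ^ 4 * B' k) (expRem M h f) := by
  have key : ∀ k : ℕ, ∃ C, 0 ≤ C ∧ ∀ f : PS d → V, SymB r B f → ∀ h, 0 < h → h ≤ H → ∀ z,
      ‖iteratedFDeriv ℝ k (expRem M h f) z‖ ≤ h ^ 4 * C * (1 + ‖z‖) ^ r := by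
    intro k
    induction k generalizing V B with
    | zero =>
      simp_rw [norm_iteratedFDeriv_zero]
      exact exists_norm_expRem_le hr hM B H
    | succ k ih =>
      obtain ⟨C, hC0, hC⟩ := ih (V := PS d →L[ℝ] V) (fun k => B (k + 1))
      refine ⟨C, hC0, fun f hf h hh hhH z => ?_⟩
      rw [← norm_iteratedFDeriv_fderiv, fderiv_expRem hr hM hf]
      exact hC _ hf.fderiv h hh hhH z
  choose C _ hC using key
  exact ⟨C, fun f hf h hh hhH => ⟨contDiff_expRem hr hM hf h, fun k z => hC k f hf h hh hhH z⟩⟩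

end Expansion

/-! ### The transposed Weyl operator as a phase integral -/

section Weyl

open Filter Topology FourierTransform

variable {d : ℕ}

lemma norm_osc (ħ t : ℝ) : ‖osc ħ t‖ = 1 := by
  rw [osc, Complex.norm_exp]; simp

lemma contDiff_osc (ħ : ℝ) : ContDiff ℝ ∞ (osc ħ) :=
  (contDiff_const.mul (Complex.ofRealCLM.contDiff.comp (contDiff_id.div_const ħ))).cexp

lemma continuous_osc (ħ : ℝ) : Continuous (osc ħ) := (contDiff_osc ħ).continuous

lemma osc_add (ħ a b : ℝ) : osc ħ (a + b) = osc ħ a * osc ħ b := by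
  rw [osc, osc, osc, ← Complex.exp_add]
  congr 1
  push_cast
  ring

/-- The substitution `x - y = -h s`, `ξ = h θ` with `h² = ħ` removes `ħ` from the exponent. -/
lemma phase_eq_osc {ħ h : ℝ} (hh : 0 < h) (hħ : h ^ 2 = ħ) (s θ : E d) :
    phase (s, θ) = osc ħ (inner ℝ (-h • s) (h • θ)) := by
  rw [phase, osc, inner_smul_left, inner_smul_right, ← hħ]
  congr 1
  have : ((h : ℝ) : ℂ) ≠ 0 := by exact_mod_cast hh.ne'
  push_cast
  simp only [conj_trivial]
  push_cast
  field_simp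

lemma integral_eq_integral_affine (F : E d → ℂ) (y : E d) {c : ℝ} (hc : c ≠ 0) :
    ∫ x, F x = (|c| ^ d : ℝ) • ∫ s, F (y + c • s) := by
  rw [Measure.integral_comp_smul volume (fun u => F (y + u)), integral_add_left_eq_self F y,
    smul_smul, finrank_euclideanSpace_fin, abs_inv, abs_pow, mul_inv_cancel₀, one_smul]
  exact pow_ne_zero _ (abs_ne_zero.2 hc)

lemma exists_symB_schwartz (v : 𝓢(E d, ℂ)) (k : ℕ) : ∃ B, SymB (-(k : ℝ)) B (v : E d → ℂ) := by
  refine ⟨fun n => 2 ^ k * (Finset.Iic (k, n)).sup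
    (fun m => SchwartzMap.seminorm ℝ m.1 m.2) v, v.smooth ⊤, fun n x => ?_⟩
  have h1 := SchwartzMap.one_add_le_sup_seminorm_apply (𝕜 := ℝ) (m := (k, n)) le_rfl le_rfl v x
  have h0 := one_add_norm_pos x
  rw [Real.rpow_neg h0.le, Real.rpow_natCast, ← div_eq_mul_inv, le_div_iff₀ (by positivity),
    mul_comm]
  exact h1

lemma integrable_decayE (d : ℕ) : Integrable (fun x : E d => (1 + ‖x‖) ^ (-(d + 1) : ℝ)) := by
  refine integrable_one_add_norm ?_
  rw [finrank_euclideanSpace_fin]; linarith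

/-- The amplitude of the transposed Weyl operator. -/
def weylAmp (h : ℝ) (p : PS d → ℂ) (v : E d → ℂ) (y : E d) (w : PS d) : ℂ :=
  p ((y, 0) + ((-(h / 2)) • w.1, h • w.2)) * v (y + (-h) • w.1)

/-- The linear map `(s, θ) ↦ (-h s / 2, h θ)`. -/
def dilNeg (d : ℕ) (h : ℝ) : PS d →L[ℝ] PS d :=
  (dil d h).comp ((-ContinuousLinearMap.fst ℝ (E d) (E d)).prod (ContinuousLinearMap.snd ℝ (E d) (E d)))

lemma dilNeg_apply (h : ℝ) (w : PS d) : dilNeg d h w = ((-(h / 2)) • w.1, h • w.2) := by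
  simp [dilNeg, dil_apply]

lemma norm_neg_fst_snd (w : PS d) : ‖((-w.1, w.2) : PS d)‖ = ‖w‖ := by
  simp [Prod.norm_def]

lemma norm_dilNeg_le {h : ℝ} (hh : 0 ≤ h) : ‖dilNeg d h‖ ≤ h := by
  refine ContinuousLinearMap.opNorm_le_bound _ hh fun w => ?_
  have h1 := norm_dil_apply_le h ((-w.1, w.2) : PS d)
  rw [norm_neg_fst_snd, abs_of_nonneg hh] at h1
  exact h1

lemma le_norm_dilNeg_apply {h : ℝ} (hh : 0 ≤ h) (w : PS d) : h / 2 * ‖w‖ ≤ ‖dilNeg d h w‖ := by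
  have h1 := le_norm_dil_apply hh ((-w.1, w.2) : PS d)
  rw [norm_neg_fst_snd] at h1
  exact h1

lemma weylAmp_eq (h : ℝ) (p : PS d → ℂ) (v : E d → ℂ) (y : E d) :
    weylAmp h p v y = fun w => p ((y, 0) + dilNeg d h w) •
      v (y + ((-h) • ContinuousLinearMap.fst ℝ (E d) (E d)) w) := by
  ext1 w
  rw [weylAmp, dilNeg_apply]
  rfl

lemma contDiff_weylAmp (h : ℝ) {p : PS d → ℂ} (hp : ContDiff ℝ ∞ p) (v : 𝓢(E d, ℂ)) (y : E d) :
    ContDiff ℝ ∞ (weylAmp h p v y) := by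
  rw [weylAmp_eq]
  exact (hp.comp (contDiff_const.add (dilNeg d h).contDiff)).smul ((v.smooth ⊤).comp
    (contDiff_const.add (ContinuousLinearMap.contDiff _)))

lemma hasCompactSupport_weylAmp {h : ℝ} (hh : 0 < h) {p : PS d → ℂ} (hs : HasCompactSupport p)
    (v : E d → ℂ) (y : E d) : HasCompactSupport (weylAmp h p v y) := by
  rw [weylAmp_eq]
  exact (HasCompactSupport.comp_affine hs (y, 0) _ (half_pos hh)
    (le_norm_dilNeg_apply hh.le)).smul_right

lemma norm_prod_zero (y : E d) : ‖((y, 0) : PS d)‖ = ‖y‖ := by simp [Prod.norm_def]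

/-- Peetre's inequality converts the decay of `v(y - h s)` into decay in `y`, paid for by growth in
`w` that the integrations by parts absorb. -/
lemma exists_symB_weylAmp {h : ℝ} (hh : 0 ≤ h) {r : ℝ} (hr : 0 ≤ r) (B : ℕ → ℝ) (v : 𝓢(E d, ℂ))
    (k : ℕ) : ∃ B' : ℕ → ℝ, ∀ p : PS d → ℂ, SymB r B p → ∀ y,
      SymB (r + k) (fun j => (1 + ‖y‖) ^ (r - k) * B' j) (weylAmp h p v y) := by
  obtain ⟨Bv, hv⟩ := exists_symB_schwartz v k
  refine ⟨leibniz (fun j => (1 + h) ^ r * h ^ j * B j) (fun j => (1 + h) ^ (k : ℝ) * h ^ j * Bv j),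
    fun p hp y => ?_⟩
  rw [weylAmp_eq]
  have h1 := hp.comp_affine hr ((y, 0) : PS d) (dilNeg d h) (norm_dilNeg_le hh)
  have hL : ‖((-h) • ContinuousLinearMap.fst ℝ (E d) (E d))‖ ≤ h := by
    rw [norm_smul, norm_neg, Real.norm_of_nonneg hh]
    exact mul_le_of_le_one_right hh (ContinuousLinearMap.norm_fst_le _ _ _)
  have h2 := hv.comp_affine_neg (Nat.cast_nonneg k) y _ hL
  rw [norm_prod_zero] at h1
  refine (h1.smul h2).mono le_rfl fun j => le_of_eq ?_
  rw [leibniz, leibniz, Finset.mul_sum]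
  refine Finset.sum_congr rfl fun i _ => ?_
  rw [sub_eq_add_neg, Real.rpow_add (one_add_norm_pos y)]
  ring

lemma weylTranspose_eq_integral {ħ h : ℝ} (hh : 0 < h) (hħ : h ^ 2 = ħ) {p : PS d → ℂ}
    (hp : ContDiff ℝ ∞ p) (hs : HasCompactSupport p) (v : 𝓢(E d, ℂ)) (y : E d) :
    weylTranspose ħ p v y = (ħ ^ d : ℝ) • ∫ w, phase w • weylAmp h p v y w := by
  have hint : Integrable (fun w => phase w • weylAmp h p v y w) :=
    integrable_phase_smul_of_hasCompactSupport (contDiff_weylAmp h hp v y).continuous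
      (hasCompactSupport_weylAmp hh hs v y)
  rw [Measure.volume_eq_prod] at hint ⊢
  rw [integral_prod_symm _ hint, weylTranspose, integral_eq_integral_affine _ 0 hh.ne']
  have h1 : ∀ θ : E d, ∫ x : E d, osc ħ (inner ℝ (x - y) (0 + h • θ)) *
      p ((1 / 2 : ℝ) • (x + y), 0 + h • θ) * v x =
      (h ^ d : ℝ) • ∫ s : E d, phase (s, θ) • weylAmp h p v y (s, θ) := by
    intro θ
    rw [integral_eq_integral_affine _ y (neg_ne_zero.2 hh.ne'), abs_neg, abs_of_pos hh]
    congr 2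
    ext1 s
    rw [zero_add, add_sub_cancel_left, ← phase_eq_osc hh hħ, weylAmp, smul_eq_mul, mul_assoc]
    congr 3
    ext i
    · simp; ring
    · simp
  simp_rw [h1]
  rw [integral_smul, smul_smul, abs_of_pos hh, ← mul_pow, ← sq, hħ]

lemma exists_norm_weylTranspose_le {ħ h : ℝ} (hh : 0 < h) (hħ : h ^ 2 = ħ) (N : ℕ) (B : ℕ → ℝ)
    (v : 𝓢(E d, ℂ)) : ∃ C, ∀ p : PS d → ℂ, SymB N B p → HasCompactSupport p → ∀ y,
      ‖weylTranspose ħ p v y‖ ≤ C * (1 + ‖y‖) ^ (-(d + 1) : ℝ) := by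
  -- The choice `k = N + d + 1` leaves decay `-(d + 1)` in `y`. The amplitude then has order `2N + d
  -- + 1`, so `M = 2N + 3d + 2` just reaches `-(2d + 1)`.
  obtain ⟨B', hB'⟩ := exists_symB_weylAmp hh.le (Nat.cast_nonneg N) B v (N + d + 1)
  obtain ⟨C, hC0, hC⟩ := exists_norm_oscInt_le (d := d) (V := ℂ)
    (r := (N : ℝ) + ((N + d + 1 : ℕ) : ℝ)) (M := 2 * N + 3 * d + 2) (by push_cast; linarith) B'
  refine ⟨ħ ^ d * C, fun p hp hs y => ?_⟩
  have hħ0 : 0 < ħ := by rw [← hħ]; positivity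
  have py := one_add_norm_rpow_pos y (-(d + 1))
  rw [weylTranspose_eq_integral hh hħ hp.1 hs, norm_smul, Real.norm_of_nonneg (by positivity),
    ← oscInt_eq_integral_of_hasCompactSupport (contDiff_weylAmp h hp.1 v y)
      (hasCompactSupport_weylAmp hh hs v y) (2 * N + 3 * d + 2), mul_assoc, mul_comm C]
  have e : (N : ℝ) - ((N + d + 1 : ℕ) : ℝ) = -(d + 1) := by push_cast; ring
  have h1 := hB' p hp y
  rw [e] at h1
  have := hC _ _ py.le h1
  gcongr

/-- Up to a unimodular factor this is the Fourier transform of `g` at `-ξ/(2πħ)`, so integrable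
derivatives give decay of any power. It makes the outer `ξ`-integral of the Weyl operator converge.
-/
lemma exists_fourier_decay {ħ : ℝ} (hħ : 0 < ħ) (K : ℕ) (B : ℕ → ℝ) :
    ∃ C, ∀ (c : ℝ) (g : E d → ℂ), 0 ≤ c → SymB (-(d + 1)) (fun j => c * B j) g → ∀ y ξ : E d,
      ‖∫ x, osc ħ (inner ℝ (x - y) ξ) * g x‖ * (1 + ‖ξ‖) ^ K ≤ c * C := by
  set D : ℝ := ∫ x : E d, (1 + ‖x‖) ^ (-(d + 1) : ℝ) with hD
  have hD0 : 0 ≤ D := integral_nonneg fun x => (one_add_norm_rpow_pos x _).le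
  have key : ∀ n : ℕ, ∃ C, ∀ (c : ℝ) (g : E d → ℂ), 0 ≤ c → SymB (-(d + 1)) (fun j => c * B j) g →
      ∀ y ξ : E d, ‖ξ‖ ^ n * ‖∫ x, osc ħ (inner ℝ (x - y) ξ) * g x‖ ≤ c * C := by
    intro n
    refine ⟨(2 * Real.pi * ħ) ^ n * (2 ^ n * ∑ j ∈ Finset.range (n + 1), B j * D),
      fun c g hc hg y ξ => ?_⟩
    have hi : ∀ j, Integrable (fun x => ‖iteratedFDeriv ℝ j g x‖) := fun j =>
      ((integrable_decayE d).const_mul (c * B j)).mono'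
        ((hg.1.continuous_iteratedFDeriv (by exact_mod_cast le_top)).norm.aestronglyMeasurable)
        (Eventually.of_forall fun x => by rw [norm_norm]; exact hg.2 j x)
    have h1 := Real.pow_mul_norm_iteratedFDeriv_fourier_le (K := 0) (N := ⊤) hg.1
      (fun k j hk _ => by
        obtain rfl : k = 0 := by simpa using hk
        simpa using hi j) (k := 0) (n := n) le_rfl le_top (-(2 * Real.pi * ħ)⁻¹ • ξ)
    have e1 : ‖∫ x, osc ħ (inner ℝ (x - y) ξ) * g x‖ =
        ‖𝓕 g (-(2 * Real.pi * ħ)⁻¹ • ξ)‖ := by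
      have e2 : ∀ x, osc ħ (inner ℝ (x - y) ξ) * g x = osc ħ (-inner ℝ y ξ) *
          (Complex.exp (((-2 * Real.pi * inner ℝ x (-(2 * Real.pi * ħ)⁻¹ • ξ) : ℝ) : ℂ) *
            Complex.I) • g x) := by
        intro x
        have e3 : (-2 * Real.pi * (-(2 * Real.pi * ħ)⁻¹ * inner ℝ x ξ) : ℝ) = inner ℝ x ξ / ħ := by
          have := Real.pi_pos
          field_simp
        rw [inner_sub_left, sub_eq_add_neg, add_comm, osc_add, inner_smul_right, e3, smul_eq_mul,
          mul_assoc, osc, osc, mul_comm Complex.I ((inner ℝ x ξ / ħ : ℝ) : ℂ)]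
      simp_rw [e2]
      rw [integral_const_mul, norm_mul, norm_osc, one_mul, Real.fourier_eq']
    rw [norm_iteratedFDeriv_zero, norm_smul, norm_neg, Real.norm_of_nonneg (by positivity),
      mul_pow, inv_pow] at h1
    rw [e1]
    have hq : 0 < (2 * Real.pi * ħ) ^ n := by positivity
    have h2 : ‖ξ‖ ^ n * ‖𝓕 g (-(2 * Real.pi * ħ)⁻¹ • ξ)‖ =
        (2 * Real.pi * ħ) ^ n * (((2 * Real.pi * ħ) ^ n)⁻¹ * ‖ξ‖ ^ n *
          ‖𝓕 g (-(2 * Real.pi * ħ)⁻¹ • ξ)‖) := by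
      field_simp
    rw [h2, mul_left_comm c]
    refine mul_le_mul_of_nonneg_left (h1.trans ?_) hq.le
    rw [Finset.range_one, Finset.singleton_product, Finset.sum_map]
    simp only [pow_zero, one_mul, Nat.cast_zero, mul_zero, zero_add, Function.Embedding.coeFn_mk]
    rw [mul_left_comm c, Finset.mul_sum (a := c)]
    refine mul_le_mul_of_nonneg_left (Finset.sum_le_sum fun j _ => ?_) (by positivity)
    rw [← mul_assoc, hD, ← integral_const_mul]
    exact integral_mono (hi j) ((integrable_decayE d).const_mul _) fun x => hg.2 j x
  obtain ⟨C0, h0⟩ := key 0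
  obtain ⟨C1, h1⟩ := key K
  refine ⟨2 ^ K * (C0 + C1), fun c g hc hg y ξ => ?_⟩
  have a0 := h0 c g hc hg y ξ
  have a1 := h1 c g hc hg y ξ
  have h2 : (1 + ‖ξ‖) ^ K ≤ 2 ^ K * (1 + ‖ξ‖ ^ K) := by
    refine (add_pow_le zero_le_one (norm_nonneg ξ) K).trans ?_
    rw [one_pow]
    gcongr
    · norm_num
    · omega
  have h3 := norm_nonneg (∫ x, osc ħ (inner ℝ (x - y) ξ) * g x)
  calc _ ≤ ‖∫ x, osc ħ (inner ℝ (x - y) ξ) * g x‖ * (2 ^ K * (1 + ‖ξ‖ ^ K)) := by gcongr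
    _ = 2 ^ K * (‖ξ‖ ^ 0 * ‖∫ x, osc ħ (inner ℝ (x - y) ξ) * g x‖ +
        ‖ξ‖ ^ K * ‖∫ x, osc ħ (inner ℝ (x - y) ξ) * g x‖) := by ring
    _ ≤ 2 ^ K * (c * C0 + c * C1) := by gcongr
    _ = _ := by ring

end Weyl

/-! ### The transposed Weyl operator tested against plane waves -/

section Duality

open Filter Topology

variable {d : ℕ}

/-- The growth of `p` splits among `x`, `y`, `ξ`; `N` powers of the decay of `v` absorb the part in
`x`, and `d + 1` remain for integrability. -/
lemma exists_symB_weylSlice (N : ℕ) (B : ℕ → ℝ) (v : 𝓢(E d, ℂ)) :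
    ∃ B' : ℕ → ℝ, ∀ p : PS d → ℂ, SymB N B p → ∀ y ξ : E d,
      SymB (-(d + 1)) (fun j => ((1 + ‖y‖) ^ N * (1 + ‖ξ‖) ^ N) * B' j)
        (fun x => p ((1 / 2 : ℝ) • (x + y), ξ) * v x) := by
  obtain ⟨Bv, hv⟩ := exists_symB_schwartz v (N + d + 1)
  refine ⟨leibniz (fun j => (1 + 1) ^ (N : ℝ) * 1 ^ j * B j) Bv, fun p hp y ξ => ?_⟩
  set L : E d →L[ℝ] PS d := ((1 / 2 : ℝ) • ContinuousLinearMap.id ℝ (E d)).prod 0 with hL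
  have hL1 : ‖L‖ ≤ 1 := by
    refine ContinuousLinearMap.opNorm_le_bound _ zero_le_one fun x => ?_
    have : L x = ((1 / 2 : ℝ) • x, 0) := rfl
    rw [this, norm_prod_zero, norm_smul, Real.norm_of_nonneg (by norm_num)]
    have := norm_nonneg x
    linarith
  have h1 := (hp.comp_affine (Nat.cast_nonneg N) (((1 / 2 : ℝ) • y, ξ) : PS d) L hL1).smul hv
  have e : (fun x => p ((1 / 2 : ℝ) • (x + y), ξ) * v x) =
      fun x => p (((1 / 2 : ℝ) • y, ξ) + L x) • v x := by
    ext1 x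
    have : L x = ((1 / 2 : ℝ) • x, 0) := rfl
    rw [smul_eq_mul, this, Prod.mk_add_mk, add_zero, ← smul_add, add_comm y]
  rw [e]
  refine h1.mono (by push_cast; linarith) fun j => ?_
  rw [leibniz, leibniz, Finset.mul_sum]
  refine Finset.sum_le_sum fun i _ => ?_
  have hz : (1 + ‖(((1 / 2 : ℝ) • y, ξ) : PS d)‖) ^ (N : ℝ) ≤ (1 + ‖y‖) ^ N * (1 + ‖ξ‖) ^ N := by
    rw [Real.rpow_natCast, ← mul_pow]
    refine pow_le_pow_left₀ (by positivity) ?_ N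
    have h2 : ‖(((1 / 2 : ℝ) • y, ξ) : PS d)‖ ≤ ‖y‖ + ‖ξ‖ := by
      rw [Prod.norm_def]
      refine max_le ?_ (by linarith [norm_nonneg y])
      rw [norm_smul, Real.norm_of_nonneg (by norm_num)]
      change 1 / 2 * ‖y‖ ≤ _
      linarith [norm_nonneg y, norm_nonneg ξ]
    nlinarith [norm_nonneg y, norm_nonneg ξ, mul_nonneg (norm_nonneg y) (norm_nonneg ξ)]
  have hB := hp.nonneg i
  have hBv := hv.nonneg (j - i)
  calc _ = (1 + ‖(((1 / 2 : ℝ) • y, ξ) : PS d)‖) ^ (N : ℝ) *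
        ((j.choose i : ℝ) * ((1 + 1) ^ (N : ℝ) * 1 ^ i * B i) * Bv (j - i)) := by ring
    _ ≤ _ := by gcongr

/-- The inner integral in the definition of the transposed Weyl operator. -/
def weylInner (ħ : ℝ) (p : PS d → ℂ) (v : E d → ℂ) (y ξ : E d) : ℂ :=
  ∫ x : E d, osc ħ (inner ℝ (x - y) ξ) * p ((1 / 2 : ℝ) • (x + y), ξ) * v x

lemma continuous_weylIntegrand (ħ : ℝ) {p : PS d → ℂ} (hp : Continuous p) (v : 𝓢(E d, ℂ)) :
    Continuous (fun t : (E d × E d) × E d => osc ħ (inner ℝ (t.2 - t.1.1) t.1.2) *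
      p ((1 / 2 : ℝ) • (t.2 + t.1.1), t.1.2) * v t.2) := by
  have h1 := continuous_osc ħ
  have h2 := v.continuous
  fun_prop

lemma stronglyMeasurable_weylInner (ħ : ℝ) {p : PS d → ℂ} (hp : Continuous p) (v : 𝓢(E d, ℂ)) :
    StronglyMeasurable (fun t : E d × E d => weylInner ħ p v t.1 t.2) :=
  (continuous_weylIntegrand ħ hp v).stronglyMeasurable.integral_prod_right'

lemma stronglyMeasurable_weylTranspose (ħ : ℝ) {p : PS d → ℂ} (hp : Continuous p)
    (v : 𝓢(E d, ℂ)) : StronglyMeasurable (weylTranspose ħ p v) :=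
  (stronglyMeasurable_weylInner ħ hp v).integral_prod_right'

lemma exists_norm_weylInner_le {ħ : ℝ} (hħ : 0 < ħ) (N : ℕ) (B : ℕ → ℝ) (v : 𝓢(E d, ℂ)) (y : E d) :
    ∃ C, ∀ p : PS d → ℂ, SymB N B p → ∀ ξ,
      ‖weylInner ħ p v y ξ‖ ≤ C * (1 + ‖ξ‖) ^ (-(d + 1) : ℝ) := by
  obtain ⟨B', hB'⟩ := exists_symB_weylSlice N B v
  -- Here `N` powers offset the growth of the slice in `ξ`, and `d + 1` give integrability.
  obtain ⟨C, hC⟩ := exists_fourier_decay (d := d) hħ (N + d + 1) B'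
  refine ⟨(1 + ‖y‖) ^ N * C, fun p hp ξ => ?_⟩
  have h1 := hC _ _ (by positivity) (hB' p hp y ξ) y ξ
  have h0 := one_add_norm_pos ξ
  simp_rw [← mul_assoc] at h1
  have e : (1 + ‖ξ‖) ^ (-(d + 1) : ℝ) = ((1 + ‖ξ‖) ^ (d + 1))⁻¹ := by
    rw [Real.rpow_neg h0.le]
    norm_cast
  rw [e, ← div_eq_mul_inv, le_div_iff₀ (by positivity)]
  refine le_of_mul_le_mul_right (a := (1 + ‖ξ‖) ^ N) ?_ (by positivity)
  calc _ = ‖weylInner ħ p v y ξ‖ * (1 + ‖ξ‖) ^ (N + d + 1) := by ring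
    _ ≤ _ := h1
    _ = _ := by ring

lemma tendsto_weylInner_trunc {ħ : ℝ} (N : ℕ) {B : ℕ → ℝ} (v : 𝓢(E d, ℂ))
    {p : PS d → ℂ} (hp : SymB N B p) (y ξ : E d) :
    Tendsto (fun n => weylInner ħ (trunc n p) v y ξ) atTop (𝓝 (weylInner ħ p v y ξ)) := by
  obtain ⟨Bt, hBt⟩ := exists_symB_trunc (d := d) (V := ℂ) B
  obtain ⟨B', hB'⟩ := exists_symB_weylSlice N Bt v
  refine tendsto_integral_of_dominated_convergence (fun x => ((1 + ‖y‖) ^ N * (1 + ‖ξ‖) ^ N) *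
    B' 0 * (1 + ‖x‖) ^ (-(d + 1) : ℝ)) (fun n => ?_) ((integrable_decayE d).const_mul _)
    (fun n => Eventually.of_forall fun x => ?_) (Eventually.of_forall fun x => ?_)
  · exact ((continuous_weylIntegrand ħ (contDiff_trunc hp.1 n).continuous v).comp
      (Continuous.prodMk_right (y, ξ))).aestronglyMeasurable
  · rw [mul_assoc (osc _ _), norm_mul, norm_osc, one_mul]
    exact (hB' _ (hBt _ _ hp n) y ξ).norm_le x
  · exact ((tendsto_trunc p _).const_mul _).mul_const _

lemma tendsto_weylTranspose_trunc {ħ : ℝ} (hħ : 0 < ħ) (N : ℕ) {B : ℕ → ℝ} (v : 𝓢(E d, ℂ))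
    {p : PS d → ℂ} (hp : SymB N B p) (y : E d) :
    Tendsto (fun n => weylTranspose ħ (trunc n p) v y) atTop (𝓝 (weylTranspose ħ p v y)) := by
  obtain ⟨Bt, hBt⟩ := exists_symB_trunc (d := d) (V := ℂ) B
  obtain ⟨C, hC⟩ := exists_norm_weylInner_le hħ N Bt v y
  refine tendsto_integral_of_dominated_convergence (fun ξ => C * (1 + ‖ξ‖) ^ (-(d + 1) : ℝ))
    (fun n => ?_) ((integrable_decayE d).const_mul _)
    (fun n => Eventually.of_forall fun ξ => hC _ (hBt _ _ hp n) ξ)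
    (Eventually.of_forall fun ξ => tendsto_weylInner_trunc N v hp y ξ)
  exact ((stronglyMeasurable_weylInner ħ (contDiff_trunc hp.1 n).continuous v).comp_measurable
    measurable_prodMk_left).aestronglyMeasurable

/-- Recentring at `x = y - h s` makes the midpoint `x + h s/2` and detaches `v x` from `w`; the
argument of `p` becomes that of `transf`. -/
lemma weylAmp_add (h : ℝ) (p : PS d → ℂ) (v : E d → ℂ) (x : E d) (w : PS d) :
    weylAmp h p v (x + h • w.1) w = p ((x, 0) + dil d h w) * v x := by
  rw [weylAmp, dil_apply]
  congr 2
  · ext i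
    · simp; ring
    · simp
  · simp

lemma exists_norm_amp_le {h : ℝ} (hh : 0 < h) {p : PS d → ℂ}
    (hp : ContDiff ℝ ∞ p) (hs : HasCompactSupport p) (v : 𝓢(E d, ℂ)) :
    ∃ C, 0 ≤ C ∧ ∀ (x : E d) (w : PS d), ‖p ((x, 0) + dil d h w) * v x‖ ≤
      C * ((1 + ‖x‖) ^ (-(d + 1) : ℝ) * (1 + ‖w‖) ^ (-(3 * d + 2) : ℝ)) := by
  -- `3d + 2 = (2d + 1) + (d + 1)`: integrability in `w` plus what Peetre's inequality consumes when
  -- passing from `x` back to `y`. Likewise `4d + 3 = (3d + 2) + (d + 1)` offsets the growth in the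
  -- base point `x`.
  obtain ⟨B, hB⟩ := SymB.exists_of_hasCompactSupport hp hs (-(3 * d + 2))
  obtain ⟨Bv, hv⟩ := exists_symB_schwartz v (4 * d + 3)
  set c : ℝ := min 1 (h / 2) with hc
  have hc0 : 0 < c := lt_min one_pos (by positivity)
  have hL : ∀ w : PS d, c * (1 + ‖w‖) ≤ 1 + ‖dil d h w‖ := by
    intro w
    have e1 := le_norm_dil_apply hh.le w
    have e2 : c ≤ 1 := min_le_left _ _
    have e3 : c ≤ h / 2 := min_le_right _ _
    have e4 := mul_le_mul_of_nonneg_right e3 (norm_nonneg w)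
    linarith
  have pc := Real.rpow_pos_of_pos hc0 (-(3 * d + 2))
  have hB0 := hB.nonneg 0
  have hv0 := hv.nonneg 0
  refine ⟨c ^ (-(3 * d + 2) : ℝ) * B 0 * Bv 0, by positivity, fun x w => ?_⟩
  have h1 := (hB.comp_affine_expanding (by positivity) ((x, 0) : PS d) (dil d h) hc0 hL).norm_le w
  have h2 := hv.norm_le x
  rw [norm_prod_zero, pow_zero] at h1
  have px := one_add_norm_rpow_pos x (3 * d + 2)
  have pw := one_add_norm_rpow_pos w (-(3 * d + 2))
  have e : (1 + ‖x‖) ^ (3 * d + 2 : ℝ) * (1 + ‖x‖) ^ (-((4 * d + 3 : ℕ) : ℝ)) =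
      (1 + ‖x‖) ^ (-(d + 1) : ℝ) := by
    rw [← Real.rpow_add (one_add_norm_pos x)]
    congr 1
    push_cast
    ring
  rw [norm_mul]
  refine (mul_le_mul h1 h2 (norm_nonneg _) (by positivity)).trans (le_of_eq ?_)
  rw [← e]
  ring

lemma integrable_prod_decay (d : ℕ) : Integrable (fun t : E d × PS d =>
    (1 + ‖t.1‖) ^ (-(d + 1) : ℝ) * (1 + ‖t.2‖) ^ (-(2 * d + 1) : ℝ)) (volume.prod volume) :=
  (integrable_decayE d).mul_prod (integrable_decay d)

/-- Translating `θ` by `ζ/h` absorbs the plane wave at `h s`, and moves the base point of the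
amplitude from `(x, 0)` to `(x, ζ)`. -/
lemma osc_mul_phase_add {ħ h : ℝ} (hh : 0 < h) (hħ : h ^ 2 = ħ) (ζ : E d) (w : PS d) :
    osc ħ (inner ℝ (h • w.1) ζ) * phase (w + (0, h⁻¹ • ζ)) = phase w := by
  rw [osc, phase, phase, ← Complex.exp_add, ← hħ]
  congr 1
  simp only [Prod.fst_add, Prod.snd_add, add_zero, inner_add_right, inner_smul_left,
    inner_smul_right, conj_trivial]
  have : ((h : ℝ) : ℂ) ≠ 0 := by exact_mod_cast hh.ne'
  push_cast
  field_simp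
  ring

/-- Fubini with two translations, `y = x + h s` and `θ ↦ θ + ζ/h`. Integrability is checked in both
coordinate systems, `Φ` in `(y, w)` and `Ψ` in `(x, w)`, since the order of integration is exchanged
before and after the first translation. -/
lemma integral_osc_weylTranspose_of_hasCompactSupport {ħ h : ℝ} (hh : 0 < h) (hħ : h ^ 2 = ħ)
    {p : PS d → ℂ} (hp : ContDiff ℝ ∞ p) (hs : HasCompactSupport p) (v : 𝓢(E d, ℂ)) (M : ℕ)
    (ζ : E d) :
    ∫ y, osc ħ (inner ℝ y ζ) * weylTranspose ħ p v y =
      ((2 * Real.pi * ħ) ^ d : ℝ) •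
        ∫ x, osc ħ (inner ℝ x ζ) * transf M h p (x, ζ) * v x := by
  have hħ0 : 0 < ħ := by rw [← hħ]; positivity
  obtain ⟨C, hC0, hC⟩ := exists_norm_amp_le hh hp hs v
  set Φ : E d → PS d → ℂ := fun y w => osc ħ (inner ℝ y ζ) * (phase w * weylAmp h p v y w) with hΦ
  set Ψ : E d → PS d → ℂ := fun x w =>
    osc ħ (inner ℝ (x + h • w.1) ζ) * (phase w * (p ((x, 0) + dil d h w) * v x)) with hΨ
  have hΦΨ : ∀ x w, Φ (x + h • w.1) w = Ψ x w := by
    intro x w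
    simp only [hΦ, hΨ, weylAmp_add]
  have c1 := continuous_osc ħ
  have c2 : Continuous (phase : PS d → ℂ) := contDiff_phase.continuous
  have c3 := hp.continuous
  have c4 := v.continuous
  have hΨi : Integrable (Function.uncurry Ψ) (volume.prod volume) := by
    refine ((integrable_prod_decay d).const_mul C).mono' ?_ (Eventually.of_forall fun t => ?_)
    · refine Continuous.aestronglyMeasurable ?_
      have : Function.uncurry Ψ = fun t : E d × PS d => osc ħ (inner ℝ (t.1 + h • t.2.1) ζ) *
          (phase t.2 * (p ((t.1, 0) + dil d h t.2) * v t.1)) := rfl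
      rw [this]
      fun_prop
    · change ‖osc ħ (inner ℝ (t.1 + h • t.2.1) ζ) *
          (phase t.2 * (p ((t.1, 0) + dil d h t.2) * v t.1))‖ ≤ _
      rw [norm_mul, norm_osc, one_mul, norm_mul, norm_phase, one_mul]
      refine (hC t.1 t.2).trans ?_
      have := one_add_norm_rpow_pos t.1 (-(d + 1))
      gcongr
      · exact one_le_one_add_norm _
      · norm_num
      · norm_num
  have hΦi : Integrable (Function.uncurry Φ) (volume.prod volume) := by
    refine ((integrable_prod_decay d).const_mul (C * (1 + h) ^ (d + 1 : ℝ))).mono' ?_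
      (Eventually.of_forall fun t => ?_)
    · refine Continuous.aestronglyMeasurable ?_
      have : Function.uncurry Φ = fun t : E d × PS d => osc ħ (inner ℝ t.1 ζ) * (phase t.2 *
        (p ((t.1, 0) + ((-(h / 2)) • t.2.1, h • t.2.2)) * v (t.1 + (-h) • t.2.1))) := rfl
      rw [this]
      fun_prop
    · obtain ⟨y, w⟩ := t
      change ‖osc ħ (inner ℝ y ζ) * (phase w * weylAmp h p v y w)‖ ≤ _
      rw [norm_mul, norm_osc, one_mul, norm_mul, norm_phase, one_mul]
      have e1 := weylAmp_add h p v (y + (-h) • w.1) w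
      rw [neg_smul, neg_add_cancel_right] at e1
      rw [e1]
      refine (hC _ w).trans ?_
      have e2 := peetre (r := (d + 1 : ℝ)) (by positivity) y (-(h • w.1))
      have e3 : (1 + ‖-(h • w.1)‖) ^ (d + 1 : ℝ) ≤
          (1 + h) ^ (d + 1 : ℝ) * (1 + ‖w‖) ^ (d + 1 : ℝ) := by
        rw [← Real.mul_rpow (by positivity) (by positivity)]
        refine Real.rpow_le_rpow (by positivity) ?_ (by positivity)
        rw [norm_neg, norm_smul, Real.norm_of_nonneg hh.le]
        have a1 := norm_fst_le w
        have a2 := mul_le_mul_of_nonneg_left a1 hh.le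
        nlinarith [norm_nonneg w]
      have e4 : (1 + ‖w‖) ^ (-(2 * d + 1) : ℝ) =
          (1 + ‖w‖) ^ (d + 1 : ℝ) * (1 + ‖w‖) ^ (-(3 * d + 2) : ℝ) := by
        rw [← Real.rpow_add (one_add_norm_pos w)]
        congr 1
        ring
      have py := one_add_norm_rpow_pos y (-(d + 1))
      have pw := one_add_norm_rpow_pos w (-(3 * d + 2))
      dsimp only
      rw [e4]
      calc _ ≤ C * (((1 + ‖y‖) ^ (-(d + 1) : ℝ) *
            ((1 + h) ^ (d + 1 : ℝ) * (1 + ‖w‖) ^ (d + 1 : ℝ))) * (1 + ‖w‖) ^ (-(3 * d + 2) : ℝ)) := by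
            gcongr
            exact e2.trans (mul_le_mul_of_nonneg_left e3 py.le)
        _ = _ := by ring
  have s1 : ∀ y, osc ħ (inner ℝ y ζ) * weylTranspose ħ p v y = (ħ ^ d : ℝ) • ∫ w, Φ y w := by
    intro y
    rw [weylTranspose_eq_integral hh hħ hp hs, mul_smul_comm, ← integral_const_mul]
    rfl
  have s2 : ∀ w, ∫ y, Φ y w = ∫ x, Ψ x w := by
    intro w
    rw [← integral_add_right_eq_self (fun y => Φ y w) (h • w.1)]
    simp_rw [hΦΨ]
  have s3 : ∀ x, ∫ w, Ψ x w = ((2 * Real.pi) ^ d : ℝ) •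
      (osc ħ (inner ℝ x ζ) * transf M h p (x, ζ) * v x) := by
    intro x
    rw [← integral_add_right_eq_self (fun w => Ψ x w) ((0, h⁻¹ • ζ) : PS d)]
    have s4 : ∀ w : PS d, Ψ x (w + (0, h⁻¹ • ζ)) =
        osc ħ (inner ℝ x ζ) * v x * (phase w • p ((x, ζ) + dil d h w)) := by
      intro w
      have s5 : ((x, 0) : PS d) + dil d h (w + (0, h⁻¹ • ζ)) = (x, ζ) + dil d h w := by
        rw [map_add, dil_apply h (0, h⁻¹ • ζ)]
        simp only [smul_zero, smul_smul, mul_inv_cancel₀ hh.ne', one_smul]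
        have s6 : ((x, 0) : PS d) + (0, ζ) = (x, ζ) := by simp
        rw [add_comm (dil d h w), ← add_assoc, s6]
      simp only [hΨ]
      rw [s5, Prod.fst_add, add_zero, inner_add_left, osc_add, ← osc_mul_phase_add hh hħ ζ w,
        smul_eq_mul]
      ring
    simp_rw [s4]
    rw [integral_const_mul, transf, oscInt_eq_integral_of_hasCompactSupport
      (f := fun w => p ((x, ζ) + dil d h w))
      (hp.comp (contDiff_const.add (dil d h).contDiff)) (HasCompactSupport.comp_dil hs _ hh),
      mul_smul_comm, smul_mul_assoc, smul_smul, mul_inv_cancel₀ (by positivity), one_smul]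
    ring
  simp_rw [s1]
  rw [integral_smul, integral_integral_swap hΦi]
  simp_rw [s2]
  rw [← integral_integral_swap hΨi]
  simp_rw [s3]
  rw [integral_smul, smul_smul, ← mul_pow, mul_comm ħ]

lemma norm_weylTranspose_le {ħ h : ℝ} (hh : 0 < h) (hħ : h ^ 2 = ħ) (N : ℕ) {B : ℕ → ℝ}
    (v : 𝓢(E d, ℂ)) {p : PS d → ℂ} (hp : SymB N B p) :
    ∃ C, ∀ y, (∀ n, ‖weylTranspose ħ (trunc n p) v y‖ ≤ C * (1 + ‖y‖) ^ (-(d + 1) : ℝ)) ∧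
      ‖weylTranspose ħ p v y‖ ≤ C * (1 + ‖y‖) ^ (-(d + 1) : ℝ) := by
  have hħ0 : 0 < ħ := by rw [← hħ]; positivity
  obtain ⟨Bt, hBt⟩ := exists_symB_trunc (d := d) (V := ℂ) B
  obtain ⟨C, hC⟩ := exists_norm_weylTranspose_le hh hħ N Bt v
  have h1 : ∀ y n, ‖weylTranspose ħ (trunc n p) v y‖ ≤ C * (1 + ‖y‖) ^ (-(d + 1) : ℝ) :=
    fun y n => hC _ (hBt _ _ hp n) (hasCompactSupport_trunc p n) y
  exact ⟨C, fun y => ⟨h1 y, le_of_tendsto (tendsto_weylTranspose_trunc hħ0 N v hp y).norm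
    (Eventually.of_forall (h1 y))⟩⟩

lemma integrable_weylTranspose {ħ h : ℝ} (hh : 0 < h) (hħ : h ^ 2 = ħ) (N : ℕ) {B : ℕ → ℝ}
    (v : 𝓢(E d, ℂ)) {p : PS d → ℂ} (hp : SymB N B p) : Integrable (weylTranspose ħ p v) := by
  obtain ⟨C, hC⟩ := norm_weylTranspose_le hh hħ N v hp
  exact ((integrable_decayE d).const_mul C).mono'
    (stronglyMeasurable_weylTranspose ħ hp.1.continuous v).aestronglyMeasurable
    (Eventually.of_forall fun y => (hC y).2)

lemma one_add_norm_pair_le (x ζ : E d) : 1 + ‖((x, ζ) : PS d)‖ ≤ (1 + ‖x‖) * (1 + ‖ζ‖) := by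
  have h2 : ‖((x, ζ) : PS d)‖ ≤ ‖x‖ + ‖ζ‖ := by
    rw [Prod.norm_def]
    exact max_le (by linarith [norm_nonneg ζ]) (by linarith [norm_nonneg x])
  nlinarith [norm_nonneg x, norm_nonneg ζ, mul_nonneg (norm_nonneg x) (norm_nonneg ζ)]

/-- A symbol of polynomial growth times a Schwartz function. -/
lemma exists_norm_mul_schwartz_le (N : ℕ) {B : ℕ → ℝ} (v : 𝓢(E d, ℂ)) :
    ∃ C, 0 ≤ C ∧ ∀ a : PS d → ℂ, SymB N B a → ∀ x ζ : E d,
      ‖a (x, ζ) * v x‖ ≤ C * (1 + ‖ζ‖) ^ N * (1 + ‖x‖) ^ (-(d + 1) : ℝ) := by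
  obtain ⟨Bv, hv⟩ := exists_symB_schwartz v (N + d + 1)
  have hv0 := hv.nonneg 0
  refine ⟨|B 0| * Bv 0, by positivity, fun a ha x ζ => ?_⟩
  have h1 : ‖a (x, ζ)‖ ≤ |B 0| * ((1 + ‖x‖) ^ N * (1 + ‖ζ‖) ^ N) := by
    refine (ha.norm_le (x, ζ)).trans ?_
    rw [Real.rpow_natCast, ← mul_pow]
    have := one_add_norm_pair_le x ζ
    gcongr
    exact le_abs_self _
  have h2 := hv.norm_le x
  rw [norm_mul]
  refine (mul_le_mul h1 h2 (norm_nonneg _) (by positivity)).trans (le_of_eq ?_)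
  have e : (1 + ‖x‖) ^ N * (1 + ‖x‖) ^ (-((N + d + 1 : ℕ) : ℝ)) = (1 + ‖x‖) ^ (-(d + 1) : ℝ) := by
    rw [← Real.rpow_natCast, ← Real.rpow_add (one_add_norm_pos x)]
    congr 1
    push_cast
    ring
  rw [← e]
  ring

/-- Both sides are continuous under truncation of the symbol, by dominated convergence with bounds
uniform in the cutoff. -/
lemma integral_osc_weylTranspose {ħ h : ℝ} (hh : 0 < h) (hħ : h ^ 2 = ħ) {N M : ℕ}
    (hM : (N : ℝ) - M ≤ -(2 * d + 1)) {B : ℕ → ℝ} {p : PS d → ℂ} (hp : SymB N B p)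
    (v : 𝓢(E d, ℂ)) (ζ : E d) :
    ∫ y, osc ħ (inner ℝ y ζ) * weylTranspose ħ p v y =
      ((2 * Real.pi * ħ) ^ d : ℝ) •
        ∫ x, osc ħ (inner ℝ x ζ) * transf M h p (x, ζ) * v x := by
  have hħ0 : 0 < ħ := by rw [← hħ]; positivity
  obtain ⟨C, hC⟩ := norm_weylTranspose_le hh hħ N v hp
  have c1 := continuous_osc ħ
  have h1 : Tendsto (fun n => ∫ y, osc ħ (inner ℝ y ζ) * weylTranspose ħ (trunc n p) v y) atTop
      (𝓝 (∫ y, osc ħ (inner ℝ y ζ) * weylTranspose ħ p v y)) := by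
    refine tendsto_integral_of_dominated_convergence
      (fun y => C * (1 + ‖y‖) ^ (-(d + 1) : ℝ)) (fun n => ?_) ((integrable_decayE d).const_mul _)
      (fun n => Eventually.of_forall fun y => ?_) (Eventually.of_forall fun y => ?_)
    · exact (by fun_prop : Continuous fun y : E d => osc ħ (inner ℝ y ζ)).aestronglyMeasurable.mul
        (stronglyMeasurable_weylTranspose ħ (contDiff_trunc hp.1 n).continuous
          v).aestronglyMeasurable
    · rw [norm_mul, norm_osc, one_mul]
      exact (hC y).1 n
    · exact (tendsto_weylTranspose_trunc hħ0 N v hp y).const_mul _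
  obtain ⟨Bt, hBt⟩ := exists_symB_trunc (d := d) (V := ℂ) B
  obtain ⟨B', hB'⟩ := exists_symB_transf (d := d) (V := ℂ) (Nat.cast_nonneg N) hM Bt h
  obtain ⟨C', _, hC'⟩ := exists_norm_mul_schwartz_le (B := B') N v
  have hT : ∀ n, SymB N B' (transf M h (trunc n p)) := fun n => by
    simpa using hB' 1 _ zero_le_one (by simpa using hBt _ _ hp n) h (abs_of_pos hh).le
  have h2 : Tendsto (fun n => ∫ x, osc ħ (inner ℝ x ζ) * transf M h (trunc n p) (x, ζ) * v x) atTop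
      (𝓝 (∫ x, osc ħ (inner ℝ x ζ) * transf M h p (x, ζ) * v x)) := by
    refine tendsto_integral_of_dominated_convergence
      (fun x => C' * (1 + ‖ζ‖) ^ N * (1 + ‖x‖) ^ (-(d + 1) : ℝ)) (fun n => ?_)
      ((integrable_decayE d).const_mul _)
      (fun n => Eventually.of_forall fun x => ?_) (Eventually.of_forall fun x => ?_)
    · have c2 := (hT n).1.continuous
      have c3 := v.continuous
      exact (by fun_prop : Continuous fun x : E d =>
        osc ħ (inner ℝ x ζ) * transf M h (trunc n p) (x, ζ) * v x).aestronglyMeasurable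
    · rw [mul_assoc, norm_mul, norm_osc, one_mul]
      exact hC' _ (hT n) x ζ
    · exact ((tendsto_transf_trunc (Nat.cast_nonneg N) hM hp h (x, ζ)).const_mul _).mul_const _
  refine tendsto_nhds_unique h1 ((h2.const_smul ((2 * Real.pi * ħ) ^ d : ℝ)).congr fun n => ?_)
  exact (integral_osc_weylTranspose_of_hasCompactSupport hh hħ (contDiff_trunc hp.1 n)
    (hasCompactSupport_trunc p n) v M ζ).symm

end Duality

/-! ### The kernel of `P V_G` and its smooth dependence on `(x, η)` -/

section Kernel

open Filter Topology

variable {d : ℕ}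

lemma sigma_zero (η : E d) : sigma η 0 = Real.sqrt (1 - ‖η‖ ^ 2) := rfl

lemma sigma_succ (η : E d) (k : Fin d) : sigma η k.succ = η k := rfl

lemma gMap_apply (G : Matrix (Fin (d + 1)) (Fin (d + 1)) ℝ) (η : E d) (j : Fin d) :
    gMap G η j = ∑ i, G i j.succ * sigma η i := rfl

/-- The zeroth coordinate of `lift 0 x` vanishes, so moving `G` across the inner product as its
transpose leaves only the components kept by `proj`. -/
lemma inner_act_lift (G : Matrix (Fin (d + 1)) (Fin (d + 1)) ℝ) (x η : E d) :
    inner ℝ (act G (lift 0 x)) (sigma η) = inner ℝ x (gMap G η) := by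
  have h1 : ∀ i, act G (lift 0 x) i = ∑ j : Fin d, G i j.succ * x j := by
    intro i
    change ∑ k, G i k * lift 0 x k = _
    rw [Fin.sum_univ_succ]
    simp [lift]
  simp only [PiLp.inner_apply, gMap_apply, h1, RCLike.inner_apply, conj_trivial,
    Finset.mul_sum, Finset.sum_mul]
  rw [Finset.sum_comm]
  exact Finset.sum_congr rfl fun j _ => Finset.sum_congr rfl fun i _ => by ring

/-- The real square root is continuous everywhere, so continuity, unlike smoothness, holds beyond
the ball and gives measurability on the whole space. -/
lemma continuous_gMap (G : Matrix (Fin (d + 1)) (Fin (d + 1)) ℝ) : Continuous (gMap G) := by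
  refine (PiLp.continuous_toLp 2 _).comp (continuous_pi fun j => ?_)
  change Continuous fun η : E d => ∑ i, G i j.succ * sigma η i
  refine continuous_finsetSum _ fun i _ => continuous_const.mul ?_
  refine Fin.cases ?_ (fun k => ?_) i
  · simp_rw [sigma_zero]
    fun_prop
  · simp_rw [sigma_succ]
    fun_prop

lemma contDiffOn_gMap (G : Matrix (Fin (d + 1)) (Fin (d + 1)) ℝ) :
    ContDiffOn ℝ ∞ (gMap G) (Metric.ball 0 1) := by
  refine contDiffOn_euclidean.2 fun j => ?_
  simp_rw [gMap_apply]
  refine ContDiffOn.sum fun i _ => contDiffOn_const.mul ?_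
  refine Fin.cases ?_ (fun k => ?_) i
  · simp_rw [sigma_zero]
    refine ContDiffOn.sqrt (contDiff_const.sub (contDiff_id.norm_sq ℝ)).contDiffOn fun η hη => ?_
    have h1 : ‖η‖ < 1 := by simpa using hη
    have h2 : 0 < 1 - ‖η‖ ^ 2 := by nlinarith [norm_nonneg η]
    exact h2.ne'
  · simp_rw [sigma_succ]
    exact (contDiff_euclidean.1 contDiff_id k).contDiffOn

/-- The map `(x, η) ↦ (x, g(η))`. -/
def gPair (G : Matrix (Fin (d + 1)) (Fin (d + 1)) ℝ) (z : PS d) : PS d := (z.1, gMap G z.2)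

lemma isOpen_region : IsOpen (region d) := isOpen_univ.prod Metric.isOpen_ball

lemma continuous_gPair (G : Matrix (Fin (d + 1)) (Fin (d + 1)) ℝ) : Continuous (gPair G) :=
  continuous_fst.prodMk ((continuous_gMap G).comp continuous_snd)

lemma contDiffOn_gPair (G : Matrix (Fin (d + 1)) (Fin (d + 1)) ℝ) :
    ContDiffOn ℝ ∞ (gPair G) (region d) :=
  contDiff_fst.contDiffOn.prodMk ((contDiffOn_gMap G).comp contDiff_snd.contDiffOn
    fun _ hz => hz.2)

/-- `gPair G` does not depend on `ħ` and has bounded derivatives on compacts of the region, so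
composition preserves the factor `ħ ^ 2`. -/
lemma isSmoothO_comp_gPair (G : Matrix (Fin (d + 1)) (Fin (d + 1)) ℝ) {ħ₀ : ℝ} {N : ℕ}
    {B : ℕ → ℝ} {R : ℝ → PS d → ℂ}
    (hR : ∀ ħ ∈ Ioc 0 ħ₀, SymB N (fun k => ħ ^ 2 * B k) (R ħ)) :
    IsSmoothO (region d) ħ₀ 2 (fun ħ z => R ħ (gPair G z)) := by
  have hu : UniqueDiffOn ℝ (region d) := isOpen_region.uniqueDiffOn
  refine ⟨fun ħ hħ => (hR ħ hħ).1.comp_contDiffOn (contDiffOn_gPair G), fun S hS hSc k => ?_⟩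
  have h1 : ∀ i : ℕ, ∃ D, ∀ z ∈ S, ‖iteratedFDerivWithin ℝ i (gPair G) (region d) z‖ ≤ D :=
    fun i => hSc.exists_bound_of_continuousOn
      (((contDiffOn_gPair G).continuousOn_iteratedFDerivWithin (by exact_mod_cast le_top) hu).mono hS)
  choose D hD using h1
  obtain ⟨Q, hQ⟩ := hSc.exists_bound_of_continuousOn (continuous_gPair G).continuousOn
  -- The summand `1` ensures `D' ≤ D' ^ i` for `i ≥ 1`, the form required by the composition
  -- estimate.
  set D' : ℝ := 1 + ∑ i ∈ Finset.range (k + 1), |D i| with hD'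
  have hD'1 : 1 ≤ D' := by
    have : 0 ≤ ∑ i ∈ Finset.range (k + 1), |D i| := Finset.sum_nonneg fun _ _ => abs_nonneg _
    linarith
  refine ⟨k.factorial * ((∑ i ∈ Finset.range (k + 1), |B i|) * (1 + |Q|) ^ N) * D' ^ k,
    fun ħ hħ z hz => ?_⟩
  have h2 : ∀ i ≤ k, ‖iteratedFDerivWithin ℝ i (R ħ) univ (gPair G z)‖ ≤
      ħ ^ 2 * ((∑ i ∈ Finset.range (k + 1), |B i|) * (1 + |Q|) ^ N) := by
    intro i hi
    rw [iteratedFDerivWithin_univ]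
    refine ((hR ħ hħ).2 i _).trans ?_
    rw [mul_assoc, Real.rpow_natCast]
    have a1 : B i ≤ ∑ i ∈ Finset.range (k + 1), |B i| :=
      (le_abs_self _).trans (Finset.single_le_sum (f := fun i => |B i|) (fun _ _ => abs_nonneg _)
        (Finset.mem_range.2 (by omega)))
    have a2 := (hQ z hz).trans (le_abs_self Q)
    have a3 : 0 ≤ ∑ i ∈ Finset.range (k + 1), |B i| := Finset.sum_nonneg fun _ _ => abs_nonneg _
    gcongr
  have h3 : ∀ i, 1 ≤ i → i ≤ k →
      ‖iteratedFDerivWithin ℝ i (gPair G) (region d) z‖ ≤ D' ^ i := by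
    intro i hi hik
    have a1 : |D i| ≤ ∑ i ∈ Finset.range (k + 1), |D i| :=
      Finset.single_le_sum (f := fun i => |D i|) (fun _ _ => abs_nonneg _)
        (Finset.mem_range.2 (by omega))
    have a2 : D i ≤ D' := (le_abs_self _).trans (by linarith)
    exact ((hD i z hz).trans a2).trans (le_self_pow₀ hD'1 (by omega))
  have h4 := norm_iteratedFDerivWithin_comp_le (n := k) (hR ħ hħ).1.contDiffOn
    (contDiffOn_gPair G) (by exact_mod_cast le_top) uniqueDiffOn_univ hu (mapsTo_univ _ _)
    (hS hz) h2 h3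
  rw [iteratedFDerivWithin_of_isOpen k isOpen_region (hS hz)] at h4
  refine h4.trans (le_of_eq (by ring))

/-- The kernel of `P V_G` in terms of the amplitude `a`. -/
def kernelPV (ħ : ℝ) (G : Matrix (Fin (d + 1)) (Fin (d + 1)) ℝ) (a : PS d → ℂ) (z : PS d) : ℂ :=
  osc ħ (inner ℝ z.1 (gMap G z.2)) * a (gPair G z)

/-- Fubini reduces the pairing to the plane wave formula at `ζ = g(η)`, and its `(2πħ)^d` cancels
the normalization of `V_G`. -/
lemma isKernelPV_kernelPV {ħ h : ℝ} (hh : 0 < h) (hħ : h ^ 2 = ħ)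
    (G : Matrix (Fin (d + 1)) (Fin (d + 1)) ℝ) {N M : ℕ} (hM : (N : ℝ) - M ≤ -(2 * d + 1))
    {B : ℕ → ℝ} {p : PS d → ℂ} (hp : SymB N B p) :
    IsKernelPV ħ p G (kernelPV ħ G (transf M h p)) := by
  have hħ0 : 0 < ħ := by rw [← hħ]; positivity
  have hT : ∃ B', SymB N B' (transf M h p) := by
    obtain ⟨B', hB'⟩ := exists_symB_transf (d := d) (V := ℂ) (Nat.cast_nonneg N) hM B h
    exact ⟨_, hB' 1 p zero_le_one (by simpa using hp) h (abs_of_pos hh).le⟩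
  obtain ⟨B', hB'⟩ := hT
  have cg := continuous_gMap G
  have co := continuous_osc ħ
  have ct := hB'.1.continuous
  have cp := continuous_gPair G
  refine ⟨?_, fun φ hφ hφs _ v => ?_⟩
  · refine ContDiffOn.mul ((contDiff_osc ħ).comp_contDiffOn ?_)
      (hB'.1.comp_contDiffOn (contDiffOn_gPair G))
    exact contDiff_fst.contDiffOn.inner ℝ ((contDiffOn_gMap G).comp contDiff_snd.contDiffOn
      fun _ hz => hz.2)
  · have cφ := hφ.continuous
    have cv := v.continuous
    have iφ : Integrable φ := cφ.integrable_of_hasCompactSupport hφs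
    have iP := integrable_weylTranspose hh hħ N v hp
    set F : E d × E d → ℂ := fun t =>
      osc ħ (inner ℝ t.1 (gMap G t.2)) * (weylTranspose ħ p v t.1 * φ t.2) with hF
    have iF : Integrable F (volume.prod volume) :=
      (iP.mul_prod iφ).bdd_mul (c := 1)
        (by fun_prop : Continuous fun t : E d × E d =>
          osc ħ (inner ℝ t.1 (gMap G t.2))).aestronglyMeasurable
        (Eventually.of_forall fun t => (norm_osc _ _).le)
    have hV : ∀ y, opV ħ G φ y * weylTranspose ħ p v y =
        (((2 * Real.pi * ħ) ^ d : ℝ) : ℂ)⁻¹ * ∫ η, F (y, η) := by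
      intro y
      rw [opV, mul_assoc, ← integral_mul_const]
      congr 2
      ext1 η
      rw [inner_act_lift, hF]
      ring
    have iK : Integrable (fun z : E d × E d =>
        kernelPV ħ G (transf M h p) z * (v z.1 * φ z.2)) (volume.prod volume) := by
      obtain ⟨C, hC0, hC⟩ := exists_norm_mul_schwartz_le (B := B') N v
      have i1 : Integrable (fun η => (1 + ‖gMap G η‖) ^ N * ‖φ η‖) :=
        (by fun_prop : Continuous (fun η => (1 + ‖gMap G η‖) ^ N * ‖φ η‖))
          |>.integrable_of_hasCompactSupport hφs.norm.mul_left
      refine (((integrable_decayE d).mul_prod i1).const_mul C).mono' ?_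
        (Eventually.of_forall fun z => ?_)
      · refine Continuous.aestronglyMeasurable ?_
        unfold kernelPV
        fun_prop
      · have h1 := hC _ hB' z.1 (gMap G z.2)
        rw [kernelPV, mul_assoc, norm_mul, norm_osc, one_mul, ← mul_assoc, norm_mul]
        refine (mul_le_mul_of_nonneg_right h1 (norm_nonneg _)).trans (le_of_eq (by ring))
    refine ⟨?_, iK, ?_⟩
    · simp_rw [hV]
      exact iF.integral_prod_left.const_mul _
    · simp_rw [hV]
      rw [integral_const_mul, integral_integral_swap (f := fun y η => F (y, η)) iF,
        Measure.volume_eq_prod, integral_prod_symm _ iK, ← integral_const_mul]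
      congr 1
      ext1 η
      have h1 : ∀ y, F (y, η) =
          φ η * (osc ħ (inner ℝ y (gMap G η)) * weylTranspose ħ p v y) := by
        intro y
        simp only [hF]
        ring
      have h2 : ∀ x, kernelPV ħ G (transf M h p) (x, η) * (v (x, η).1 * φ (x, η).2) =
          φ η * (osc ħ (inner ℝ x (gMap G η)) * transf M h p (x, gMap G η) * v x) := by
        intro x
        simp only [kernelPV, gPair]
        ring
      simp_rw [h1, h2]
      rw [integral_const_mul, integral_const_mul, integral_osc_weylTranspose hh hħ hM hp v,
        mul_left_comm, Complex.real_smul, ← mul_assoc (_⁻¹), inv_mul_cancel₀, one_mul]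
      exact_mod_cast (by positivity : ((2 * Real.pi * ħ) ^ d : ℝ) ≠ 0)

lemma mixedDeriv_eq {a : PS d → ℂ} (ha : ContDiff ℝ ∞ a) (x ξ : E d) :
    mixedDeriv a x ξ = ∑ j, dirD (unitMom j) (dirD (unitPos j) a) (x, ξ) := by
  refine Finset.sum_congr rfl fun j _ => ?_
  have h1 : ∀ ξ' : E d, fderiv ℝ (fun x' : E d => a (x', ξ')) x (EuclideanSpace.single j 1) =
      dirD (unitPos j) a (x, ξ') := by
    intro ξ'
    have hi : HasFDerivAt (fun x' : E d => ((x', ξ') : PS d))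
        ((ContinuousLinearMap.id ℝ (E d)).prod 0) x :=
      (hasFDerivAt_id x).prodMk (hasFDerivAt_const ξ' x)
    have e := (HasFDerivAt.comp (g := a) (f := fun x' : E d => ((x', ξ') : PS d)) x
      (ha.differentiable (by simp) (x, ξ')).hasFDerivAt hi).fderiv
    exact congrArg (fun L => L (EuclideanSpace.single j 1)) e
  simp_rw [h1]
  have hi : HasFDerivAt (fun ξ' : E d => ((x, ξ') : PS d))
      ((0 : E d →L[ℝ] E d).prod (ContinuousLinearMap.id ℝ (E d))) ξ :=
    (hasFDerivAt_const x ξ).prodMk (hasFDerivAt_id ξ)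
  have e := (HasFDerivAt.comp (g := dirD (unitPos j) a) (f := fun ξ' : E d => ((x, ξ') : PS d)) ξ
    ((contDiff_dirD ha (unitPos j)).differentiable (by simp) (x, ξ)).hasFDerivAt hi).fderiv
  exact congrArg (fun L => L (EuclideanSpace.single j 1)) e

/-- Comparison with the value at `0`. Polynomial growth is enough, because the conclusion is local
in `(x, η)`. -/
lemma IsOrderFunction.exists_le {m : PS d → ℝ} (hm : IsOrderFunction m) :
    ∃ (C : ℝ) (N : ℕ), ∀ z, m z ≤ C * (1 + ‖z‖) ^ (N : ℝ) := by
  obtain ⟨hpos, C, N, h⟩ := hm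
  refine ⟨|C| * m 0, N, fun z => ?_⟩
  have h1 := h 0 z
  rw [sub_zero] at h1
  rw [Real.rpow_natCast]
  calc m z ≤ C * (1 + ‖z‖) ^ N * m 0 := h1
    _ ≤ |C| * (1 + ‖z‖) ^ N * m 0 := by
      have := (hpos 0).le
      gcongr
      exact le_abs_self C
    _ = _ := by ring

lemma IsSymbolO.exists_symB {m : PS d → ℝ} (hpos : ∀ z, 0 < m z) {C : ℝ} {N : ℕ}
    (hm : ∀ z, m z ≤ C * (1 + ‖z‖) ^ (N : ℝ)) {ħ₀ : ℝ} {n : ℕ} {a : ℝ → PS d → ℂ}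
    (ha : IsSymbolO m ħ₀ n a) :
    ∃ B : ℕ → ℝ, ∀ ħ ∈ Ioc 0 ħ₀, SymB N (fun k => ħ ^ n * B k) (a ħ) := by
  choose Q hQ using ha.2
  refine ⟨fun k => |Q k| * C, fun ħ hħ => ⟨ha.1 ħ hħ, fun k z => ?_⟩⟩
  have h1 := hQ k ħ hħ z
  have h2 := pow_nonneg hħ.1.le n
  calc _ ≤ Q k * ħ ^ n * m z := h1
    _ ≤ |Q k| * ħ ^ n * (C * (1 + ‖z‖) ^ (N : ℝ)) := by
      have := (hpos z).le
      gcongr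
      · exact le_abs_self _
      · exact hm z
    _ = _ := by ring

lemma IsSymbol.exists_symB {m : PS d → ℝ} (hpos : ∀ z, 0 < m z) {C : ℝ} {N : ℕ}
    (hm : ∀ z, m z ≤ C * (1 + ‖z‖) ^ (N : ℝ)) {a : PS d → ℂ} (ha : IsSymbol m a) :
    ∃ B : ℕ → ℝ, SymB N B a := by
  have h1 : IsSymbolO m 1 0 (fun _ => a) :=
    ⟨fun _ _ => ha.1, fun k => (ha.2 k).imp fun Q hQ _ _ z => by simpa using hQ z⟩
  obtain ⟨B, hB⟩ := h1.exists_symB hpos hm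
  exact ⟨B, by simpa using hB 1 ⟨one_pos, le_rfl⟩⟩

end Kernel

end TiltedFIO

end

/-! ### Assembly of the kernel and its expansion -/

open TiltedFIO

theorem mainTheorem6 (d : ℕ) (hd : 1 ≤ d)
    (G : Matrix.GeneralLinearGroup (Fin (d + 1)) ℝ)
    (m : TiltedFIO.E d × TiltedFIO.E d → ℝ) (hm : TiltedFIO.IsOrderFunction m)
    (ħ₀ : ℝ) (hħ₀ : 0 < ħ₀)
    (p : ℝ → TiltedFIO.E d × TiltedFIO.E d → ℂ) (p₀ p₁ : TiltedFIO.E d × TiltedFIO.E d → ℂ)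
    (hp₀ : TiltedFIO.IsSymbol m p₀) (hp₁ : TiltedFIO.IsSymbol m p₁)
    (hp : TiltedFIO.IsSymbolO m ħ₀ 2 (fun ħ z => p ħ z - (p₀ z + (ħ : ℂ) * p₁ z))) :
    ∃ K r : ℝ → TiltedFIO.E d × TiltedFIO.E d → ℂ,
      (∀ ħ ∈ Ioc 0 ħ₀, TiltedFIO.IsKernelPV ħ (p ħ) G.val (K ħ)) ∧
      (∀ ħ ∈ Ioc 0 ħ₀, ∀ x : TiltedFIO.E d, ∀ η ∈ Metric.ball (0 : TiltedFIO.E d) 1,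
        K ħ (x, η) = TiltedFIO.osc ħ (inner ℝ x (TiltedFIO.gMap G.val η)) *
          (p₀ (x, TiltedFIO.gMap G.val η) + (ħ : ℂ) * p₁ (x, TiltedFIO.gMap G.val η)
            - Complex.I * (ħ : ℂ) / 2 * TiltedFIO.mixedDeriv p₀ x (TiltedFIO.gMap G.val η)
            + r ħ (x, η))) ∧
      TiltedFIO.IsSmoothO (TiltedFIO.region d) ħ₀ 2 r := by
  obtain ⟨C, N, hmN⟩ := hm.exists_le
  obtain ⟨B₀, h₀⟩ := hp₀.exists_symB hm.1 hmN
  obtain ⟨B₁, h₁⟩ := hp₁.exists_symB hm.1 hmN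
  obtain ⟨B₂, h₂⟩ := hp.exists_symB hm.1 hmN
  set q : ℝ → PS d → ℂ := fun ħ z => p ħ z - (p₀ z + (ħ : ℂ) * p₁ z) with hq
  have hN : (0 : ℝ) ≤ N := Nat.cast_nonneg N
  -- The least `M` with `N + 1 - M ≤ -(2d + 1)`; the additional `1` is the order lost in the limit
  -- `h → 0`.
  set M : ℕ := N + 2 * d + 2 with hMdef
  have hM1 : (N : ℝ) + 1 - M ≤ -(2 * d + 1) := by rw [hMdef]; push_cast; linarith
  have hM : (N : ℝ) - M ≤ -(2 * d + 1) := by linarith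
  obtain ⟨B₀', h₀'⟩ := exists_symB_expRem (d := d) (V := ℂ) hN hM1 B₀ (Real.sqrt ħ₀)
  obtain ⟨B₁', h₁'⟩ := exists_symB_expRemOne (d := d) (V := ℂ) hN hM1 B₁ (Real.sqrt ħ₀)
  obtain ⟨B₂', h₂'⟩ := exists_symB_transf (d := d) (V := ℂ) hN hM B₂ (Real.sqrt ħ₀)
  -- Three contributions of size `ħ²`: `p₀` expanded to second order, with error `h⁴`; `p₁` to first
  -- order, with error `h²` times `ħ`; and the symbol remainder, for which boundedness of `transf`
  -- suffices.
  set R : ℝ → PS d → ℂ := fun ħ z => expRem M (Real.sqrt ħ) p₀ z +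
    (ħ : ℂ) • expRemOne M (Real.sqrt ħ) p₁ z + transf M (Real.sqrt ħ) (q ħ) z with hRdef
  have hpe : ∀ ħ : ℝ, p ħ = fun z => (p₀ z + (ħ : ℂ) • p₁ z) + q ħ z := by
    intro ħ
    ext1 z
    simp only [hq, smul_eq_mul]
    ring
  refine ⟨fun ħ => kernelPV ħ G.val (transf M (Real.sqrt ħ) (p ħ)),
    fun ħ z => R ħ (gPair G.val z), fun ħ hħ => ?_, fun ħ hħ x η _ => ?_, ?_⟩
  · obtain ⟨B, hs⟩ : ∃ B, SymB N B (p ħ) := by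
      rw [hpe ħ]
      exact ⟨_, (h₀.add (h₁.const_smul (ħ : ℂ))).add (h₂ ħ hħ)⟩
    exact isKernelPV_kernelPV (Real.sqrt_pos.2 hħ.1) (Real.sq_sqrt hħ.1.le) G.val hM hs
  · change osc ħ (inner ℝ x (gMap G.val η)) * transf M (Real.sqrt ħ) (p ħ) (x, gMap G.val η) = _
    congr 1
    have e1 : transf M (Real.sqrt ħ) (p ħ) (x, gMap G.val η) =
        transf M (Real.sqrt ħ) p₀ (x, gMap G.val η) +
          (ħ : ℂ) * transf M (Real.sqrt ħ) p₁ (x, gMap G.val η) +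
          transf M (Real.sqrt ħ) (q ħ) (x, gMap G.val η) := by
      rw [hpe ħ, transf_add hN hM (h₀.add (h₁.const_smul (ħ : ℂ))) (h₂ ħ hħ),
        transf_add hN hM h₀ (h₁.const_smul (ħ : ℂ)), transf_smul h₁.1, smul_eq_mul]
    rw [e1, mixedDeriv_eq h₀.1]
    simp only [hRdef, gPair, expRem, expRemOne, mixOp, Real.sq_sqrt hħ.1.le, smul_eq_mul,
      Complex.real_smul]
    push_cast
    ring
  · refine isSmoothO_comp_gPair G.val (N := N) (B := fun k => B₀' k + B₁' k + B₂' k) fun ħ hħ => ?_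
    have hs0 : 0 < Real.sqrt ħ := Real.sqrt_pos.2 hħ.1
    have hsle : Real.sqrt ħ ≤ Real.sqrt ħ₀ := Real.sqrt_le_sqrt hħ.2
    have hsq : Real.sqrt ħ ^ 2 = ħ := Real.sq_sqrt hħ.1.le
    have hsq4 : Real.sqrt ħ ^ 4 = ħ ^ 2 := by rw [show 4 = 2 * 2 from rfl, pow_mul, hsq]
    have a0 := h₀' p₀ h₀ _ hs0 hsle
    have a1 := (h₁' p₁ h₁ _ hs0 hsle).const_smul (ħ : ℂ)
    have a2 := h₂' (ħ ^ 2) (q ħ) (by positivity) (h₂ ħ hħ) (Real.sqrt ħ)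
      (by rwa [abs_of_pos hs0])
    refine ((a0.add a1).add a2).mono le_rfl fun k => le_of_eq ?_
    rw [hsq4, hsq, Complex.norm_real, Real.norm_of_nonneg hħ.1.le]
    ring
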